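/- Conventions. $H,K$ denote complex Hilbert spaces and $M_n=M_n(\mathbb C)$. For a tuple $A=(A_1,\dots,A_d)$ of bounded self-adjoint operators on $H$, let $S_A=\operatorname{span}\{I,A_1,\dots,A_d\}$, and let the matrix range be $\mathcal W(A)=\bigcup_{n\ge1}\mathcal W_n(A)$, where $\mathcal W_n(A)$ is the set of all $(\phi(A_1),\dots,\phi(A_d))$ with $\phi:C^*(I,A_1,\dots,A_d)\to M_n$ unital completely positive; $\mathcal W_1(A)$ is regarded as a subset of $\mathbb R^d$. A matrix convex set is a graded set $\mathcal T=\bigcup_{n\ge1}\mathcal T_n$, $\mathcal T_n\subseteq M_n^d$, closed under direct sums, simultaneous unitary conjugation, and (entrywise) unital completely positive maps $M_n\to M_k$. For a set $\mathcal S$ of self-adjoint tuples put $$\mathcal S^\bullet_n=\Big\{X\in (M_n)^d_{sa}:\ \sum_j Y_j\otimes X_j\le I\ \text{ for all } Y\in\mathcal S\Big\},$$ and $$\rho_{\mathcal S}=\inf_{n\ge1}\ \sup\{t\ge0:\ t\,\mathcal S_n\subseteq\mathcal T_n\text{ for every matrix convex set }\mathcal T\text{ with }\mathcal S_1\subseteq\mathcal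 T_1\}\in[0,\infty],\qquad \sigma_{\mathcal S}=\rho_{\mathcal S^\bullet}\in[0,\infty].$$ Theorem. Let $A$ be a $d$-tuple of bounded self-adjoint operators on $H$, let $\mathcal S=\mathcal W(A)$, and suppose $0\in\mathcal W_1(A)$. Then $\rho_{\mathcal S}$ and $\sigma_{\mathcal S}$ are finite unless $A=0$, and the following hold. 1. For a real number $t\ge0$, the following are equivalent: (a) for every Hilbert space $K$ and every $d$-tuple $B$ of bounded self-adjoint operators on $K$ such that $I\mapsto I$, $A_i\mapsto B_i$ is a well-defined positive linear map $S_A\to S_B$, the map $I\mapsto I$, $A_i\mapsto tB_i$ is well defined and completely positive; (b) $t\le\sigma_{\mathcal S}$. In particular, if $A\ne0$, then $\sigma_{\mathcal S}$ is the largest constant that works for all $B$. 2. For a real number $t\ge0$, the following are equivalent: (a) for every Hilbert space $K$ and every $d$-tuple $B$ of bounded self-adjoint operators on $K$ such that $I\mapsto I$, $B_i\mapsto A_i$ is a well-defined positive linear map $S_B\to S_A$, the map $I\mapsto I$, $B_i\mapsto tA_i$ is well defined and completely positive; (b) $t\le\rho_{\mathcal S}$. In particular, if $A\ne0$, then $\rho_{\mathcal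 S}$ is the largest constant that works for all $B$. 3. If $0$ is an interior point of $\mathcal W_1(A)$ in $\mathbb R^d$, then $\rho_{\mathcal S}>0$ and $\sigma_{\mathcal S}>0$. 4. If $C>0$ and there are finitely many real $d\times d$ matrices $\lambda^{(1)},\dots,\lambda^{(k)}$ of rank one with $I_d\in\operatorname{conv}\{\lambda^{(1)},\dots,\lambda^{(k)}\}$ and $\lambda^{(m)}\mathcal W_1(A)\subseteq C\,\mathcal W_1(A)$ for all $m$, then $\rho_{\mathcal S}\ge 1/C$ and $\sigma_{\mathcal S}\ge 1/C$. 5. If there is a finite set $\Phi\subset\mathbb R^d$ of vectors of a common length $\ell>0$ and a constant $s>0$ with $\sum_{v\in\Phi}\langle x,v\rangle^2=s\|x\|^2$ for all $x\in\mathbb R^d$ (an isometric tight frame), such that $\mathcal W_1(A)$ is mapped into itself by the orthogonal projection onto $\mathbb Rv$ for each $v\in\Phi$, then $\rho_{\mathcal S}\ge 1/d$ and $\sigma_{\mathcal S}\ge 1/d$ (with $1/d=\infty$ if $d=0$). -/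

import Mathlib

open scoped ComplexOrder InnerProductSpace Kronecker NNReal ENNReal

noncomputable section

/-! ### Matrix orderings and completely positive maps -/

/-- The positive cone of `M_m(V)` for an operator space `V` inside `B(H)`: the `m × m` operator
matrix `(X i j)`, acting on the Hilbert sum of `m` copies of `H`, is positive. -/
def opCone {H : Type*} [NormedAddCommGroup H] [InnerProductSpace ℂ H]
    (V : Submodule ℂ (H →L[ℂ] H)) (m : ℕ) (X : Matrix (Fin m) (Fin m) V) : Prop :=
  ∀ ξ : Fin m → H, 0 ≤ ∑ i, ∑ j, ⟪ξ i, (X i j : H →L[ℂ] H) (ξ j)⟫_ℂ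

/-- The positive cone of `M_m(M_n)`: the `mn × mn` matrix with blocks `X i j` is positive
semidefinite. -/
def matCone (n m : ℕ) (X : Matrix (Fin m) (Fin m) (Matrix (Fin n) (Fin n) ℂ)) : Prop :=
  (Matrix.comp (Fin m) (Fin m) (Fin n) (Fin n) ℂ X).PosSemidef

/-- A linear map between spaces with given matrix orderings `P`, `Q` is completely positive if
each of its amplifications to `m × m` matrices preserves positivity. -/
def IsCP {V W : Type*} [AddCommMonoid V] [Module ℂ V] [AddCommMonoid W] [Module ℂ W]
    (P : ∀ m : ℕ, Matrix (Fin m) (Fin m) V → Prop) (Q : ∀ m : ℕ, Matrix (Fin m) (Fin m) W → Prop)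
    (φ : V →ₗ[ℂ] W) : Prop :=
  ∀ (m : ℕ) (X : Matrix (Fin m) (Fin m) V), P m X → Q m (X.map φ)

/-! ### Matrix convex sets -/

/-- A free set in `d` free dimensions: level `n` is a set of `d`-tuples of complex `n × n`
matrices. Only the levels `n ≥ 1` carry information. -/
abbrev FreeSet (d : ℕ) : Type :=
  (n : ℕ) → Set (Fin d → Matrix (Fin n) (Fin n) ℂ)

/-- The direct sum of an `m × m` and an `n × n` matrix. -/
def matDirectSum {m n : ℕ} (X : Matrix (Fin m) (Fin m) ℂ) (Y : Matrix (Fin n) (Fin n) ℂ) :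
    Matrix (Fin (m + n)) (Fin (m + n)) ℂ :=
  Matrix.reindex finSumFinEquiv finSumFinEquiv (Matrix.fromBlocks X 0 0 Y)

/-- Matrix convex sets: free sets closed under direct sums, under simultaneous unitary
conjugation, and under unital completely positive maps `M_n → M_k`. -/
structure IsMatrixConvex {d : ℕ} (T : FreeSet d) : Prop where
  directSum_mem : ∀ (m n : ℕ), ∀ X ∈ T m, ∀ Y ∈ T n, (fun j => matDirectSum (X j) (Y j)) ∈ T (m + n)
  unitary_mem : ∀ (n : ℕ), ∀ U ∈ Matrix.unitaryGroup (Fin n) ℂ, ∀ X ∈ T n,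
    (fun j => star U * X j * U) ∈ T n
  ucp_mem : ∀ (n k : ℕ) (φ : Matrix (Fin n) (Fin n) ℂ →ₗ[ℂ] Matrix (Fin k) (Fin k) ℂ),
    φ 1 = 1 → IsCP (matCone n) (matCone k) φ → ∀ X ∈ T n, (fun j => φ (X j)) ∈ T k

/-- The first level of a free set of self-adjoint tuples, as a subset of `ℝ^d`. -/
def levelOne {d : ℕ} (S : FreeSet d) : Set (Fin d → ℝ) :=
  {x | (fun j => ((x j : ℂ) • (1 : Matrix (Fin 1) (Fin 1) ℂ))) ∈ S 1}

/-- The self-adjoint polar dual: all self-adjoint tuples `X` with `∑ A_j ⊗ X_j ≤ I` for every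
`A` in any level of `S`. -/
def polarDual {d : ℕ} (S : FreeSet d) : FreeSet d := fun n =>
  {X | (∀ j, (X j).IsHermitian) ∧ ∀ (m : ℕ), ∀ A ∈ S m, (1 - ∑ j, A j ⊗ₖ X j).PosSemidef}

/-- The set of all `t ≥ 0` such that `t S_n ⊆ T_n` for every matrix convex set `T` with
`S_1 ⊆ T_1`. -/
def inclusionScaleSet {d : ℕ} (S : FreeSet d) (n : ℕ) : Set ℝ≥0 :=
  {t | ∀ T : FreeSet d, IsMatrixConvex T → S 1 ⊆ T 1 →
    ∀ X ∈ S n, (fun j => ((t : ℝ) : ℂ) • X j) ∈ T n}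

/-- The `n`-th inclusion scale `ρ_S(n)`, a supremum in `[0, ∞]`. -/
def inclusionScaleAt {d : ℕ} (S : FreeSet d) (n : ℕ) : ℝ≥0∞ :=
  ⨆ t ∈ inclusionScaleSet S n, (t : ℝ≥0∞)

/-- The rank independent inclusion scale `ρ_S = inf_{n ≥ 1} ρ_S(n)`. -/
def inclusionScale {d : ℕ} (S : FreeSet d) : ℝ≥0∞ :=
  ⨅ n : ℕ, ⨅ _ : 1 ≤ n, inclusionScaleAt S n

/-- The dual constant `σ_S`: the rank independent inclusion scale of the polar dual of `S`. -/
def dualInclusionScale {d : ℕ} (S : FreeSet d) : ℝ≥0∞ :=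
  inclusionScale (polarDual S)

/-! ### Operator systems, matrix ranges and maps between tuples -/

section Operators

variable {H : Type*} [NormedAddCommGroup H] [InnerProductSpace ℂ H]

/-- The operator system `S_A` generated by a self-adjoint tuple `A`, the span of
`I, A_1, …, A_d`. -/
def opSystem {d : ℕ} (A : Fin d → H →L[ℂ] H) : Submodule ℂ (H →L[ℂ] H) :=
  Submodule.span ℂ (insert 1 (Set.range A))

lemma one_mem_opSystem {d : ℕ} (A : Fin d → H →L[ℂ] H) : 1 ∈ opSystem A :=
  Submodule.subset_span (Set.mem_insert _ _)

lemma mem_opSystem {d : ℕ} (A : Fin d → H →L[ℂ] H) (i : Fin d) : A i ∈ opSystem A :=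
  Submodule.subset_span (Set.mem_insert_of_mem _ ⟨i, rfl⟩)

/-- The unital C*-algebra generated by the tuple `A`, as a subspace of `B(H)`. -/
def cstarGenerated [CompleteSpace H] {d : ℕ} (A : Fin d → H →L[ℂ] H) : Submodule ℂ (H →L[ℂ] H) :=
  (StarAlgebra.adjoin ℂ (Set.range A)).topologicalClosure.toSubalgebra.toSubmodule

lemma one_mem_cstarGenerated [CompleteSpace H] {d : ℕ} (A : Fin d → H →L[ℂ] H) :
    1 ∈ cstarGenerated A :=
  one_mem (StarAlgebra.adjoin ℂ (Set.range A)).topologicalClosure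

lemma mem_cstarGenerated [CompleteSpace H] {d : ℕ} (A : Fin d → H →L[ℂ] H) (i : Fin d) :
    A i ∈ cstarGenerated A :=
  StarSubalgebra.le_topologicalClosure _ (StarAlgebra.subset_adjoin ℂ (Set.range A) ⟨i, rfl⟩)

/-- The matrix range `W(A)`: level `n` consists of all `(φ(A_1), …, φ(A_d))` for `φ` a unital
completely positive map from the unital C*-algebra generated by `A` to `M_n`. -/
def matrixRange [CompleteSpace H] {d : ℕ} (A : Fin d → H →L[ℂ] H) : FreeSet d := fun n =>
  {X | ∃ φ : cstarGenerated A →ₗ[ℂ] Matrix (Fin n) (Fin n) ℂ,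
    φ ⟨1, one_mem_cstarGenerated A⟩ = 1 ∧ IsCP (opCone (cstarGenerated A)) (matCone n) φ ∧
    ∀ j, φ ⟨A j, mem_cstarGenerated A j⟩ = X j}

variable {K : Type*} [NormedAddCommGroup K] [InnerProductSpace ℂ K]

/-- `φ : S_A → S_B` is the linear map with `I ↦ I` and `A_i ↦ B_i`. -/
def IsUnitalMapSending {d : ℕ} (A : Fin d → H →L[ℂ] H) (B : Fin d → K →L[ℂ] K)
    (φ : opSystem A →ₗ[ℂ] opSystem B) : Prop :=
  φ ⟨1, one_mem_opSystem A⟩ = ⟨1, one_mem_opSystem B⟩ ∧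
    ∀ i, φ ⟨A i, mem_opSystem A i⟩ = ⟨B i, mem_opSystem B i⟩

/-- `I ↦ I`, `A_i ↦ B_i` is a well-defined positive linear map `S_A → S_B`. -/
def UnitalMapIsPositive {d : ℕ} (A : Fin d → H →L[ℂ] H) (B : Fin d → K →L[ℂ] K) : Prop :=
  ∃ φ : opSystem A →ₗ[ℂ] opSystem B, IsUnitalMapSending A B φ ∧
    ∀ x : opSystem A, (x : H →L[ℂ] H).IsPositive → (φ x : K →L[ℂ] K).IsPositive

/-- `I ↦ I`, `A_i ↦ B_i` is a well-defined completely positive linear map `S_A → S_B`. -/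
def UnitalMapIsCP {d : ℕ} (A : Fin d → H →L[ℂ] H) (B : Fin d → K →L[ℂ] K) : Prop :=
  ∃ φ : opSystem A →ₗ[ℂ] opSystem B, IsUnitalMapSending A B φ ∧
    IsCP (opCone (opSystem A)) (opCone (opSystem B)) φ

end Operators

/-! ### Symmetry conditions on subsets of `ℝ^d` -/

/-- There are finitely many rank one real matrices `λ^(1), …, λ^(k)` whose convex hull contains
the identity such that `λ^(m) L ⊆ C L` for all `m`. -/
def IsRankOneSymmetric {d : ℕ} (L : Set (Fin d → ℝ)) (C : ℝ) : Prop :=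
  ∃ (k : ℕ) (l : Fin k → Matrix (Fin d) (Fin d) ℝ),
    (∀ m, (l m).rank = 1) ∧ (1 : Matrix (Fin d) (Fin d) ℝ) ∈ convexHull ℝ (Set.range l) ∧
    ∀ m, ∀ x ∈ L, ∃ y ∈ L, (l m).mulVec x = C • y

/-- A finite set of vectors of `ℝ^d` of common length `r > 0` is an isometric tight frame if
`∑_v ⟨x, v⟩² = s ‖x‖²` for all `x`, with a constant `s > 0`. -/
def IsIsometricTightFrame {d : ℕ} (F : Finset (Fin d → ℝ)) : Prop :=
  (∃ r : ℝ, 0 < r ∧ ∀ v ∈ F, v ⬝ᵥ v = r ^ 2) ∧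
    ∃ s : ℝ, 0 < s ∧ ∀ x : Fin d → ℝ, ∑ v ∈ F, (x ⬝ᵥ v) ^ 2 = s * (x ⬝ᵥ x)

/-- `L` is invariant under the orthogonal projections onto the lines spanned by the vectors of
some isometric tight frame. -/
def IsTightFrameInvariant {d : ℕ} (L : Set (Fin d → ℝ)) : Prop :=
  ∃ F : Finset (Fin d → ℝ), IsIsometricTightFrame F ∧
    ∀ v ∈ F, ∀ x ∈ L, ((x ⬝ᵥ v) / (v ⬝ᵥ v)) • v ∈ L

end

/-! Everything is a duality between cones of pencils and sets of tuples. A tuple `C` of Hermitian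
matrices is positive at `a` when `∑ C_κ ⊗ a_κ ≥ 0`, with the unit put in front of `A`. The map `I ↦
I`, `A_i ↦ B_i` is completely positive exactly when every pencil positive at `A` is positive at `B`
(`unitalMapIsCP_iff`), and positive exactly when this holds for scalar pencils
(`unitalMapIsPositive_iff`). By M. Riesz extension the matrix range is the set of Hermitian tuples
dual to the pencils positive at `A` (`mem_matrixRange_iff`).

A tuple lies in every matrix convex set over `L` once `(1, X)` is a finite sum of terms `(1, x) ⊗
ζ*ζ` with `x ∈ L`, that is, once `X` is a compression of a diagonal tuple with spectrum in `L`.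
Hahn–Banach identifies the closed cone of such sums with the dual of the pencils positive on `L`. In
the other direction, the dual of any family of pencils closed under compression is matrix convex
(`isMatrixConvex_conePolar`), which supplies the sets on which an inclusion scale is tested.

For `ρ`: if `B_i ↦ A_i` is positive, the dual of the pencils positive at `B` is a matrix convex set
containing `W_1(A)`; applying the scale to compressions of `A` gives complete positivity.
Conversely, the diagonal tuple on `ℓ²(W_1(A))` is an extremal `B`, and complete positivity for it is
the separation criterion. For `σ`: a pencil positive at `A`, normalized so that its constant term is
`1`, is up to sign a member of the polar dual. This exchanges tuples with pencils and both
implications follow in the same style; the normalization costs an `ε`. The polar of `W_1(A)` need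
not be compact, so there membership is obtained only after shrinking, which is harmless for a
supremum.

The lower bounds come from one-variable pencils. If `λ = u vᵀ`, then substituting `λA / C` in a
pencil leaves a pencil in the single operator `∑ v_j A_j`, and such a pencil is positive as soon as
it is positive at two scalars enclosing that operator (`tensorForm_interval_nonneg`). Averaging over
the `λ` recovers `A / C`. Interior points and tight frames provide such `λ`. Finiteness follows from
`B = A`: if `A ↦ tA` is positive for all `t`, then `A = 0`. -/

noncomputable section

/-! ### The bilinear pairing of matrix tuples and its behaviour under compression. -/

section Pairing

variable {ι : Type*} [Fintype ι] {k m n : ℕ}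

/-- The tuple `A` preceded by the unit. -/
def homog {R : Type*} [One R] {d : ℕ} (A : Fin d → R) : Option (Fin d) → R := fun o => o.elim 1 A

@[simp] lemma homog_none {R : Type*} [One R] {d : ℕ} (A : Fin d → R) : homog A none = 1 := rfl

@[simp] lemma homog_some {R : Type*} [One R] {d : ℕ} (A : Fin d → R) (j : Fin d) :
    homog A (some j) = A j := rfl

/-- The bilinear pairing `∑_κ tr (C_κ Y_κᵀ)` of tuples of matrices. -/
def pairing (C Y : ι → Matrix (Fin n) (Fin n) ℂ) : ℂ := ∑ κ, ∑ i, ∑ j, C κ i j * Y κ i j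

/-- The tuple with components `V* C_κ V`. -/
def compress {ι : Type*} (V : Matrix (Fin k) (Fin n) ℂ) (C : ι → Matrix (Fin k) (Fin k) ℂ) :
    ι → Matrix (Fin n) (Fin n) ℂ := fun κ => V.conjTranspose * C κ * V

lemma pairing_eq_trace (C Y : ι → Matrix (Fin n) (Fin n) ℂ) :
    pairing C Y = ∑ κ, (C κ * (Y κ).transpose).trace := by
  simp [pairing, Matrix.trace, Matrix.mul_apply]

/-- Since the pairing is `tr (C Yᵀ)`, cyclicity of the trace moves `V` across as its transpose. This
is the exchange used whenever vectors are absorbed into coefficients. -/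
lemma pairing_compress (V : Matrix (Fin k) (Fin n) ℂ) (C : ι → Matrix (Fin k) (Fin k) ℂ)
    (Y : ι → Matrix (Fin n) (Fin n) ℂ) :
    pairing (compress V C) Y = pairing C (compress V.transpose Y) := by
  rw [pairing_eq_trace, pairing_eq_trace]
  refine Finset.sum_congr rfl fun κ _ => ?_
  simp only [compress, Matrix.transpose_mul, Matrix.transpose_transpose]
  have e : V.transpose.conjTranspose.transpose = V.conjTranspose := by ext; simp
  rw [Matrix.mul_assoc, Matrix.mul_assoc, Matrix.trace_mul_comm, e]
  simp only [Matrix.mul_assoc]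

lemma pairing_add_left (C D Y : ι → Matrix (Fin n) (Fin n) ℂ) :
    pairing (C + D) Y = pairing C Y + pairing D Y := by
  simp [pairing, add_mul, Finset.sum_add_distrib]

lemma pairing_smul_left (c : ℂ) (C Y : ι → Matrix (Fin n) (Fin n) ℂ) :
    pairing (c • C) Y = c * pairing C Y := by
  simp [pairing, Finset.mul_sum, mul_assoc]

lemma pairing_add_right (C Y Z : ι → Matrix (Fin n) (Fin n) ℂ) :
    pairing C (Y + Z) = pairing C Y + pairing C Z := by
  simp [pairing, mul_add, Finset.sum_add_distrib]

lemma pairing_smul_right (c : ℂ) (C Y : ι → Matrix (Fin n) (Fin n) ℂ) :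
    pairing C (c • Y) = c * pairing C Y := by
  simp only [pairing, Finset.mul_sum, Pi.smul_apply, Matrix.smul_apply, smul_eq_mul]
  exact Finset.sum_congr rfl fun _ _ => Finset.sum_congr rfl fun _ _ =>
    Finset.sum_congr rfl fun _ _ => by ring

lemma star_pairing (C Y : ι → Matrix (Fin n) (Fin n) ℂ) :
    star (pairing C Y) = pairing (fun κ => (C κ).conjTranspose) (fun κ => (Y κ).conjTranspose) := by
  simp only [pairing, star_sum, Matrix.conjTranspose_apply, star_mul']
  exact Finset.sum_congr rfl fun κ _ => Finset.sum_comm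

lemma pairing_im_eq_zero {C Y : ι → Matrix (Fin n) (Fin n) ℂ} (hC : ∀ κ, (C κ).IsHermitian)
    (hY : ∀ κ, (Y κ).IsHermitian) : (pairing C Y).im = 0 := by
  have h := star_pairing C Y
  simp only [(hC _).eq, (hY _).eq] at h
  exact Complex.conj_eq_iff_im.1 h

lemma pairing_nonneg_of_re {C Y : ι → Matrix (Fin n) (Fin n) ℂ} (hC : ∀ κ, (C κ).IsHermitian)
    (hY : ∀ κ, (Y κ).IsHermitian) (h : 0 ≤ (pairing C Y).re) : 0 ≤ pairing C Y :=
  Complex.nonneg_iff.2 ⟨h, (pairing_im_eq_zero hC hY).symm⟩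

/-- The componentwise Hermitian part of a tuple. -/
def hermPart {ι : Type*} (C : ι → Matrix (Fin n) (Fin n) ℂ) : ι → Matrix (Fin n) (Fin n) ℂ :=
  (1 / 2 : ℂ) • (C + fun κ => (C κ).conjTranspose)

lemma hermPart_isHermitian {ι : Type*} (C : ι → Matrix (Fin n) (Fin n) ℂ) (κ : ι) :
    (hermPart C κ).IsHermitian := by
  simp [hermPart, Matrix.IsHermitian, Matrix.conjTranspose_smul, add_comm]

/-- Reduces real-part inequalities for arbitrary coefficients, as produced by separation theorems,
to Hermitian pencils. -/
lemma pairing_hermPart (C : ι → Matrix (Fin n) (Fin n) ℂ) {Y : ι → Matrix (Fin n) (Fin n) ℂ}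
    (hY : ∀ κ, (Y κ).IsHermitian) : pairing (hermPart C) Y = ((pairing C Y).re : ℂ) := by
  have h := star_pairing C Y
  simp only [(hY _).eq] at h
  rw [hermPart, pairing_smul_left, pairing_add_left, ← h, Complex.re_eq_add_conj]
  simp only [starRingEnd_apply]
  ring

lemma compress_isHermitian {ι : Type*} (V : Matrix (Fin k) (Fin n) ℂ) {C : ι → Matrix (Fin k) (Fin k) ℂ}
    (hC : ∀ κ, (C κ).IsHermitian) (κ : ι) : (compress V C κ).IsHermitian :=
  Matrix.isHermitian_conjTranspose_mul_mul V (hC κ)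

end Pairing

/-- Over `ℂ` a form with real values is automatically Hermitian, so no symmetry assumption is
needed. -/
lemma Matrix.posSemidef_of_forall_nonneg {n : Type*} [Fintype n] {M : Matrix n n ℂ}
    (h : ∀ v : n → ℂ, 0 ≤ star v ⬝ᵥ M.mulVec v) : M.PosSemidef := by
  classical
  rw [← Matrix.isPositive_toEuclideanLin_iff, LinearMap.isPositive_iff_complex]
  intro x
  have := h x.ofLp
  have e : ⟪Matrix.toEuclideanLin M x, x⟫_ℂ = star (star x.ofLp ⬝ᵥ M.mulVec x.ofLp) := by
    rw [← inner_conj_symm, EuclideanSpace.inner_eq_star_dotProduct]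
    simp [Matrix.toLpLin_apply, dotProduct_comm]
  rw [e]
  rw [Complex.nonneg_iff] at this
  simp only [RCLike.re_eq_complex_re]
  refine ⟨?_, by simpa using this.1⟩
  apply Complex.ext <;> simp [← this.2]

/-! ### Gram matrices of operators and the cones of positive pencils. -/

section Gram

variable {ι : Type*} [Fintype ι] {k m n : ℕ}
variable {H : Type*} [NormedAddCommGroup H] [InnerProductSpace ℂ H]

/-- The matrices `(⟪ξ_i, a_κ ξ_j⟫)_{ij}`. -/
def opGram {ι : Type*} (a : ι → H →L[ℂ] H) (ξ : Fin n → H) : ι → Matrix (Fin n) (Fin n) ℂ :=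
  fun κ => Matrix.of fun i j => ⟪ξ i, a κ (ξ j)⟫_ℂ

@[simp] lemma opGram_apply {ι : Type*} (a : ι → H →L[ℂ] H) (ξ : Fin n → H) (κ : ι) (i j : Fin n) :
    opGram a ξ κ i j = ⟪ξ i, a κ (ξ j)⟫_ℂ := rfl

lemma compress_opGram {ι : Type*} (V : Matrix (Fin k) (Fin n) ℂ) (a : ι → H →L[ℂ] H) (ξ : Fin k → H) :
    compress V (opGram a ξ) = opGram a (fun b => ∑ j, V j b • ξ j) := by
  funext κ
  ext i j
  simp only [compress, Matrix.mul_apply, opGram_apply, Matrix.conjTranspose_apply, map_sum,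
    map_smul, sum_inner, inner_sum, inner_smul_left, inner_smul_right, Finset.sum_mul,
    starRingEnd_apply]
  simp only [Finset.mul_sum]
  exact Finset.sum_congr rfl fun _ _ => Finset.sum_congr rfl fun _ _ => by ring

lemma opGram_isHermitian {ι : Type*} [CompleteSpace H] {a : ι → H →L[ℂ] H} (ha : ∀ κ, IsSelfAdjoint (a κ))
    (ξ : Fin n → H) (κ : ι) : (opGram a ξ κ).IsHermitian := by
  ext i j
  simp only [Matrix.conjTranspose_apply, opGram_apply, RCLike.star_def, inner_conj_symm]
  rw [← ContinuousLinearMap.adjoint_inner_right, (ha κ).adjoint_eq]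

/-- The cone of tuples `C` of Hermitian matrices such that `∑_κ C_κ ⊗ a_κ` is positive. -/
def pencilCone (a : ι → H →L[ℂ] H) (n : ℕ) : Set (ι → Matrix (Fin n) (Fin n) ℂ) :=
  {C | (∀ κ, (C κ).IsHermitian) ∧ ∀ ξ : Fin n → H, 0 ≤ pairing C (opGram a ξ)}

lemma compress_mem_pencilCone {a : ι → H →L[ℂ] H} {C : ι → Matrix (Fin k) (Fin k) ℂ}
    (hC : C ∈ pencilCone a k) (V : Matrix (Fin k) (Fin n) ℂ) : compress V C ∈ pencilCone a n := by
  refine ⟨compress_isHermitian V hC.1, fun ξ => ?_⟩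
  rw [pairing_compress, compress_opGram]
  exact hC.2 _

/-- The cone of real tuples `c` such that `∑_κ c_κ a_κ` is positive. -/
def scalarCone (a : ι → H →L[ℂ] H) : Set (ι → ℝ) :=
  {c | ∀ ξ : H, 0 ≤ ∑ κ, c κ * (⟪ξ, a κ ξ⟫_ℂ).re}

lemma isSelfAdjoint_homog [CompleteSpace H] {d : ℕ} {A : Fin d → H →L[ℂ] H}
    (hA : ∀ i, IsSelfAdjoint (A i)) (κ : Option (Fin d)) : IsSelfAdjoint (homog A κ) := by
  cases κ with
  | none => exact IsSelfAdjoint.one _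
  | some j => exact hA j

lemma isHermitian_homog {d : ℕ} {X : Fin d → Matrix (Fin n) (Fin n) ℂ}
    (hX : ∀ i, (X i).IsHermitian) (κ : Option (Fin d)) : (homog X κ).IsHermitian := by
  cases κ with
  | none => exact Matrix.isHermitian_one
  | some j => exact hX j

end Gram

/-! ### Duals of compression-invariant cones are matrix convex. -/

section MatrixConvexity

variable {d : ℕ}

/-- The free set dual to a family of cones. -/
def conePolar (P : (n : ℕ) → Set (Option (Fin d) → Matrix (Fin n) (Fin n) ℂ)) : FreeSet d :=
  fun n => {Y | ∀ C ∈ P n, 0 ≤ pairing C (homog Y)}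

lemma star_dotProduct_comp_mulVec {m n : ℕ} (M : Matrix (Fin m) (Fin m) (Matrix (Fin n) (Fin n) ℂ))
    (v : Fin m × Fin n → ℂ) :
    star v ⬝ᵥ (Matrix.comp _ _ _ _ ℂ M).mulVec v =
      ∑ i, ∑ j, ∑ a, ∑ b, star (v (i, a)) * M i j a b * v (j, b) := by
  simp only [dotProduct, Matrix.mulVec, Fintype.sum_prod_type, Matrix.comp_apply, Pi.star_apply,
    Finset.mul_sum]
  refine Finset.sum_congr rfl fun i _ => ?_
  rw [Finset.sum_comm]
  exact Finset.sum_congr rfl fun _ _ => Finset.sum_congr rfl fun _ _ =>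
    Finset.sum_congr rfl fun _ _ => by ring

/-- The image of a positive pencil under a completely positive map pairs nonnegatively. -/
lemma matCone_pairing_nonneg {n : ℕ} {M : Matrix (Fin n) (Fin n) (Matrix (Fin n) (Fin n) ℂ)}
    (hM : matCone n n M) : 0 ≤ ∑ i, ∑ j, M i j i j := by
  -- The sum is the quadratic form at the vector `∑ e_i ⊗ e_i`.
  have h := hM.dotProduct_mulVec_nonneg (fun p : Fin n × Fin n => if p.1 = p.2 then 1 else 0)
  rw [star_dotProduct_comp_mulVec] at h
  simpa [apply_ite star] using h

/-- Compressions `Z ↦ V* Z V` are completely positive. -/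
lemma isCP_conj {m n : ℕ} (V : Matrix (Fin m) (Fin n) ℂ) :
    IsCP (matCone m) (matCone n)
      { toFun := fun Z => V.conjTranspose * Z * V
        map_add' := fun _ _ => by rw [Matrix.mul_add, Matrix.add_mul]
        map_smul' := fun _ _ => by simp } := by
  intro k X hX
  refine Matrix.posSemidef_of_forall_nonneg fun v => ?_
  have h := hX.dotProduct_mulVec_nonneg (fun p => ∑ a, V p.2 a * v (p.1, a))
  rw [star_dotProduct_comp_mulVec] at h ⊢
  refine h.trans_eq (Finset.sum_congr rfl fun i _ => Finset.sum_congr rfl fun j _ => ?_)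
  simp only [Matrix.map_apply, LinearMap.coe_mk, AddHom.coe_mk, Matrix.mul_apply,
    Matrix.conjTranspose_apply, star_sum, star_mul', Finset.sum_mul, Finset.mul_sum]
  calc _ = ∑ p, ∑ a, ∑ q, ∑ b, star (v (i, a)) * (star (V p a) * X i j p q * V q b) * v (j, b) := by
        refine Finset.sum_congr rfl fun p _ => ?_
        conv_lhs => enter [2, q]; rw [Finset.sum_comm]
        rw [Finset.sum_comm]
        exact Finset.sum_congr rfl fun _ _ => Finset.sum_congr rfl fun _ _ =>
          Finset.sum_congr rfl fun _ _ => by ring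
    _ = _ := by
        rw [Finset.sum_comm]
        refine Finset.sum_congr rfl fun a _ => ?_
        conv_lhs => enter [2, p]; rw [Finset.sum_comm]
        rw [Finset.sum_comm]
        refine Finset.sum_congr rfl fun b _ => ?_
        rw [Finset.sum_comm]

/-- The block matrix `∑ C_κ ⊗ X_κ` is positive, because testing it on a vector amounts to pairing
`X` with a compression of `C`. A completely positive map preserves this, and evaluating the image at
`∑ e_i ⊗ e_i` gives the required pairing. -/
lemma conePolar_ucp_mem {P : (n : ℕ) → Set (Option (Fin d) → Matrix (Fin n) (Fin n) ℂ)}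
    (hP : ∀ (k n : ℕ) (V : Matrix (Fin k) (Fin n) ℂ), ∀ C ∈ P k, compress V C ∈ P n)
    (n k : ℕ) (φ : Matrix (Fin n) (Fin n) ℂ →ₗ[ℂ] Matrix (Fin k) (Fin k) ℂ)
    (h1 : φ 1 = 1) (hφ : IsCP (matCone n) (matCone k) φ) (X : Fin d → Matrix (Fin n) (Fin n) ℂ)
    (hX : X ∈ conePolar P n) : (fun j => φ (X j)) ∈ conePolar P k := by
  intro C hC
  set M : Matrix (Fin k) (Fin k) (Matrix (Fin n) (Fin n) ℂ) :=
    Matrix.of fun i j => ∑ κ, C κ i j • homog X κ with hM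
  have hpos : matCone n k M := by
    refine Matrix.posSemidef_of_forall_nonneg fun v => ?_
    rw [star_dotProduct_comp_mulVec]
    -- The vector `v`, read as a `k × n` matrix, compresses `C` to level `n`.
    have h := hX _ (hP k n (Matrix.of fun i a => v (i, a)) C hC)
    rw [pairing_compress] at h
    convert h using 1
    have e : ∀ i j, ∑ a, ∑ b, star (v (i, a)) * M i j a b * v (j, b) =
        ∑ κ, C κ i j * compress (Matrix.of fun i a => v (i, a)).transpose (homog X) κ i j := by
      intro i j
      simp only [compress, hM, Matrix.of_apply, Matrix.mul_apply, Matrix.sum_apply,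
        Matrix.smul_apply, smul_eq_mul, Finset.mul_sum, Finset.sum_mul,
        Matrix.conjTranspose_apply, Matrix.transpose_apply]
      rw [Finset.sum_comm]
      conv_rhs => rw [Finset.sum_comm]
      refine Finset.sum_congr rfl fun b _ => ?_
      conv_rhs => rw [Finset.sum_comm]
      exact Finset.sum_congr rfl fun _ _ => Finset.sum_congr rfl fun _ _ => by ring
    simp only [e, pairing]
    conv_rhs => rw [Finset.sum_comm]
    exact Finset.sum_congr rfl fun _ _ => Finset.sum_comm
  have h2 := matCone_pairing_nonneg (hφ k M hpos)
  convert h2 using 1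
  have e : ∀ i j, φ (M i j) = ∑ κ, C κ i j • homog (fun l => φ (X l)) κ := by
    intro i j
    simp only [hM, Matrix.of_apply, map_sum, map_smul]
    refine Finset.sum_congr rfl fun κ _ => ?_
    cases κ <;> simp [h1]
  simp only [pairing, Matrix.map_apply, e, Matrix.sum_apply, Matrix.smul_apply, smul_eq_mul]
  rw [Finset.sum_comm]
  exact Finset.sum_congr rfl fun i _ => Finset.sum_comm

/-- A free set that is dual to a family of cones closed under compressions is matrix convex. -/
lemma isMatrixConvex_conePolar
    {P : (n : ℕ) → Set (Option (Fin d) → Matrix (Fin n) (Fin n) ℂ)}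
    (hP : ∀ (k n : ℕ) (V : Matrix (Fin k) (Fin n) ℂ), ∀ C ∈ P k, compress V C ∈ P n) :
    IsMatrixConvex (conePolar P) where
  directSum_mem m n X hX Y hY C hC := by
    -- `V` and `W` are the two coordinate inclusions; the direct sum splits as `V X V* + W Y W*`,
    -- and the pairing splits with it.
    set V : Matrix (Fin (m + n)) (Fin m) ℂ :=
      Matrix.of fun i a => if i = Fin.castAdd n a then 1 else 0 with hV
    set W : Matrix (Fin (m + n)) (Fin n) ℂ :=
      Matrix.of fun i a => if i = Fin.natAdd m a then 1 else 0 with hW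
    have e : homog (fun j => matDirectSum (X j) (Y j)) =
        compress V.transpose (homog X) + compress W.transpose (homog Y) := by
      have hne : ∀ (a : Fin m) (b : Fin n), Fin.castAdd n a ≠ Fin.natAdd m b := by
        intro a b h
        have := congrArg Fin.val h
        simp at this
        omega
      have hinj : ∀ a b : Fin m, Fin.castAdd n a = Fin.castAdd n b ↔ a = b :=
        fun a b => (Fin.castAdd_injective m n).eq_iff
      have hinj' : ∀ a b : Fin n, Fin.natAdd m a = Fin.natAdd m b ↔ a = b :=
        fun a b => (Fin.natAdd_injective n m).eq_iff
      funext κ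
      ext i j
      cases κ <;> induction i using Fin.addCases <;> induction j using Fin.addCases <;>
        simp [compress, Matrix.mul_apply, hV, hW, matDirectSum, hne, (hne _ _).symm,
          Matrix.one_apply, hinj, hinj', apply_ite star]
    rw [e, pairing_add_right, ← pairing_compress, ← pairing_compress]
    exact add_nonneg (hX _ (hP _ _ _ _ hC)) (hY _ (hP _ _ _ _ hC))
  unitary_mem n U hU X hX := by
    refine conePolar_ucp_mem hP n n
      _ ?_ (isCP_conj U) X hX
    simpa [Matrix.star_eq_conjTranspose] using Matrix.mem_unitaryGroup_iff'.1 hU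
  ucp_mem := conePolar_ucp_mem hP

end MatrixConvexity

/-! ### Positivity and complete positivity of unital maps as inclusions of cones. -/

lemma LinearMap.exists_factor_of_surjective {R V W U : Type*} [DivisionRing R] [AddCommGroup V]
    [Module R V] [AddCommGroup W] [Module R W] [AddCommGroup U] [Module R U] (f : V →ₗ[R] W)
    (g : V →ₗ[R] U) (hf : Function.Surjective f) (h : ∀ v, f v = 0 → g v = 0) :
    ∃ φ : W →ₗ[R] U, ∀ v, φ (f v) = g v := by
  obtain ⟨s, hs⟩ := f.exists_rightInverse_of_surjective (LinearMap.range_eq_top.2 hf)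
  refine ⟨g.comp s, fun v => ?_⟩
  have h1 : f (s (f v) - v) = 0 := by
    have := LinearMap.congr_fun hs (f v)
    simp only [LinearMap.comp_apply, LinearMap.id_apply] at this
    rw [map_sub, this, sub_self]
  have h2 := h _ h1
  rw [map_sub, sub_eq_zero] at h2
  exact h2

section UnitalMaps

variable {ι : Type*} [Fintype ι] {m n d : ℕ}
variable {H : Type*} [NormedAddCommGroup H] [InnerProductSpace ℂ H]
variable {K : Type*} [NormedAddCommGroup K] [InnerProductSpace ℂ K]

lemma range_homog {R : Type*} [One R] (A : Fin d → R) :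
    Set.range (homog A) = insert 1 (Set.range A) := by
  ext x
  simp [Option.exists, homog, eq_comm]

lemma homog_mem_opSystem (A : Fin d → H →L[ℂ] H) (κ : Option (Fin d)) :
    homog A κ ∈ opSystem A :=
  Submodule.subset_span (range_homog A ▸ ⟨κ, rfl⟩)

lemma exists_coeff_of_mem_opSystem {A : Fin d → H →L[ℂ] H} {x : H →L[ℂ] H} (hx : x ∈ opSystem A) :
    ∃ c : Option (Fin d) → ℂ, ∑ κ, c κ • homog A κ = x := by
  rw [opSystem, ← range_homog, Submodule.mem_span_range_iff_exists_fun] at hx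
  exact hx

lemma sum_inner_pencil (a : ι → H →L[ℂ] H) (C : ι → Matrix (Fin m) (Fin m) ℂ) (ξ : Fin m → H) :
    ∑ i, ∑ j, ⟪ξ i, (∑ κ, C κ i j • a κ) (ξ j)⟫_ℂ = pairing C (opGram a ξ) := by
  simp only [pairing, opGram_apply, sum_apply, smul_apply,
    inner_sum, inner_smul_right]
  conv_rhs => rw [Finset.sum_comm]
  exact Finset.sum_congr rfl fun _ _ => Finset.sum_comm

lemma inner_sum_smul (a : ι → H →L[ℂ] H) (c : ι → ℂ) (ξ : H) :
    ⟪ξ, (∑ κ, c κ • a κ) ξ⟫_ℂ = ∑ κ, c κ * ⟪ξ, a κ ξ⟫_ℂ := by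
  simp only [sum_apply, smul_apply, inner_sum, inner_smul_right]

lemma inner_eq_re_of_isSelfAdjoint [CompleteSpace H] {a : H →L[ℂ] H} (ha : IsSelfAdjoint a)
    (ξ : H) : ⟪ξ, a ξ⟫_ℂ = ((⟪ξ, a ξ⟫_ℂ).re : ℂ) := by
  refine (Complex.conj_eq_iff_re.1 ?_).symm
  rw [inner_conj_symm, ← ContinuousLinearMap.adjoint_inner_right, ha.adjoint_eq]

lemma re_sum_mul_inner [CompleteSpace H] {a : ι → H →L[ℂ] H} (ha : ∀ κ, IsSelfAdjoint (a κ))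
    (c : ι → ℂ) (ξ : H) :
    (∑ κ, c κ * ⟪ξ, a κ ξ⟫_ℂ).re = ∑ κ, (c κ).re * (⟪ξ, a κ ξ⟫_ℂ).re := by
  rw [Complex.re_sum]
  refine Finset.sum_congr rfl fun κ _ => ?_
  rw [inner_eq_re_of_isSelfAdjoint (ha κ)]
  simp

lemma im_sum_mul_inner [CompleteSpace H] {a : ι → H →L[ℂ] H} (ha : ∀ κ, IsSelfAdjoint (a κ))
    (c : ι → ℂ) (ξ : H) :
    (∑ κ, c κ * ⟪ξ, a κ ξ⟫_ℂ).im = ∑ κ, (c κ).im * (⟪ξ, a κ ξ⟫_ℂ).re := by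
  rw [Complex.im_sum]
  refine Finset.sum_congr rfl fun κ _ => ?_
  rw [inner_eq_re_of_isSelfAdjoint (ha κ)]
  simp

lemma IsUnitalMapSending.apply_sum {A : Fin d → H →L[ℂ] H} {B : Fin d → K →L[ℂ] K}
    {φ : opSystem A →ₗ[ℂ] opSystem B} (hφ : IsUnitalMapSending A B φ) (c : Option (Fin d) → ℂ)
    (x : opSystem A) (hx : ∑ κ, c κ • homog A κ = (x : H →L[ℂ] H)) :
    (φ x : K →L[ℂ] K) = ∑ κ, c κ • homog B κ := by
  have h1 : x = ∑ κ, c κ • (⟨homog A κ, homog_mem_opSystem A κ⟩ : opSystem A) :=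
    Subtype.ext (by simp [← hx])
  have h2 : ∀ κ, φ ⟨homog A κ, homog_mem_opSystem A κ⟩ = ⟨homog B κ, homog_mem_opSystem B κ⟩ := by
    intro κ
    cases κ with
    | none => exact hφ.1
    | some i => exact hφ.2 i
  rw [h1, map_sum]
  simp only [map_smul, h2, AddSubmonoidClass.coe_finsetSum, Submodule.coe_smul]

variable [CompleteSpace H] [CompleteSpace K]

/-- Positivity at `a` puts the real part of `c` in the cone, and the imaginary part together with
its negative; the last two force the imaginary part of the form at `b` to vanish. -/
lemma nonneg_of_scalarCone_le {a : ι → H →L[ℂ] H} {b : ι → K →L[ℂ] K}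
    (ha : ∀ κ, IsSelfAdjoint (a κ)) (hb : ∀ κ, IsSelfAdjoint (b κ))
    (h : scalarCone a ⊆ scalarCone b) {c : ι → ℂ} (hc : ∀ ξ, 0 ≤ ∑ κ, c κ * ⟪ξ, a κ ξ⟫_ℂ)
    (ξ : K) : 0 ≤ ∑ κ, c κ * ⟪ξ, b κ ξ⟫_ℂ := by
  have h1 : (fun κ => (c κ).re) ∈ scalarCone a := fun η => by
    rw [← re_sum_mul_inner ha]
    exact (Complex.nonneg_iff.1 (hc η)).1
  have h2 : (fun κ => (c κ).im) ∈ scalarCone a := fun η => by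
    rw [← im_sum_mul_inner ha]
    exact (Complex.nonneg_iff.1 (hc η)).2.le
  have h3 : (fun κ => -(c κ).im) ∈ scalarCone a := fun η => by
    simp only [neg_mul, Finset.sum_neg_distrib]
    rw [← im_sum_mul_inner ha, ← (Complex.nonneg_iff.1 (hc η)).2, neg_zero]
  have h4 := h h3 ξ
  simp only [neg_mul, Finset.sum_neg_distrib] at h4
  rw [Complex.nonneg_iff, re_sum_mul_inner hb, im_sum_mul_inner hb]
  exact ⟨h h1 ξ, le_antisymm (h h2 ξ) (by linarith)⟩

/-- The Hermitian parts of `C`, `iC` and `-iC` are all positive at `a`; at `b` the last two force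
the form to be real. -/
lemma nonneg_of_pencilCone_le {a : ι → H →L[ℂ] H} {b : ι → K →L[ℂ] K}
    (ha : ∀ κ, IsSelfAdjoint (a κ)) (hb : ∀ κ, IsSelfAdjoint (b κ))
    (h : pencilCone a n ⊆ pencilCone b n) {C : ι → Matrix (Fin n) (Fin n) ℂ}
    (hC : ∀ ξ, 0 ≤ pairing C (opGram a ξ)) (ξ : Fin n → K) : 0 ≤ pairing C (opGram b ξ) := by
  have key : ∀ D : ι → Matrix (Fin n) (Fin n) ℂ, (∀ η, 0 ≤ (pairing D (opGram a η)).re) →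
      0 ≤ (pairing D (opGram b ξ)).re := by
    intro D hD
    have h1 : hermPart D ∈ pencilCone a n := ⟨hermPart_isHermitian D, fun η => by
      rw [pairing_hermPart D (opGram_isHermitian ha η)]
      exact_mod_cast hD η⟩
    have h2 := (h h1).2 ξ
    rw [pairing_hermPart D (opGram_isHermitian hb ξ)] at h2
    exact_mod_cast h2
  have h1 := key C fun η => (Complex.nonneg_iff.1 (hC η)).1
  have h2 := key (Complex.I • C) fun η => by
    rw [pairing_smul_left]
    simp [← (Complex.nonneg_iff.1 (hC η)).2]
  have h3 := key (-Complex.I • C) fun η => by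
    rw [pairing_smul_left]
    simp [← (Complex.nonneg_iff.1 (hC η)).2]
  rw [pairing_smul_left] at h2 h3
  simp at h2 h3
  exact Complex.nonneg_iff.2 ⟨h1, le_antisymm h3 h2⟩

/-- The issue is well-definedness. A linear relation among the `A_κ` is a pencil which is positive
together with its negative, so its quadratic form at `B` is zero, and over `ℂ` an operator with zero
quadratic form vanishes. -/
lemma exists_unitalMap {A : Fin d → H →L[ℂ] H} {B : Fin d → K →L[ℂ] K}
    (hA : ∀ i, IsSelfAdjoint (A i)) (hB : ∀ i, IsSelfAdjoint (B i))
    (h : scalarCone (homog A) ⊆ scalarCone (homog B)) :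
    ∃ φ : opSystem A →ₗ[ℂ] opSystem B, IsUnitalMapSending A B φ := by
  let f : (Option (Fin d) → ℂ) →ₗ[ℂ] opSystem A :=
    Fintype.linearCombination ℂ fun κ => (⟨homog A κ, homog_mem_opSystem A κ⟩ : opSystem A)
  let g : (Option (Fin d) → ℂ) →ₗ[ℂ] opSystem B :=
    Fintype.linearCombination ℂ fun κ => (⟨homog B κ, homog_mem_opSystem B κ⟩ : opSystem B)
  have hf : ∀ c, (f c : H →L[ℂ] H) = ∑ κ, c κ • homog A κ := fun c => by
    simp [f, Fintype.linearCombination_apply]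
  have hg : ∀ c, (g c : K →L[ℂ] K) = ∑ κ, c κ • homog B κ := fun c => by
    simp [g, Fintype.linearCombination_apply]
  obtain ⟨φ, hφ⟩ := LinearMap.exists_factor_of_surjective f g (fun x => by
      obtain ⟨c, hc⟩ := exists_coeff_of_mem_opSystem x.2
      exact ⟨c, Subtype.ext ((hf c).trans hc)⟩) (fun c hc => by
      have h0 : ∑ κ, c κ • homog A κ = 0 := by rw [← hf, hc]; rfl
      apply Subtype.ext
      rw [hg]
      ext1 ξ
      have hz : ∀ ξ : K, ⟪(∑ κ, c κ • homog B κ) ξ, ξ⟫_ℂ = 0 := by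
        intro ξ
        rw [← inner_conj_symm, inner_sum_smul]
        have h1 := nonneg_of_scalarCone_le (isSelfAdjoint_homog hA) (isSelfAdjoint_homog hB) h
          (c := c) (fun η => by rw [← inner_sum_smul, h0]; simp) ξ
        have h2 := nonneg_of_scalarCone_le (isSelfAdjoint_homog hA) (isSelfAdjoint_homog hB) h
          (c := -c) (fun η => by
            rw [← inner_sum_smul]; simp [h0]) ξ
        simp only [Pi.neg_apply, neg_mul, Finset.sum_neg_distrib, neg_nonneg] at h2
        rw [le_antisymm h2 h1, map_zero]
      have := (inner_map_self_eq_zero ((∑ κ, c κ • homog B κ : K →L[ℂ] K) : K →ₗ[ℂ] K)).1 hz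
      exact LinearMap.congr_fun this ξ)
  have key : ∀ κ, φ ⟨homog A κ, homog_mem_opSystem A κ⟩ = ⟨homog B κ, homog_mem_opSystem B κ⟩ := by
    classical
    intro κ
    have h1 : f (Pi.single κ 1) = ⟨homog A κ, homog_mem_opSystem A κ⟩ := by
      simp [f, Fintype.linearCombination_apply_single]
    have h2 : g (Pi.single κ 1) = ⟨homog B κ, homog_mem_opSystem B κ⟩ := by
      simp [g, Fintype.linearCombination_apply_single]
    rw [← h1, hφ, h2]
  exact ⟨φ, key none, fun i => key (some i)⟩

/-- Positivity of `I ↦ I`, `A_i ↦ B_i` in terms of scalar pencils. -/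
lemma unitalMapIsPositive_iff {A : Fin d → H →L[ℂ] H} {B : Fin d → K →L[ℂ] K}
    (hA : ∀ i, IsSelfAdjoint (A i)) (hB : ∀ i, IsSelfAdjoint (B i)) :
    UnitalMapIsPositive A B ↔ scalarCone (homog A) ⊆ scalarCone (homog B) := by
  have hA' := isSelfAdjoint_homog hA
  have hB' := isSelfAdjoint_homog hB
  constructor
  · rintro ⟨φ, hφ, hpos⟩ c hc ξ
    have h1 := hpos ⟨∑ κ, (c κ : ℂ) • homog A κ, Submodule.sum_mem _ fun κ _ =>
      Submodule.smul_mem _ _ (homog_mem_opSystem A κ)⟩ (by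
        rw [ContinuousLinearMap.isPositive_def']
        refine ⟨?_, fun η => ?_⟩
        · exact isSelfAdjoint_sum _ fun κ _ =>
            IsSelfAdjoint.smul (Complex.conj_ofReal (c κ)) (hA' κ)
        · rw [ContinuousLinearMap.reApplyInnerSelf_apply, ← inner_conj_symm, inner_sum_smul]
          have h1 := re_sum_mul_inner hA' (fun κ => (c κ : ℂ)) η
          simp only [Complex.ofReal_re] at h1
          simp only [RCLike.re_eq_complex_re, Complex.conj_re]
          exact (hc η).trans_eq h1.symm)
    have h2 := h1.inner_nonneg_right ξ
    rw [hφ.apply_sum (fun κ => (c κ : ℂ)) _ rfl, inner_sum_smul] at h2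
    have h3 := (Complex.nonneg_iff.1 h2).1
    rw [re_sum_mul_inner hB'] at h3
    simpa using h3
  · intro h
    obtain ⟨φ, hφ⟩ := exists_unitalMap hA hB h
    refine ⟨φ, hφ, fun x hx => ?_⟩
    obtain ⟨c, hc⟩ := exists_coeff_of_mem_opSystem x.2
    rw [ContinuousLinearMap.isPositive_iff_complex]
    intro ξ
    have h1 : 0 ≤ ⟪ξ, (φ x : K →L[ℂ] K) ξ⟫_ℂ := by
      rw [hφ.apply_sum c x hc, inner_sum_smul]
      refine nonneg_of_scalarCone_le hA' hB' h (fun η => ?_) ξ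
      rw [← inner_sum_smul, hc]
      exact hx.inner_nonneg_right η
    obtain ⟨h2, h3⟩ := Complex.nonneg_iff.1 h1
    have h4 : ⟪(φ x : K →L[ℂ] K) ξ, ξ⟫_ℂ = ⟪ξ, (φ x : K →L[ℂ] K) ξ⟫_ℂ := by
      rw [← inner_conj_symm]
      exact Complex.conj_eq_iff_im.2 h3.symm
    rw [h4]
    exact ⟨Complex.ext rfl h3, h2⟩

/-- Complete positivity of `I ↦ I`, `A_i ↦ B_i` in terms of matrix pencils. -/
lemma unitalMapIsCP_iff {A : Fin d → H →L[ℂ] H} {B : Fin d → K →L[ℂ] K}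
    (hA : ∀ i, IsSelfAdjoint (A i)) (hB : ∀ i, IsSelfAdjoint (B i)) :
    UnitalMapIsCP A B ↔ ∀ n, pencilCone (homog A) n ⊆ pencilCone (homog B) n := by
  have hA' := isSelfAdjoint_homog hA
  have hB' := isSelfAdjoint_homog hB
  constructor
  · rintro ⟨φ, hφ, hcp⟩ n C hC
    refine ⟨hC.1, fun ξ => ?_⟩
    have h1 := hcp n (Matrix.of fun i j => ⟨∑ κ, C κ i j • homog A κ, Submodule.sum_mem _ fun κ _ =>
      Submodule.smul_mem _ _ (homog_mem_opSystem A κ)⟩) (fun η => by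
        simpa only [Matrix.of_apply, sum_inner_pencil] using hC.2 η) ξ
    simp only [Matrix.map_apply, Matrix.of_apply] at h1
    rw [← sum_inner_pencil]
    convert h1 using 6 with i _ j _
    exact (hφ.apply_sum _ _ rfl).symm
  · intro h
    -- Scalar pencils are the pencils of size one.
    have h1 : scalarCone (homog A) ⊆ scalarCone (homog B) := by
      intro c hc ξ
      have h2 := (h 1 (a := fun κ => Matrix.of fun _ _ => (c κ : ℂ)) ⟨fun κ => by
        ext i j; simp, fun η => by
          have := hc (η 0)
          simp only [pairing, Fin.sum_univ_one, Matrix.of_apply, opGram_apply]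
          rw [Finset.sum_congr rfl fun κ _ =>
            congrArg _ (inner_eq_re_of_isSelfAdjoint (hA' κ) (η 0))]
          exact_mod_cast this⟩).2 fun _ => ξ
      simp only [pairing, Fin.sum_univ_one, Matrix.of_apply, opGram_apply] at h2
      rw [Finset.sum_congr rfl fun κ _ =>
        congrArg _ (inner_eq_re_of_isSelfAdjoint (hB' κ) ξ)] at h2
      exact_mod_cast h2
    obtain ⟨φ, hφ⟩ := exists_unitalMap hA hB h1
    refine ⟨φ, hφ, fun m X hX ξ => ?_⟩
    choose c hc using fun i j => exists_coeff_of_mem_opSystem (X i j).2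
    have h2 := nonneg_of_pencilCone_le hA' hB' (h m) (C := fun κ => Matrix.of fun i j => c i j κ)
      (fun η => by
        rw [← sum_inner_pencil]
        simpa only [Matrix.of_apply, hc] using hX η) ξ
    rw [← sum_inner_pencil] at h2
    simp only [Matrix.of_apply] at h2
    simpa only [Matrix.map_apply, hφ.apply_sum _ _ (hc _ _)] using h2

end UnitalMaps

/-! ### Completely positive maps into matrices by extension of functionals. -/

section Extension

variable {ι : Type*} [Fintype ι] {m n d : ℕ}
variable {H : Type*} [NormedAddCommGroup H] [InnerProductSpace ℂ H]

/-- The sesquilinear form of an operator matrix. -/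
def matForm {V : Submodule ℂ (H →L[ℂ] H)} (X : Matrix (Fin n) (Fin n) V) (ξ : Fin n → H) : ℂ :=
  ∑ i, ∑ j, ⟪ξ i, (X i j : H →L[ℂ] H) (ξ j)⟫_ℂ

lemma matForm_add {V : Submodule ℂ (H →L[ℂ] H)} (X Y : Matrix (Fin n) (Fin n) V) (ξ : Fin n → H) :
    matForm (X + Y) ξ = matForm X ξ + matForm Y ξ := by
  simp [matForm, Finset.sum_add_distrib]

lemma matForm_smul {V : Submodule ℂ (H →L[ℂ] H)} (c : ℂ) (X : Matrix (Fin n) (Fin n) V)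
    (ξ : Fin n → H) : matForm (c • X) ξ = c * matForm X ξ := by
  simp [matForm, Finset.mul_sum]

/-- The cone of operator matrices with positive real part. -/
def realPartCone (V : Submodule ℂ (H →L[ℂ] H)) (n : ℕ) :
    PointedCone ℝ (Matrix (Fin n) (Fin n) V) where
  carrier := {X | ∀ ξ, 0 ≤ (matForm X ξ).re}
  add_mem' hX hY ξ := by
    rw [matForm_add, Complex.add_re]
    exact add_nonneg (hX ξ) (hY ξ)
  zero_mem' ξ := by simp [matForm]
  smul_mem' c X hX ξ := by
    have h : c • X = ((c : ℝ) : ℂ) • X := by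
      ext i j : 2
      change ((c : ℝ) • ((X i j : V) : H →L[ℂ] H)) = ((c : ℝ) : ℂ) • ((X i j : V) : H →L[ℂ] H)
      exact (Complex.coe_smul (c : ℝ) _).symm
    rw [h, matForm_smul, Complex.re_ofReal_mul]
    exact mul_nonneg c.2 (hX ξ)

/-- A crude bound by the entry norms, sufficient to make the unit an order unit for the cone of
positive real parts. -/
lemma norm_matForm_le {V : Submodule ℂ (H →L[ℂ] H)} (X : Matrix (Fin n) (Fin n) V)
    (ξ : Fin n → H) : ‖matForm X ξ‖ ≤ (∑ i, ∑ j, ‖(X i j : H →L[ℂ] H)‖) * ∑ i, ‖ξ i‖ ^ 2 := by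
  have hle : ∀ i, ‖ξ i‖ ^ 2 ≤ ∑ i, ‖ξ i‖ ^ 2 := fun i =>
    Finset.single_le_sum (f := fun i => ‖ξ i‖ ^ 2) (fun _ _ => sq_nonneg _) (Finset.mem_univ i)
  rw [Finset.sum_mul]
  refine (norm_sum_le _ _).trans (Finset.sum_le_sum fun i _ => ?_)
  rw [Finset.sum_mul]
  refine (norm_sum_le _ _).trans (Finset.sum_le_sum fun j _ => ?_)
  calc ‖⟪ξ i, (X i j : H →L[ℂ] H) (ξ j)⟫_ℂ‖ ≤ ‖ξ i‖ * (‖(X i j : H →L[ℂ] H)‖ * ‖ξ j‖) :=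
        (norm_inner_le_norm _ _).trans
          (mul_le_mul_of_nonneg_left (ContinuousLinearMap.le_opNorm _ _) (norm_nonneg _))
    _ = ‖(X i j : H →L[ℂ] H)‖ * (‖ξ i‖ * ‖ξ j‖) := by ring
    _ ≤ ‖(X i j : H →L[ℂ] H)‖ * ∑ i, ‖ξ i‖ ^ 2 := by
        refine mul_le_mul_of_nonneg_left ?_ (norm_nonneg _)
        nlinarith [hle i, hle j, sq_nonneg (‖ξ i‖ - ‖ξ j‖)]

/-- Operator matrices `∑_κ C_κ ⊗ a_κ`, as a linear function of the coefficients. -/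
def pencilMap {V : Submodule ℂ (H →L[ℂ] H)} (a : ι → V) (n : ℕ) :
    (ι → Matrix (Fin n) (Fin n) ℂ) →ₗ[ℂ] Matrix (Fin n) (Fin n) V where
  toFun C := Matrix.of fun i j => ∑ κ, C κ i j • a κ
  map_add' C D := by
    ext i j : 2
    simp [add_smul, Finset.sum_add_distrib]
  map_smul' c C := by
    ext i j : 2
    simp only [Pi.smul_apply, Matrix.smul_apply, Matrix.of_apply, smul_eq_mul, RingHom.id_apply,
      Finset.smul_sum, smul_smul]

lemma matForm_pencilMap {V : Submodule ℂ (H →L[ℂ] H)} (a : ι → V)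
    (C : ι → Matrix (Fin n) (Fin n) ℂ) (ξ : Fin n → H) :
    matForm (pencilMap a n C) ξ = pairing C (opGram (fun κ => (a κ : H →L[ℂ] H)) ξ) := by
  rw [← sum_inner_pencil]
  simp [matForm, pencilMap]

/-- A functional on `M_n(V)` that is nonnegative on matrices with positive real part induces a
completely positive map `V → M_n`. -/
lemma exists_cp_of_functional {V : Submodule ℂ (H →L[ℂ] H)}
    (G : Matrix (Fin n) (Fin n) V →ₗ[ℂ] ℂ) (hG : ∀ X ∈ realPartCone V n, 0 ≤ (G X).re) :
    ∃ φ : V →ₗ[ℂ] Matrix (Fin n) (Fin n) ℂ, IsCP (opCone V) (matCone n) φ ∧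
      ∀ v i j, φ v i j = G (Matrix.single i j v) := by
  let φ : V →ₗ[ℂ] Matrix (Fin n) (Fin n) ℂ :=
    { toFun := fun v => Matrix.of fun i j => G (Matrix.single i j v)
      map_add' := fun v w => by
        ext i j
        simp [Matrix.single_add]
      map_smul' := fun c v => by
        ext i j
        simp only [Matrix.of_apply, RingHom.id_apply, Matrix.smul_apply]
        rw [← map_smul, Matrix.smul_single] }
  refine ⟨φ, fun m X hX => Matrix.posSemidef_of_forall_nonneg fun v => ?_, fun _ _ _ => rfl⟩
  -- `Y` is `X` compressed by the scalar matrix `v`, so it is positive along with `X`, and `G Y` is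
  -- the form of the image of `X` at `v`.
  set Y : Matrix (Fin n) (Fin n) V :=
    Matrix.of fun i j => ∑ a, ∑ b, (star (v (a, i)) * v (b, j)) • X a b with hY
  have e1 : star v ⬝ᵥ (Matrix.comp _ _ _ _ ℂ (X.map φ)).mulVec v = G Y := by
    rw [star_dotProduct_comp_mulVec]
    have e2 : Y = ∑ a, ∑ b, ∑ i, ∑ j, (star (v (a, i)) * v (b, j)) • Matrix.single i j (X a b) := by
      rw [Matrix.matrix_eq_sum_single Y]
      simp only [hY, Matrix.of_apply, Matrix.smul_single]
      have e3 : ∀ i j, Matrix.single i j (∑ a, ∑ b, (star (v (a, i)) * v (b, j)) • X a b) =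
          ∑ a, ∑ b, Matrix.single i j ((star (v (a, i)) * v (b, j)) • X a b) := fun i j => by
        rw [← Matrix.singleAddMonoidHom_apply, map_sum]
        simp only [map_sum, Matrix.singleAddMonoidHom_apply]
      simp only [e3]
      calc _ = ∑ i, ∑ a, ∑ b, ∑ j, Matrix.single i j ((star (v (a, i)) * v (b, j)) • X a b) := by
            refine Finset.sum_congr rfl fun i _ => ?_
            rw [Finset.sum_comm]
            exact Finset.sum_congr rfl fun a _ => Finset.sum_comm
        _ = _ := by
            rw [Finset.sum_comm]
            exact Finset.sum_congr rfl fun a _ => Finset.sum_comm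
    rw [e2]
    simp only [map_sum, map_smul, Matrix.map_apply, smul_eq_mul]
    refine Finset.sum_congr rfl fun a _ => Finset.sum_congr rfl fun b _ =>
      Finset.sum_congr rfl fun i _ => Finset.sum_congr rfl fun j _ => ?_
    change star (v (a, i)) * G (Matrix.single i j (X a b)) * v (b, j) = _
    ring
  have e4 : ∀ ξ, 0 ≤ matForm Y ξ := by
    intro ξ
    have h := hX fun a => ∑ i, v (a, i) • ξ i
    convert h using 1
    simp only [matForm, hY, Matrix.of_apply, map_sum, map_smul, sum_inner, inner_sum,
      inner_smul_left, inner_smul_right, Submodule.coe_sum, Submodule.coe_smul, sum_apply,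
      smul_apply]
    calc _ = ∑ i, ∑ a, ∑ b, ∑ j, star (v (a, i)) * v (b, j) *
          ⟪ξ i, (X a b : H →L[ℂ] H) (ξ j)⟫_ℂ := by
          refine Finset.sum_congr rfl fun i _ => ?_
          rw [Finset.sum_comm]
          exact Finset.sum_congr rfl fun a _ => Finset.sum_comm
      _ = ∑ a, ∑ b, ∑ i, ∑ j, star (v (a, i)) * v (b, j) *
          ⟪ξ i, (X a b : H →L[ℂ] H) (ξ j)⟫_ℂ := by
          rw [Finset.sum_comm]
          exact Finset.sum_congr rfl fun a _ => Finset.sum_comm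
      _ = _ := by
          refine Finset.sum_congr rfl fun a _ => Finset.sum_congr rfl fun b _ => ?_
          simp only [Finset.mul_sum]
          rw [Finset.sum_comm]
          exact Finset.sum_congr rfl fun i _ => Finset.sum_congr rfl fun j _ => by
            simp only [starRingEnd_apply]; ring
  rw [e1]
  have h1 := hG Y fun ξ => (Complex.nonneg_iff.1 (e4 ξ)).1
  -- The form of `Y` is real, so `±iY` have zero real part and lie in the cone; this makes `G Y`
  -- real.
  have h2 := hG (Complex.I • Y) fun ξ => by
    rw [matForm_smul]; simp [← (Complex.nonneg_iff.1 (e4 ξ)).2]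
  have h3 := hG (-Complex.I • Y) fun ξ => by
    rw [matForm_smul]; simp [← (Complex.nonneg_iff.1 (e4 ξ)).2]
  rw [map_smul] at h2 h3
  simp at h2 h3
  exact Complex.nonneg_iff.2 ⟨h1, le_antisymm h3 h2⟩

/-- The M. Riesz extension theorem for a functional on the range of a linear map. -/
lemma exists_nonneg_extension {E F : Type*} [AddCommGroup E] [Module ℝ E] [AddCommGroup F]
    [Module ℝ F] (s : PointedCone ℝ E) (p : F →ₗ[ℝ] E) (g : F →ₗ[ℝ] ℝ)
    (hg : ∀ C, p C ∈ s → 0 ≤ g C) (hs : ∀ y, ∃ C, p C + y ∈ s) :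
    ∃ G : E →ₗ[ℝ] ℝ, (∀ C, G (p C) = g C) ∧ ∀ x ∈ s, 0 ≤ G x := by
  -- On the kernel of `p` both `C` and `-C` are mapped into the cone, so `g` vanishes there and
  -- descends to the range.
  obtain ⟨f, hf⟩ := LinearMap.exists_factor_of_surjective (R := ℝ) (W := LinearMap.range p)
    p.rangeRestrict g p.surjective_rangeRestrict (fun C hC => by
      have h0 : p C = 0 := congrArg Subtype.val hC
      have h1 := hg C (h0 ▸ Submodule.zero_mem _)
      have h2 := hg (-C) (by rw [map_neg, h0, neg_zero]; exact Submodule.zero_mem _)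
      rw [map_neg] at h2
      linarith)
  obtain ⟨G, hG, hGpos⟩ := riesz_extension s ⟨LinearMap.range p, f⟩
    (by
      rintro ⟨_, C, rfl⟩ hC
      exact (hg C hC).trans_eq (hf C).symm)
    (fun y => (hs y).imp' (fun C => ⟨p C, C, rfl⟩) fun C hC => hC)
  exact ⟨G, fun C => (hG ⟨p C, C, rfl⟩).trans (hf C), hGpos⟩

/-- Completely positive maps into `M_n` with prescribed values at finitely many elements, one of
which is the unit. -/
lemma exists_cp_of_pairing_nonneg {V : Submodule ℂ (H →L[ℂ] H)} (a : ι → V) (o : ι)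
    (ho : (a o : H →L[ℂ] H) = 1) (x : ι → Matrix (Fin n) (Fin n) ℂ)
    (hpos : ∀ C : ι → Matrix (Fin n) (Fin n) ℂ,
      (∀ ξ, 0 ≤ (pairing C (opGram (fun κ => (a κ : H →L[ℂ] H)) ξ)).re) → 0 ≤ (pairing C x).re) :
    ∃ φ : V →ₗ[ℂ] Matrix (Fin n) (Fin n) ℂ, IsCP (opCone V) (matCone n) φ ∧
      ∀ κ, φ (a κ) = x κ := by
  classical
  let p : (ι → Matrix (Fin n) (Fin n) ℂ) →ₗ[ℝ] Matrix (Fin n) (Fin n) V :=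
    (pencilMap a n).restrictScalars ℝ
  let g : (ι → Matrix (Fin n) (Fin n) ℂ) →ₗ[ℝ] ℝ :=
    { toFun := fun C => (pairing C x).re
      map_add' := fun C D => by rw [pairing_add_left, Complex.add_re]
      map_smul' := fun c C => by
        have : c • C = (c : ℂ) • C := (Complex.coe_smul c C).symm
        rw [this, pairing_smul_left, Complex.re_ofReal_mul]; rfl }
  have hgp : ∀ C, p C ∈ realPartCone V n → 0 ≤ g C := fun C hC =>
    hpos C fun ξ => by
      rw [← matForm_pencilMap]
      exact hC ξ
  obtain ⟨G, hG, hGpos⟩ := exists_nonneg_extension (realPartCone V n) p g hgp (by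
      intro y
      -- Cofinality for the Riesz theorem: `c` times the unit dominates the form of `y`.
      set c : ℝ := ∑ i, ∑ j, ‖(y i j : H →L[ℂ] H)‖
      set D : ι → Matrix (Fin n) (Fin n) ℂ := Pi.single o ((c : ℂ) • 1) with hD
      refine ⟨D, fun ξ => ?_⟩
      have e : matForm (p D) ξ = ((c * ∑ i, ‖ξ i‖ ^ 2 : ℝ) : ℂ) := by
        change matForm (pencilMap a n D) ξ = _
        rw [matForm_pencilMap, pairing, Finset.sum_eq_single o]
        · simp [hD, ho, Matrix.one_apply, Finset.mul_sum, inner_self_eq_norm_sq_to_K]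
        · intro κ _ hκ
          simp [hD, Pi.single_eq_of_ne hκ]
        · simp
      change 0 ≤ (matForm (p D + y) ξ).re
      rw [matForm_add, e, Complex.add_re, Complex.ofReal_re]
      have h1 := norm_matForm_le y ξ
      have h2 := (abs_le.1 (Complex.abs_re_le_norm (matForm y ξ))).1
      linarith)
  let Gc : Matrix (Fin n) (Fin n) V →ₗ[ℂ] ℂ := Module.Dual.extendRCLike (𝕜 := ℂ) G
  have hre : ∀ X, (Gc X).re = G X := fun X => Module.Dual.re_extendRCLike_apply (𝕜 := ℂ) G X
  have hp : ∀ C, (Gc (pencilMap a n C)).re = (pairing C x).re := fun C => by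
    rw [hre]
    exact hG C
  -- Real parts agree for all coefficients, so applying this to `-iC` matches imaginary parts too.
  have hp' : ∀ C, Gc (pencilMap a n C) = pairing C x := fun C => by
    refine Complex.ext (hp C) ?_
    have h := hp (-Complex.I • C)
    rw [map_smul, map_smul, pairing_smul_left] at h
    simpa using h
  obtain ⟨φ, hφ, hφ'⟩ := exists_cp_of_functional Gc fun X hX => (hGpos X hX).trans_eq (hre X).symm
  refine ⟨φ, hφ, fun κ => ?_⟩
  ext i j
  rw [hφ']
  have e : Matrix.single i j (a κ) = pencilMap a n (Pi.single κ (Matrix.single i j 1)) := by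
    ext i' j' : 2
    simp only [pencilMap, LinearMap.coe_mk, AddHom.coe_mk, Matrix.of_apply]
    rw [Finset.sum_eq_single κ]
    · by_cases h : i = i' ∧ j = j'
      · simp [h]
      · simp [h]
    · intro κ' _ h
      simp [Pi.single_eq_of_ne h]
    · simp
  rw [e, hp', pairing, Finset.sum_eq_single κ]
  · simp [Matrix.single_apply, Finset.sum_ite_eq, ite_and]
  · intro κ' _ h
    simp [Pi.single_eq_of_ne h]
  · simp

end Extension

/-! ### The matrix range as the dual of the positive pencils; its first level. -/

section MatrixRange

variable {m n d : ℕ}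
variable {H : Type*} [NormedAddCommGroup H] [InnerProductSpace ℂ H] [CompleteSpace H]

lemma homog_mem_cstarGenerated (A : Fin d → H →L[ℂ] H) (κ : Option (Fin d)) :
    homog A κ ∈ cstarGenerated A := by
  cases κ with
  | none => exact one_mem_cstarGenerated A
  | some j => exact mem_cstarGenerated A j

lemma inner_self_eq_ofReal {H : Type*} [NormedAddCommGroup H] [InnerProductSpace ℂ H] (ξ : H) :
    ⟪ξ, ξ⟫_ℂ = ((‖ξ‖ ^ 2 : ℝ) : ℂ) := by
  rw [inner_self_eq_norm_sq_to_K, Complex.ofReal_pow]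
  rfl

lemma neg_norm_mul_le_re_inner {H : Type*} [NormedAddCommGroup H] [InnerProductSpace ℂ H]
    (T : H →L[ℂ] H) (ξ : H) : -(‖T‖ * ‖ξ‖ ^ 2) ≤ (⟪ξ, T ξ⟫_ℂ).re := by
  have h1 := (abs_le.1 (Complex.abs_re_le_norm ⟪ξ, T ξ⟫_ℂ)).1
  have h2 : ‖⟪ξ, T ξ⟫_ℂ‖ ≤ ‖ξ‖ * (‖T‖ * ‖ξ‖) := (norm_inner_le_norm _ _).trans
    (mul_le_mul_of_nonneg_left (T.le_opNorm _) (norm_nonneg _))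
  nlinarith

/-- The operator `‖T‖ + T` is positive, so its image is Hermitian; subtract the multiple of the
unit. -/
lemma isHermitian_of_isCP {V : Submodule ℂ (H →L[ℂ] H)} (h1 : 1 ∈ V)
    {φ : V →ₗ[ℂ] Matrix (Fin n) (Fin n) ℂ} (hφ1 : φ ⟨1, h1⟩ = 1)
    (hφ : IsCP (opCone V) (matCone n) φ) {T : H →L[ℂ] H} (hT : T ∈ V) (hsa : IsSelfAdjoint T) :
    (φ ⟨T, hT⟩).IsHermitian := by
  have h := hφ 1 (Matrix.of fun _ _ => ((‖T‖ : ℂ) • ⟨1, h1⟩ + ⟨T, hT⟩)) (fun ξ => by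
    simp only [Fin.sum_univ_one, Matrix.of_apply, Submodule.coe_add, Submodule.coe_smul,
      add_apply, smul_apply, inner_add_right, inner_smul_right, one_apply_eq_self]
    rw [inner_eq_re_of_isSelfAdjoint hsa, inner_self_eq_ofReal]
    have h2 := neg_norm_mul_le_re_inner T (ξ 0)
    have h3 : 0 ≤ ‖T‖ * ‖ξ 0‖ ^ 2 + (⟪ξ 0, T (ξ 0)⟫_ℂ).re := by linarith
    exact_mod_cast h3)
  have h2 : (φ ((‖T‖ : ℂ) • ⟨1, h1⟩ + ⟨T, hT⟩)).IsHermitian := by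
    ext i j
    have := congrFun (congrFun h.isHermitian (0, i)) (0, j)
    simpa [Matrix.comp_apply] using this
  rw [map_add, map_smul, hφ1] at h2
  have h3 : ((‖T‖ : ℂ) • (1 : Matrix (Fin n) (Fin n) ℂ)).IsHermitian := by
    simp [Matrix.IsHermitian, Matrix.conjTranspose_smul]
  simpa using h2.sub h3

/-- The matrix range in terms of positive pencils. -/
lemma mem_matrixRange_iff {A : Fin d → H →L[ℂ] H} (hA : ∀ i, IsSelfAdjoint (A i))
    {X : Fin d → Matrix (Fin n) (Fin n) ℂ} :
    X ∈ matrixRange A n ↔ (∀ j, (X j).IsHermitian) ∧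
      ∀ C ∈ pencilCone (homog A) n, 0 ≤ pairing C (homog X) := by
  let a : Option (Fin d) → cstarGenerated A := fun κ => ⟨homog A κ, homog_mem_cstarGenerated A κ⟩
  constructor
  · rintro ⟨φ, h1, hφ, hX⟩
    have hX' : homog X = fun κ => φ (a κ) := by
      funext κ
      cases κ with
      | none => exact h1.symm
      | some j => exact (hX j).symm
    refine ⟨fun j => ?_, fun C hC => ?_⟩
    · rw [← hX j]
      exact isHermitian_of_isCP (one_mem_cstarGenerated A) h1 hφ _ (hA j)
    · have h2 := matCone_pairing_nonneg (hφ n (pencilMap a n C) (fun ξ => by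
        have := hC.2 ξ
        rwa [← matForm_pencilMap a C ξ] at this))
      convert h2 using 1
      simp only [hX', pairing, pencilMap, LinearMap.coe_mk, AddHom.coe_mk, Matrix.map_apply,
        Matrix.of_apply, map_sum, map_smul, Matrix.sum_apply, Matrix.smul_apply, smul_eq_mul]
      rw [Finset.sum_comm]
      exact Finset.sum_congr rfl fun _ _ => Finset.sum_comm
  · rintro ⟨hX, hpos⟩
    obtain ⟨φ, hφ, hφX⟩ := exists_cp_of_pairing_nonneg a none rfl (homog X) (fun C hC => by
      have h1 := hpos (hermPart C) ⟨hermPart_isHermitian C, fun ξ => by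
        rw [pairing_hermPart C (opGram_isHermitian (isSelfAdjoint_homog hA) ξ)]
        exact_mod_cast hC ξ⟩
      rw [pairing_hermPart C (isHermitian_homog hX)] at h1
      exact_mod_cast h1)
    exact ⟨φ, hφX none, hφ, fun j => hφX (some j)⟩

lemma homog_opGram {H : Type*} [NormedAddCommGroup H] [InnerProductSpace ℂ H]
    {A : Fin d → H →L[ℂ] H} {v : Fin n → H} (hv : Orthonormal ℂ v) :
    homog (opGram A v) = opGram (homog A) v := by
  funext κ
  cases κ with
  | none =>
    ext i j
    simp [Matrix.one_apply, orthonormal_iff_ite.1 hv]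
  | some j => rfl

/-- Compressions to orthonormal families belong to the matrix range. -/
lemma compression_mem_matrixRange {A : Fin d → H →L[ℂ] H} (hA : ∀ i, IsSelfAdjoint (A i))
    {v : Fin n → H} (hv : Orthonormal ℂ v) : opGram A v ∈ matrixRange A n := by
  refine (mem_matrixRange_iff hA).2 ⟨opGram_isHermitian hA v, fun C hC => ?_⟩
  rw [homog_opGram hv]
  exact hC.2 v

/-- The tuple of scalar `1 × 1` matrices with given real entries. -/
def scalarTuple (x : Fin d → ℝ) : Fin d → Matrix (Fin 1) (Fin 1) ℂ :=
  fun j => (x j : ℂ) • (1 : Matrix (Fin 1) (Fin 1) ℂ)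

lemma mem_levelOne {S : FreeSet d} {x : Fin d → ℝ} : x ∈ levelOne S ↔ scalarTuple x ∈ S 1 := Iff.rfl

lemma scalarTuple_apply (x : Fin d → ℝ) (j : Fin d) (a b : Fin 1) :
    scalarTuple x j a b = x j := by
  simp [scalarTuple, Subsingleton.elim a b]

lemma homog_scalarTuple_apply (x : Fin d → ℝ) (κ : Option (Fin d)) (a b : Fin 1) :
    homog (scalarTuple x) κ a b = (homog x κ : ℝ) := by
  cases κ with
  | none => simp [Subsingleton.elim a b]
  | some j => exact scalarTuple_apply x j a b

lemma scalarTuple_isHermitian (x : Fin d → ℝ) (j : Fin d) : (scalarTuple x j).IsHermitian := by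
  ext a b
  simp [scalarTuple_apply]

lemma eq_scalarTuple_of_isHermitian {X : Fin d → Matrix (Fin 1) (Fin 1) ℂ}
    (hX : ∀ j, (X j).IsHermitian) : X = scalarTuple fun j => (X j 0 0).re := by
  funext j
  ext a b
  rw [scalarTuple_apply, Subsingleton.elim a 0, Subsingleton.elim b 0]
  have := congrFun (congrFun (hX j) 0) 0
  exact (Complex.conj_eq_iff_re.1 this).symm

lemma scalar_pencil_mem_iff {ι : Type*} [Fintype ι] {a : ι → H →L[ℂ] H}
    (ha : ∀ κ, IsSelfAdjoint (a κ)) {c : ι → ℝ} :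
    (fun κ => Matrix.of fun _ _ => (c κ : ℂ)) ∈ pencilCone a 1 ↔ c ∈ scalarCone a := by
  have e : ∀ ξ : Fin 1 → H, pairing (fun κ => Matrix.of fun _ _ => (c κ : ℂ)) (opGram a ξ) =
      ((∑ κ, c κ * (⟪ξ 0, a κ (ξ 0)⟫_ℂ).re : ℝ) : ℂ) := fun ξ => by
    simp only [pairing, Fin.sum_univ_one, Matrix.of_apply, opGram_apply]
    rw [Finset.sum_congr rfl fun κ _ =>
      congrArg _ (inner_eq_re_of_isSelfAdjoint (ha κ) (ξ 0))]
    push_cast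
    rfl
  constructor
  · rintro ⟨-, h⟩ ξ
    have h1 := h fun _ => ξ
    rw [e] at h1
    exact_mod_cast h1
  · intro h
    refine ⟨fun κ => by ext; simp, fun ξ => ?_⟩
    rw [e]
    exact_mod_cast h (ξ 0)

lemma eq_scalar_pencil {ι : Type*} {C : ι → Matrix (Fin 1) (Fin 1) ℂ}
    (hC : ∀ κ, (C κ).IsHermitian) : C = fun κ => Matrix.of fun _ _ => ((C κ 0 0).re : ℂ) := by
  funext κ
  ext a b
  rw [Subsingleton.elim a 0, Subsingleton.elim b 0]
  have := congrFun (congrFun (hC κ) 0) 0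
  exact (Complex.conj_eq_iff_re.1 this).symm

lemma pairing_scalar (c : Option (Fin d) → ℝ) (x : Fin d → ℝ) :
    pairing (fun κ => Matrix.of fun _ _ => (c κ : ℂ)) (homog (scalarTuple x)) =
      ((∑ κ, c κ * homog x κ : ℝ) : ℂ) := by
  simp [pairing, homog_scalarTuple_apply, -Fintype.sum_option]

lemma mem_levelOne_matrixRange_iff {A : Fin d → H →L[ℂ] H} (hA : ∀ i, IsSelfAdjoint (A i))
    {x : Fin d → ℝ} : x ∈ levelOne (matrixRange A) ↔
      ∀ c ∈ scalarCone (homog A), 0 ≤ ∑ κ, c κ * homog x κ := by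
  rw [mem_levelOne, mem_matrixRange_iff hA]
  constructor
  · rintro ⟨-, h⟩ c hc
    have h1 := h _ ((scalar_pencil_mem_iff (isSelfAdjoint_homog hA)).2 hc)
    rw [pairing_scalar] at h1
    exact_mod_cast h1
  · intro h
    refine ⟨scalarTuple_isHermitian x, fun C hC => ?_⟩
    have e := eq_scalar_pencil hC.1
    rw [e] at hC
    rw [e, pairing_scalar]
    exact_mod_cast h _ ((scalar_pencil_mem_iff (isSelfAdjoint_homog hA)).1 hC)

/-- Bipolarity without a separation argument: the normalized vector states of `A` already lie in the
first level, and they detect positivity. -/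
lemma mem_scalarCone_homog_iff {A : Fin d → H →L[ℂ] H} (hA : ∀ i, IsSelfAdjoint (A i))
    {c : Option (Fin d) → ℝ} : c ∈ scalarCone (homog A) ↔
      ∀ x ∈ levelOne (matrixRange A), 0 ≤ ∑ κ, c κ * homog x κ := by
  refine ⟨fun hc x hx => (mem_levelOne_matrixRange_iff hA).1 hx c hc, fun h ξ => ?_⟩
  rcases eq_or_ne ξ 0 with rfl | hξ
  · simp
  have hpos : 0 < ‖ξ‖ ^ 2 := by positivity
  have e : ∀ c' : Option (Fin d) → ℝ, ∑ κ, c' κ * (⟪ξ, homog A κ ξ⟫_ℂ).re =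
      ‖ξ‖ ^ 2 * ∑ κ, c' κ * homog (fun j => (⟪ξ, A j ξ⟫_ℂ).re / ‖ξ‖ ^ 2) κ := fun c' => by
    rw [Finset.mul_sum]
    refine Finset.sum_congr rfl fun κ _ => ?_
    cases κ with
    | none =>
      simp only [homog_none, one_apply_eq_self, inner_self_eq_ofReal, Complex.ofReal_re]
      ring
    | some j =>
      simp only [homog_some]
      field_simp
  rw [e]
  refine mul_nonneg hpos.le (h _ ((mem_levelOne_matrixRange_iff hA).2 fun c' hc' => ?_))
  have := hc' ξ
  rw [e] at this
  exact nonneg_of_mul_nonneg_right this hpos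

lemma continuous_homog (κ : Option (Fin d)) : Continuous fun x : Fin d → ℝ => homog x κ := by
  cases κ with
  | none => exact continuous_const
  | some j => exact continuous_apply j

/-- Closed as an intersection of half-spaces, and bounded because the pencils `‖A_j‖ ± A_j` are
positive. -/
lemma isCompact_levelOne_matrixRange {A : Fin d → H →L[ℂ] H} (hA : ∀ i, IsSelfAdjoint (A i)) :
    IsCompact (levelOne (matrixRange A)) := by
  have hclosed : IsClosed (levelOne (matrixRange A)) := by
    have : levelOne (matrixRange A) = ⋂ c ∈ scalarCone (homog A),
        {x | 0 ≤ ∑ κ, c κ * homog x κ} := by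
      ext x
      rw [mem_levelOne_matrixRange_iff hA]
      simp only [Set.mem_iInter, Set.mem_ofPred_eq]
    rw [this]
    exact isClosed_biInter fun c _ => isClosed_le continuous_const
      (continuous_finsetSum _ fun κ _ => continuous_const.mul (continuous_homog κ))
  refine (isCompact_Icc (a := fun j => -‖A j‖) (b := fun j => ‖A j‖)).of_isClosed_subset hclosed ?_
  classical
  have key : ∀ x ∈ levelOne (matrixRange A), ∀ j, ∀ s : ℝ, |s| = 1 → 0 ≤ ‖A j‖ + s * x j := by
    intro x hx j s hs
    have h := (mem_levelOne_matrixRange_iff hA).1 hx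
      (fun κ => κ.elim ‖A j‖ (fun i => if i = j then s else 0)) (fun ξ => by
        simp only [Fintype.sum_option, Option.elim, homog_none, homog_some, ite_mul, zero_mul,
          Finset.sum_ite_eq', Finset.mem_univ, if_true, one_apply_eq_self,
          inner_self_eq_ofReal, Complex.ofReal_re]
        have h2 := Complex.abs_re_le_norm ⟪ξ, A j ξ⟫_ℂ
        have h3 : ‖⟪ξ, A j ξ⟫_ℂ‖ ≤ ‖ξ‖ * (‖A j‖ * ‖ξ‖) := (norm_inner_le_norm _ _).trans
          (mul_le_mul_of_nonneg_left ((A j).le_opNorm _) (norm_nonneg _))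
        have h4 := neg_abs_le (s * (⟪ξ, A j ξ⟫_ℂ).re)
        rw [abs_mul, hs] at h4
        nlinarith)
    simpa using h
  intro x hx
  exact ⟨fun j => by have := key x hx j 1 (by simp); linarith,
    fun j => by have := key x hx j (-1) (by simp); linarith⟩

/-- The value `C_0 + ∑_j x_j C_j` of a pencil at a real point. -/
def evalPencil (C : Option (Fin d) → Matrix (Fin n) (Fin n) ℂ) (x : Fin d → ℝ) :
    Matrix (Fin n) (Fin n) ℂ := ∑ κ, ((homog x κ : ℝ) : ℂ) • C κ

/-- A pencil which is positive at `B` is positive at all points dual to the scalar cone of `B`. -/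
lemma evalPencil_posSemidef {B : Fin d → H →L[ℂ] H} (hB : ∀ i, IsSelfAdjoint (B i))
    {x : Fin d → ℝ} (hx : ∀ c ∈ scalarCone (homog B), 0 ≤ ∑ κ, c κ * homog x κ)
    {C : Option (Fin d) → Matrix (Fin n) (Fin n) ℂ} (hC : C ∈ pencilCone (homog B) n) :
    (evalPencil C x).PosSemidef := by
  refine Matrix.posSemidef_of_forall_nonneg fun v => ?_
  -- Compressing `C` by the column `v` gives a scalar pencil, on which `x` can be tested.
  have h1 := compress_mem_pencilCone hC (Matrix.of fun i (_ : Fin 1) => v i)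
  have h2 := h1.1
  rw [eq_scalar_pencil h2, scalar_pencil_mem_iff (isSelfAdjoint_homog hB)] at h1
  have h3 := hx _ h1
  have h4 := eq_scalar_pencil h2
  have e : ∀ κ, star v ⬝ᵥ (C κ).mulVec v =
      ((compress (Matrix.of fun i (_ : Fin 1) => v i) C κ 0 0).re : ℂ) := fun κ => by
    have h5 := congrFun (congrFun (congrFun h4 κ) 0) 0
    simp only [Matrix.of_apply] at h5
    rw [← h5]
    simp only [compress, Matrix.mul_assoc]
    simp [Matrix.mul_apply, dotProduct, Matrix.mulVec]
  rw [evalPencil, Matrix.sum_mulVec, dotProduct_sum]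
  simp only [Matrix.smul_mulVec, dotProduct_smul, e, smul_eq_mul]
  have h6 : 0 ≤ ∑ κ, homog x κ * (compress (Matrix.of fun i (_ : Fin 1) => v i) C κ 0 0).re := by
    simpa only [mul_comm] using h3
  exact_mod_cast h6

end MatrixRange

/-! ### One-variable pencils and complete positivity under rank one symmetry. -/

section RankOne

variable {n d : ℕ}
variable {H : Type*} [NormedAddCommGroup H] [InnerProductSpace ℂ H]

/-- The form `∑_{ij} E_{ij} ⟪ξ_i, T ξ_j⟫` of the operator `E ⊗ T`, bilinear in `E` and `T`. -/
def tensorForm (ξ : Fin n → H) : Matrix (Fin n) (Fin n) ℂ →ₗ[ℂ] (H →L[ℂ] H) →ₗ[ℂ] ℂ :=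
  LinearMap.mk₂ ℂ (fun E T => ∑ i, ∑ j, E i j * ⟪ξ i, T (ξ j)⟫_ℂ)
    (fun E F T => by simp [add_mul, Finset.sum_add_distrib])
    (fun c E T => by simp [mul_assoc, Finset.mul_sum])
    (fun E S T => by simp [mul_add, Finset.sum_add_distrib])
    (fun c E T => by simp [Finset.mul_sum, mul_left_comm])

lemma tensorForm_apply (ξ : Fin n → H) (E : Matrix (Fin n) (Fin n) ℂ) (T : H →L[ℂ] H) :
    tensorForm ξ E T = ∑ i, ∑ j, E i j * ⟪ξ i, T (ξ j)⟫_ℂ := rfl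

lemma pairing_opGram {ι : Type*} [Fintype ι] (C : ι → Matrix (Fin n) (Fin n) ℂ)
    (a : ι → H →L[ℂ] H) (ξ : Fin n → H) :
    pairing C (opGram a ξ) = ∑ κ, tensorForm ξ (C κ) (a κ) := rfl

open scoped MatrixOrder in
lemma Matrix.PosSemidef.exists_conjTranspose_mul_self {E : Matrix (Fin n) (Fin n) ℂ}
    (hE : E.PosSemidef) : ∃ R : Matrix (Fin n) (Fin n) ℂ, E = R.conjTranspose * R :=
  CStarAlgebra.nonneg_iff_eq_star_mul_self.mp hE.nonneg

/-- Factoring `E = R*R` turns the form into a sum of quadratic forms of `T`, one for each row of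
`R`. -/
lemma tensorForm_nonneg (ξ : Fin n → H) {E : Matrix (Fin n) (Fin n) ℂ} (hE : E.PosSemidef)
    {T : H →L[ℂ] H} (hT : ∀ η, 0 ≤ ⟪η, T η⟫_ℂ) : 0 ≤ tensorForm ξ E T := by
  obtain ⟨R, rfl⟩ := hE.exists_conjTranspose_mul_self
  have e : tensorForm ξ (R.conjTranspose * R) T =
      ∑ r, ⟪∑ i, R r i • ξ i, T (∑ j, R r j • ξ j)⟫_ℂ := by
    simp only [tensorForm_apply, Matrix.mul_apply, Matrix.conjTranspose_apply, map_sum, map_smul,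
      sum_inner, inner_sum, inner_smul_left, inner_smul_right, Finset.sum_mul, Finset.mul_sum,
      starRingEnd_apply]
    calc _ = ∑ i, ∑ r, ∑ j, star (R r i) * R r j * ⟪ξ i, T (ξ j)⟫_ℂ :=
          Finset.sum_congr rfl fun i _ => Finset.sum_comm
      _ = _ := by
          rw [Finset.sum_comm]
          refine Finset.sum_congr rfl fun r _ => ?_
          rw [Finset.sum_comm]
          exact Finset.sum_congr rfl fun i _ => Finset.sum_congr rfl fun j _ => by ring
  rw [e]
  exact Finset.sum_nonneg fun r _ => hT _

/-- If `E₀ + α E₁` and `E₀ + β E₁` are positive and `α ≤ T ≤ β`, then `E₀ ⊗ 1 + E₁ ⊗ T` is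
positive. -/
lemma tensorForm_interval_nonneg (ξ : Fin n → H) {E₀ E₁ : Matrix (Fin n) (Fin n) ℂ} {α β : ℝ}
    (hα : (E₀ + (α : ℂ) • E₁).PosSemidef) (hβ : (E₀ + (β : ℂ) • E₁).PosSemidef) {T : H →L[ℂ] H}
    (hTα : ∀ η, 0 ≤ ⟪η, (T - (α : ℂ) • (1 : H →L[ℂ] H)) η⟫_ℂ)
    (hTβ : ∀ η, 0 ≤ ⟪η, ((β : ℂ) • (1 : H →L[ℂ] H) - T) η⟫_ℂ) :
    0 ≤ tensorForm ξ E₀ 1 + tensorForm ξ E₁ T := by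
  by_cases hne : ∃ η : H, η ≠ 0
  swap
  · push Not at hne
    simp [tensorForm_apply, hne]
  obtain ⟨η₀, hη₀⟩ := hne
  have hle : α ≤ β := by
    have h := add_nonneg (hTα η₀) (hTβ η₀)
    rw [← inner_add_right, ← add_apply, sub_add_sub_cancel', ← sub_smul, smul_apply,
      inner_smul_right, one_apply_eq_self, inner_self_eq_ofReal] at h
    have h' : 0 ≤ (β - α) * ‖η₀‖ ^ 2 := by exact_mod_cast h
    have hpos : 0 < ‖η₀‖ ^ 2 := by positivity
    linarith [nonneg_of_mul_nonneg_left h' hpos]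
  have h1 := tensorForm_nonneg ξ hα hTβ
  have h2 := tensorForm_nonneg ξ hβ hTα
  simp only [map_add, map_sub, map_smul, LinearMap.add_apply, LinearMap.smul_apply,
    smul_eq_mul] at h1 h2
  -- If `α = β`, then `T` is the scalar `α`. Otherwise divide the identity `(β - α)(E₀ ⊗ 1 + E₁ ⊗ T)
  -- = (E₀ + αE₁) ⊗ (β - T) + (E₀ + βE₁) ⊗ (T - α)` by `β - α`.
  rcases hle.eq_or_lt with rfl | hlt
  · have hT : T = (α : ℂ) • (1 : H →L[ℂ] H) := by
      have hz : ∀ η : H, ⟪(T - (α : ℂ) • (1 : H →L[ℂ] H)) η, η⟫_ℂ = 0 := by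
        intro η
        rw [← inner_conj_symm]
        have h3 := hTβ η
        rw [← neg_sub, neg_apply, inner_neg_right, neg_nonneg] at h3
        rw [le_antisymm h3 (hTα η), map_zero]
      have := (inner_map_self_eq_zero ((T - (α : ℂ) • (1 : H →L[ℂ] H) : H →L[ℂ] H) :
        H →ₗ[ℂ] H)).1 hz
      refine sub_eq_zero.1 (ContinuousLinearMap.ext fun η => LinearMap.congr_fun this η)
    have h3 := tensorForm_nonneg ξ hα (T := 1) (fun η => by
      rw [one_apply_eq_self, inner_self_eq_ofReal]
      exact_mod_cast sq_nonneg ‖η‖)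
    simp only [map_add, map_smul, LinearMap.add_apply, LinearMap.smul_apply, smul_eq_mul] at h3
    rw [hT, map_smul, smul_eq_mul]
    exact h3
  · have h3 := add_nonneg h1 h2
    have hne : ((β : ℂ) - α) ≠ 0 := by exact_mod_cast (sub_pos.2 hlt).ne'
    have hβα : (0 : ℂ) ≤ (((β - α)⁻¹ : ℝ) : ℂ) := by
      exact_mod_cast inv_nonneg.2 (sub_pos.2 hlt).le
    refine (mul_nonneg hβα h3).trans_eq ?_
    push_cast
    field_simp
    ring

lemma Matrix.exists_vecMulVec_of_rank_eq_one {l : Matrix (Fin d) (Fin d) ℝ} (hl : l.rank = 1) :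
    ∃ u v : Fin d → ℝ, ∀ i j, l i j = u i * v j := by
  rw [Matrix.rank, finrank_eq_one_iff'] at hl
  obtain ⟨u, -, hu⟩ := hl
  choose v hv using fun j => hu ⟨l.mulVec (Pi.single j 1), Pi.single j 1, rfl⟩
  refine ⟨u.1, v, fun i j => ?_⟩
  have := congrFun (congrArg Subtype.val (hv j)) i
  simp at this
  rw [← this, mul_comm]

variable [CompleteSpace H]

lemma nonneg_inner_of_mem_scalarCone {A : Fin d → H →L[ℂ] H} (hA : ∀ i, IsSelfAdjoint (A i))
    {c : Option (Fin d) → ℝ} (hc : c ∈ scalarCone (homog A)) (η : H) :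
    0 ≤ ⟪η, (∑ κ, (c κ : ℂ) • homog A κ) η⟫_ℂ := by
  rw [inner_sum_smul, Finset.sum_congr rfl fun κ _ =>
    congrArg _ (inner_eq_re_of_isSelfAdjoint (isSelfAdjoint_homog hA κ) η)]
  exact_mod_cast hc η

/-- Under a rank one symmetry of `L`, a pencil that is positive on `L` is positive at `A / C` for
all tuples `A` with numerical range in `L`. -/
lemma tensorForm_rankOne_nonneg {L : Set (Fin d → ℝ)} (hL : IsCompact L) (hLne : L.Nonempty)
    {c : ℝ} (hc : 0 < c) {l : Matrix (Fin d) (Fin d) ℝ} (hl : l.rank = 1)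
    (hlL : ∀ x ∈ L, ∃ y ∈ L, l.mulVec x = c • y) {A : Fin d → H →L[ℂ] H}
    (hA : ∀ i, IsSelfAdjoint (A i))
    (hAL : ∀ c : Option (Fin d) → ℝ, (∀ x ∈ L, 0 ≤ ∑ κ, c κ * homog x κ) →
      c ∈ scalarCone (homog A))
    {D : Option (Fin d) → Matrix (Fin n) (Fin n) ℂ} (hD : ∀ x ∈ L, (evalPencil D x).PosSemidef)
    (ξ : Fin n → H) :
    0 ≤ tensorForm ξ (D none) 1 +
      ∑ i, tensorForm ξ (D (some i)) (((1 / c : ℝ) : ℂ) • ∑ j, (l i j : ℂ) • A j) := by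
  obtain ⟨u, v, huv⟩ := Matrix.exists_vecMulVec_of_rank_eq_one hl
  have hcont : ContinuousOn (fun x : Fin d → ℝ => ∑ j, v j * x j) L :=
    (continuous_finsetSum _ fun j _ => continuous_const.mul (continuous_apply j)).continuousOn
  -- By compactness the extreme values `α`, `β` of `x ↦ ∑ v_j x_j` on `L` are attained; they enclose
  -- `T = ∑ v_j A_j`.
  obtain ⟨xα, hxα, hα⟩ := hL.exists_isMinOn hLne hcont
  obtain ⟨xβ, hxβ, hβ⟩ := hL.exists_isMaxOn hLne hcont
  set E₁ : Matrix (Fin n) (Fin n) ℂ := ∑ i, ((u i / c : ℝ) : ℂ) • D (some i) with hE₁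
  set T : H →L[ℂ] H := ∑ j, (v j : ℂ) • A j with hT
  -- This is the value of `D` at `y = l x / c`, a point of `L` that depends on `x` only through `∑
  -- v_j x_j`.
  have hpsd : ∀ x ∈ L, (D none + ((∑ j, v j * x j : ℝ) : ℂ) • E₁).PosSemidef := by
    intro x hx
    obtain ⟨y, hy, hxy⟩ := hlL x hx
    have h := hD y hy
    have hyi : ∀ i, y i = (∑ j, v j * x j) * (u i / c) := fun i => by
      have h1 := congrFun hxy i
      simp only [Matrix.mulVec, dotProduct, huv, Pi.smul_apply, smul_eq_mul] at h1
      have h2 : ∑ j, u i * v j * x j = u i * ∑ j, v j * x j := by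
        rw [Finset.mul_sum]; exact Finset.sum_congr rfl fun _ _ => by ring
      rw [h2] at h1
      field_simp
      linarith
    convert h using 1
    rw [evalPencil, Fintype.sum_option, hE₁, Finset.smul_sum]
    simp only [homog_none, homog_some, Complex.ofReal_one, one_smul, hyi, smul_smul,
      Complex.ofReal_mul]
  have hTα : ∀ η, 0 ≤ ⟪η, (T - ((∑ j, v j * xα j : ℝ) : ℂ) • (1 : H →L[ℂ] H)) η⟫_ℂ := fun η => by
    have h := nonneg_inner_of_mem_scalarCone hA
      (hAL (fun κ => κ.elim (-∑ j, v j * xα j) v) fun x hx => by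
        have := hα hx
        simp only [Set.mem_ofPred_eq] at this
        simpa [Fintype.sum_option] using this) η
    convert h using 3
    rw [Fintype.sum_option, hT]
    simp [sub_eq_neg_add]
  have hTβ : ∀ η, 0 ≤ ⟪η, (((∑ j, v j * xβ j : ℝ) : ℂ) • (1 : H →L[ℂ] H) - T) η⟫_ℂ := fun η => by
    have h := nonneg_inner_of_mem_scalarCone hA
      (hAL (fun κ => κ.elim (∑ j, v j * xβ j) (fun j => -v j)) fun x hx => by
        have := hβ hx
        simp only [Set.mem_ofPred_eq] at this
        simpa [Fintype.sum_option] using this) η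
    convert h using 3
    rw [Fintype.sum_option, hT]
    simp [sub_eq_add_neg]
  have h := tensorForm_interval_nonneg ξ (hpsd xα hxα) (hpsd xβ hxβ) hTα hTβ
  convert h using 2
  rw [hE₁, map_sum (tensorForm ξ), LinearMap.sum_apply]
  refine Finset.sum_congr rfl fun i _ => ?_
  have e : ∑ j, (l i j : ℂ) • A j = (u i : ℂ) • T := by
    rw [hT, Finset.smul_sum]
    exact Finset.sum_congr rfl fun j _ => by rw [huv, Complex.ofReal_mul, smul_smul]
  rw [e, map_smul, map_smul, map_smul, LinearMap.smul_apply]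
  simp only [smul_eq_mul]
  push_cast
  ring

variable {K : Type*} [NormedAddCommGroup K] [InnerProductSpace ℂ K] [CompleteSpace K]

lemma isSelfAdjoint_real_smul {A : Fin d → H →L[ℂ] H} (hA : ∀ i, IsSelfAdjoint (A i)) (t : ℝ)
    (i : Fin d) : IsSelfAdjoint ((t : ℂ) • A i) :=
  IsSelfAdjoint.smul (Complex.conj_ofReal t) (hA i)

/-- Rank one symmetry of a compact set sandwiched between the numerical ranges of `A` and `B`
implies complete positivity of `I ↦ I`, `B_i ↦ A_i / C`. -/
lemma unitalMapIsCP_of_isRankOneSymmetric {L : Set (Fin d → ℝ)} (hL : IsCompact L)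
    (hLne : L.Nonempty) {c : ℝ} (hc : 0 < c) (hsym : IsRankOneSymmetric L c)
    {A : Fin d → H →L[ℂ] H} {B : Fin d → K →L[ℂ] K}
    (hA : ∀ i, IsSelfAdjoint (A i)) (hB : ∀ i, IsSelfAdjoint (B i))
    (hAL : ∀ c : Option (Fin d) → ℝ, (∀ x ∈ L, 0 ≤ ∑ κ, c κ * homog x κ) →
      c ∈ scalarCone (homog A))
    (hBL : ∀ c ∈ scalarCone (homog B), ∀ x ∈ L, 0 ≤ ∑ κ, c κ * homog x κ) :
    UnitalMapIsCP B fun i => ((1 / c : ℝ) : ℂ) • A i := by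
  rw [unitalMapIsCP_iff hB (isSelfAdjoint_real_smul hA _)]
  intro n D hD
  refine ⟨hD.1, fun ξ => ?_⟩
  have hDL : ∀ x ∈ L, (evalPencil D x).PosSemidef := fun x hx =>
    evalPencil_posSemidef hB (fun c hc => hBL c hc x hx) hD
  obtain ⟨k, l, hl, hconv, hlL⟩ := hsym
  rw [mem_convexHull_iff_exists_fintype] at hconv
  obtain ⟨τ, _, w, z, hw, hw1, hz, hzw⟩ := hconv
  choose m hm using hz
  have h : ∀ t, 0 ≤ tensorForm ξ (D none) 1 +
      ∑ i, tensorForm ξ (D (some i)) (((1 / c : ℝ) : ℂ) • ∑ j, (z t i j : ℂ) • A j) := fun t => by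
    rw [← hm t]
    exact tensorForm_rankOne_nonneg hL hLne hc (hl _) (hlL _) hA hAL hDL ξ
  -- The inequality is affine in the matrix `λ`, so averaging replaces `λ` by the identity.
  have h2 : 0 ≤ ∑ t, (w t : ℂ) * (tensorForm ξ (D none) 1 +
      ∑ i, tensorForm ξ (D (some i)) (((1 / c : ℝ) : ℂ) • ∑ j, (z t i j : ℂ) • A j)) :=
    Finset.sum_nonneg fun t _ => mul_nonneg (by exact_mod_cast hw t) (h t)
  refine h2.trans_eq ?_
  rw [pairing_opGram, Fintype.sum_option]
  simp only [mul_add, Finset.sum_add_distrib, ← Finset.sum_mul, homog_none, homog_some]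
  congr 1
  · have : ∑ t, (w t : ℂ) = 1 := by exact_mod_cast hw1
    rw [this, one_mul]
  · simp only [Finset.mul_sum]
    rw [Finset.sum_comm]
    refine Finset.sum_congr rfl fun i _ => ?_
    have e : A i = ∑ t, (w t : ℂ) • ∑ j, (z t i j : ℂ) • A j := by
      have h3 : ∀ j, ∑ t, (w t : ℂ) * (z t i j : ℂ) = if i = j then 1 else 0 := fun j => by
        have := congrFun (congrFun hzw i) j
        simp only [Matrix.sum_apply, Matrix.smul_apply, smul_eq_mul, Matrix.one_apply] at this
        have h4 := congrArg (fun r : ℝ => (r : ℂ)) this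
        simpa [apply_ite] using h4
      simp only [Finset.smul_sum, smul_smul]
      rw [Finset.sum_comm]
      simp only [← Finset.sum_smul, h3]
      simp
    conv_rhs => rw [e]
    simp only [map_smul, map_sum, smul_eq_mul, Finset.mul_sum]
    exact Finset.sum_congr rfl fun _ _ => Finset.sum_congr rfl fun _ _ => by ring

end RankOne

/-! ### Rank one sums over a set and the smallest matrix convex set containing it. -/

section Separation

variable {n d : ℕ}

/-- The tuple `(1, x_1, …, x_d) ⊗ ζ* ζ`. -/
def rankOneTuple (x : Fin d → ℝ) (ζ : Fin n → ℂ) : Option (Fin d) → Fin n → Fin n → ℂ :=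
  fun κ i j => (homog x κ : ℝ) * (star (ζ i) * ζ j)

/-- The finite sums of tuples `(1, x) ⊗ ζ* ζ` with `x ∈ L`. -/
def rankOneSums (L : Set (Fin d → ℝ)) (n : ℕ) : Set (Option (Fin d) → Fin n → Fin n → ℂ) :=
  {Y | ∃ (τ : Type) (_ : Fintype τ) (x : τ → Fin d → ℝ) (ζ : τ → Fin n → ℂ),
    (∀ k, x k ∈ L) ∧ Y = ∑ k, rankOneTuple (x k) (ζ k)}

/-- The normalized tuples `(1, x) ⊗ ζ* ζ` with `x ∈ L`. -/
def rankOneStates (L : Set (Fin d → ℝ)) (n : ℕ) : Set (Option (Fin d) → Fin n → Fin n → ℂ) :=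
  {Y | ∃ x ∈ L, ∃ ζ : Fin n → ℂ, ∑ i, ‖ζ i‖ ^ 2 = 1 ∧ Y = rankOneTuple x ζ}

lemma rankOneTuple_smul (x : Fin d → ℝ) (ζ : Fin n → ℂ) (r : ℝ) :
    rankOneTuple x ((r : ℂ) • ζ) = r ^ 2 • rankOneTuple x ζ := by
  funext κ i j
  simp only [rankOneTuple, Pi.smul_apply, smul_eq_mul, star_mul', Complex.real_smul, RCLike.star_def,
    Complex.conj_ofReal]
  push_cast
  ring

lemma rankOneTuple_mem_rankOneSums {L : Set (Fin d → ℝ)} {x : Fin d → ℝ} (hx : x ∈ L)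
    (ζ : Fin n → ℂ) : rankOneTuple x ζ ∈ rankOneSums L n :=
  ⟨Unit, inferInstance, fun _ => x, fun _ => ζ, fun _ => hx, by simp⟩

lemma zero_mem_rankOneSums (L : Set (Fin d → ℝ)) : (0 : Option (Fin d) → Fin n → Fin n → ℂ) ∈
    rankOneSums L n :=
  ⟨Empty, inferInstance, fun e => e.elim, fun e => e.elim, fun e => e.elim, by simp⟩

lemma add_mem_rankOneSums {L : Set (Fin d → ℝ)} {Y Z : Option (Fin d) → Fin n → Fin n → ℂ}
    (hY : Y ∈ rankOneSums L n) (hZ : Z ∈ rankOneSums L n) : Y + Z ∈ rankOneSums L n := by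
  obtain ⟨τ, _, x, ζ, hx, rfl⟩ := hY
  obtain ⟨τ', _, x', ζ', hx', rfl⟩ := hZ
  refine ⟨τ ⊕ τ', inferInstance, Sum.elim x x', Sum.elim ζ ζ', ?_, ?_⟩
  · rintro (k | k)
    · exact hx k
    · exact hx' k
  · simp

lemma sum_mem_rankOneSums {L : Set (Fin d → ℝ)} {σ : Type*} (s : Finset σ)
    {Y : σ → Option (Fin d) → Fin n → Fin n → ℂ} (hY : ∀ k ∈ s, Y k ∈ rankOneSums L n) :
    ∑ k ∈ s, Y k ∈ rankOneSums L n := by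
  classical
  induction s using Finset.induction_on with
  | empty => exact zero_mem_rankOneSums L
  | insert a s ha ih =>
    rw [Finset.sum_insert ha]
    exact add_mem_rankOneSums (hY a (Finset.mem_insert_self a s))
      (ih fun k hk => hY k (Finset.mem_insert_of_mem hk))

lemma smul_mem_rankOneSums {L : Set (Fin d → ℝ)} {Y : Option (Fin d) → Fin n → Fin n → ℂ}
    (hY : Y ∈ rankOneSums L n) {r : ℝ} (hr : 0 ≤ r) : r • Y ∈ rankOneSums L n := by
  obtain ⟨τ, _, x, ζ, hx, rfl⟩ := hY
  refine ⟨τ, inferInstance, x, fun k => ((√r : ℝ) : ℂ) • ζ k, hx, ?_⟩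
  simp only [rankOneTuple_smul, Real.sq_sqrt hr, Finset.smul_sum]

lemma convexHull_rankOneStates_subset (L : Set (Fin d → ℝ)) :
    convexHull ℝ (rankOneStates L n) ⊆ rankOneSums L n := by
  refine convexHull_min ?_ ?_
  · rintro _ ⟨x, hx, ζ, -, rfl⟩
    exact rankOneTuple_mem_rankOneSums hx ζ
  · intro Y hY Z hZ a b ha hb _
    exact add_mem_rankOneSums (smul_mem_rankOneSums hY ha) (smul_mem_rankOneSums hZ hb)

lemma isCompact_rankOneStates {L : Set (Fin d → ℝ)} (hL : IsCompact L) :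
    IsCompact (rankOneStates L n) := by
  have hS : IsCompact {ζ : Fin n → ℂ | ∑ i, ‖ζ i‖ ^ 2 = 1} := by
    refine Metric.isCompact_of_isClosed_isBounded ?_ ?_
    · exact isClosed_eq (continuous_finsetSum _ fun i _ => (continuous_apply i).norm.pow 2)
        continuous_const
    · refine (Metric.isBounded_closedBall (x := (0 : Fin n → ℂ)) (r := 1)).subset fun ζ hζ => ?_
      rw [mem_closedBall_zero_iff, pi_norm_le_iff_of_nonneg zero_le_one]
      intro i
      have h1 : ‖ζ i‖ ^ 2 ≤ 1 := (Finset.single_le_sum (f := fun i => ‖ζ i‖ ^ 2)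
        (fun _ _ => sq_nonneg _) (Finset.mem_univ i)).trans_eq hζ
      nlinarith [norm_nonneg (ζ i)]
  have hc : Continuous fun p : (Fin d → ℝ) × (Fin n → ℂ) => rankOneTuple p.1 p.2 := by
    refine continuous_pi fun κ => continuous_pi fun i => continuous_pi fun j => ?_
    have h1 : Continuous fun p : (Fin d → ℝ) × (Fin n → ℂ) => homog p.1 κ :=
      (continuous_homog κ).comp continuous_fst
    unfold rankOneTuple
    fun_prop
  convert (hL.prod hS).image hc using 1
  ext Y
  simp only [rankOneStates, Set.mem_ofPred_eq, Set.mem_image, Set.mem_prod, Prod.exists]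
  constructor
  · rintro ⟨x, hx, ζ, hζ, rfl⟩
    exact ⟨x, ζ, ⟨hx, hζ⟩, rfl⟩
  · rintro ⟨x, ζ, ⟨hx, hζ⟩, rfl⟩
    exact ⟨x, hx, ζ, hζ, rfl⟩

lemma sum_rankOneTuple_none (x : Fin d → ℝ) (ζ : Fin n → ℂ) :
    ∑ i, rankOneTuple x ζ none i i = ((∑ i, ‖ζ i‖ ^ 2 : ℝ) : ℂ) := by
  push_cast
  refine Finset.sum_congr rfl fun i _ => ?_
  simp only [rankOneTuple, homog_none, Complex.ofReal_one, one_mul, RCLike.star_def]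
  exact Complex.conj_mul' _

/-- A normalized tuple on which all pencils positive on `L` are nonnegative is a limit of convex
combinations of rank one states. -/
lemma mem_closure_convexHull_rankOneStates {L : Set (Fin d → ℝ)}
    {p : Option (Fin d) → Matrix (Fin n) (Fin n) ℂ} (hp : (p none).trace = 1)
    (hC : ∀ C : Option (Fin d) → Matrix (Fin n) (Fin n) ℂ,
      (∀ x ∈ L, ∀ ζ, 0 ≤ (pairing C fun κ => Matrix.of (rankOneTuple x ζ κ)).re) →
        0 ≤ (pairing C p).re) :
    (fun κ i j => p κ i j) ∈ closure (convexHull ℝ (rankOneStates L n)) := by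
  classical
  by_contra hmem
  obtain ⟨f, u, hf, hu⟩ := geometric_hahn_banach_closed_point
    (convex_convexHull ℝ (rankOneStates L n)).closure isClosed_closure hmem
  let g : (Option (Fin d) → Fin n → Fin n → ℂ) →ₗ[ℂ] ℂ :=
    Module.Dual.extendRCLike (𝕜 := ℂ) f.toLinearMap
  have hg : ∀ Y, (g Y).re = f Y := fun Y =>
    Module.Dual.re_extendRCLike_apply (𝕜 := ℂ) f.toLinearMap Y
  -- On tuples whose unit component has trace one, the affine functional `u - g` is the homogeneous
  -- `u · tr Y_0 - g Y`; these are its coefficients in the pairing.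
  set C : Option (Fin d) → Matrix (Fin n) (Fin n) ℂ := fun κ => Matrix.of fun i j =>
    (if κ = none then if i = j then (u : ℂ) else 0 else 0) -
      g (Pi.single κ (Pi.single i (Pi.single j 1))) with hCdef
  have hpair : ∀ Y : Option (Fin d) → Fin n → Fin n → ℂ,
      pairing C (fun κ => Matrix.of (Y κ)) = u * ∑ i, Y none i i - g Y := by
    intro Y
    have h1 : g Y = ∑ κ, ∑ i, ∑ j, g (Pi.single κ (Pi.single i (Pi.single j 1))) * Y κ i j := by
      have h2 : Y = ∑ κ, ∑ i, ∑ j, Y κ i j • Pi.single κ (Pi.single i (Pi.single j 1)) := by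
        funext κ i j
        simp only [Finset.sum_apply, Pi.smul_apply]
        rw [Finset.sum_eq_single κ, Finset.sum_eq_single i, Finset.sum_eq_single j]
        · simp
        · intro j' _ h; simp [h.symm]
        · simp
        · intro i' _ h; simp [h.symm]
        · simp
        · intro κ' _ h; simp [h.symm]
        · simp
      conv_lhs => rw [h2]
      simp only [map_sum, map_smul, smul_eq_mul]
      exact Finset.sum_congr rfl fun _ _ => Finset.sum_congr rfl fun _ _ =>
        Finset.sum_congr rfl fun _ _ => mul_comm _ _
    rw [h1]
    simp only [pairing, hCdef, Matrix.of_apply, sub_mul, Finset.sum_sub_distrib]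
    congr 1
    rw [Fintype.sum_option]
    simp [ite_mul, Finset.mul_sum]
  have hunit : ∀ x ∈ L, ∀ ζ : Fin n → ℂ, ∑ i, ‖ζ i‖ ^ 2 = 1 →
      0 ≤ (pairing C fun κ => Matrix.of (rankOneTuple x ζ κ)).re := by
    intro x hx ζ hζ
    rw [hpair, sum_rankOneTuple_none, hζ, Complex.sub_re, hg]
    have := hf _ (subset_closure (subset_convexHull ℝ _ ⟨x, hx, ζ, hζ, rfl⟩))
    simp
    exact this.le
  -- Homogeneity passes from unit vectors `ζ` to all `ζ`, with `ζ = 0` treated apart.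
  have h := hC C fun x hx ζ => by
    set s : ℝ := ∑ i, ‖ζ i‖ ^ 2 with hs
    have hs0 : 0 ≤ s := Finset.sum_nonneg fun _ _ => sq_nonneg _
    rcases hs0.eq_or_lt with h0 | hpos
    · have hζ : ζ = 0 := by
        funext i
        have := (Finset.sum_eq_zero_iff_of_nonneg fun _ _ => sq_nonneg _).1 h0.symm i
          (Finset.mem_univ i)
        simpa using this
      rw [hpair, sum_rankOneTuple_none, ← hs, ← h0, hζ]
      have : rankOneTuple x (0 : Fin n → ℂ) = 0 := by
        funext κ i j; simp [rankOneTuple]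
      simp [this]
    · have h1 := hunit x hx (((√s)⁻¹ : ℝ) • ζ) (by
        simp only [Pi.smul_apply, norm_smul, mul_pow, ← Finset.mul_sum, ← hs]
        rw [norm_inv, Real.norm_of_nonneg (Real.sqrt_nonneg _), inv_pow, Real.sq_sqrt hs0]
        exact inv_mul_cancel₀ hpos.ne')
      have h2 : rankOneTuple x (((√s)⁻¹ : ℝ) • ζ) = s⁻¹ • rankOneTuple x ζ := by
        rw [← Complex.coe_smul, rankOneTuple_smul, inv_pow, Real.sq_sqrt hs0]
      have h3 : (fun κ => Matrix.of (rankOneTuple x (((√s)⁻¹ : ℝ) • ζ) κ)) =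
          ((s⁻¹ : ℝ) : ℂ) • fun κ => Matrix.of (rankOneTuple x ζ κ) := by
        rw [h2]; funext κ; ext i j; simp
      rw [h3, pairing_smul_right, Complex.re_ofReal_mul] at h1
      exact nonneg_of_mul_nonneg_right h1 (inv_pos.2 hpos)
  have h2 := hpair fun κ i j => p κ i j
  have h3 : (fun κ => Matrix.of fun i j => p κ i j) = p := rfl
  have h4 : ∑ i, p none i i = 1 := hp
  rw [h3, h4] at h2
  rw [h2, Complex.sub_re, hg] at h
  simp at h
  linarith

/-- Convex hulls of compact sets in finite dimensional spaces are compact. -/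
lemma IsCompact.convexHull_of_finiteDimensional {E : Type*} [NormedAddCommGroup E]
    [NormedSpace ℝ E] [FiniteDimensional ℝ E] {s : Set E} (hs : IsCompact s) :
    IsCompact (convexHull ℝ s) := by
  have e : convexHull ℝ s = ⋃ m ∈ Finset.range (Module.finrank ℝ E + 2),
      (fun p : (Fin m → ℝ) × (Fin m → E) => ∑ i, p.1 i • p.2 i) ''
        (stdSimplex ℝ (Fin m) ×ˢ Set.univ.pi fun _ => s) := by
    ext x
    simp only [Set.mem_iUnion, Set.mem_image, Set.mem_prod, Prod.exists, Set.mem_univ_pi]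
    constructor
    · intro hx
      -- Carathéodory: at most `dim + 1` points suffice, so the hull is a finite union of continuous
      -- images of compact sets.
      obtain ⟨ι, _, z, w, hz, hind, hw, hw1, rfl⟩ := eq_pos_convex_span_of_mem_convexHull hx
      let e := (Fintype.equivFin ι).symm
      refine ⟨Fintype.card ι, Finset.mem_range.2 ?_, w ∘ e, z ∘ e, ⟨⟨fun i => (hw _).le, ?_⟩,
        fun i => hz ⟨_, rfl⟩⟩, ?_⟩
      · have h1 := hind.card_le_finrank_succ
        have h2 := Submodule.finrank_le (vectorSpan ℝ (Set.range z))
        omega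
      · rw [← hw1]; exact Equiv.sum_comp e w
      · exact Equiv.sum_comp e fun i => w i • z i
    · rintro ⟨m, -, w, z, ⟨hw, hz⟩, rfl⟩
      exact (convex_convexHull ℝ s).sum_mem (fun i _ => hw.1 i) hw.2
        fun i _ => subset_convexHull ℝ s (hz i)
  rw [e]
  refine Finset.isCompact_biUnion _ fun m _ => IsCompact.image ?_ (by fun_prop)
  exact (isCompact_stdSimplex ℝ (Fin m)).prod (isCompact_univ_pi fun _ => hs)

/-- The version for compact sets, without closure. -/
lemma homog_mem_rankOneSums_of_isCompact {L : Set (Fin d → ℝ)} (hL : IsCompact L) (hn : 1 ≤ n)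
    {X : Fin d → Matrix (Fin n) (Fin n) ℂ}
    (hC : ∀ C : Option (Fin d) → Matrix (Fin n) (Fin n) ℂ,
      (∀ x ∈ L, ∀ ζ, 0 ≤ (pairing C fun κ => Matrix.of (rankOneTuple x ζ κ)).re) →
        0 ≤ (pairing C (homog X)).re) :
    (fun κ i j => homog X κ i j) ∈ rankOneSums L n := by
  have hn0 : (n : ℂ) ≠ 0 := by exact_mod_cast (by omega : n ≠ 0)
  -- Dividing by `n` gives the unit component trace one; the factor is restored by scaling the cone.
  have h := mem_closure_convexHull_rankOneStates (L := L) (p := ((n : ℝ)⁻¹ : ℝ) • homog X)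
    (by simp [Matrix.trace_smul, hn0]) (fun C h => by
      have : ((n : ℝ)⁻¹ : ℝ) • homog X = (((n : ℝ)⁻¹ : ℝ) : ℂ) • homog X :=
        (Complex.coe_smul _ _).symm
      rw [this, pairing_smul_right, Complex.re_ofReal_mul]
      exact mul_nonneg (by positivity) (hC C h))
  rw [(isCompact_rankOneStates hL).convexHull_of_finiteDimensional.isClosed.closure_eq] at h
  have h2 := smul_mem_rankOneSums (convexHull_rankOneStates_subset L h) (Nat.cast_nonneg (α := ℝ) n)
  convert h2 using 1
  funext κ i j
  have hn1 : (n : ℝ) ≠ 0 := by exact_mod_cast (by omega : n ≠ 0)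
  simp only [Pi.smul_apply, Matrix.smul_apply, smul_smul, mul_inv_cancel₀ hn1, one_smul]

lemma matDirectSum_diagonal {m n : ℕ} (a : Fin m → ℂ) (b : Fin n → ℂ) :
    matDirectSum (Matrix.diagonal a) (Matrix.diagonal b) = Matrix.diagonal (Fin.append a b) := by
  have hne : ∀ (a : Fin m) (b : Fin n), Fin.castAdd n a ≠ Fin.natAdd m b := by
    intro a b h
    have := congrArg Fin.val h
    simp at this
    omega
  ext i j
  induction i using Fin.addCases <;> induction j using Fin.addCases <;>
    simp [matDirectSum, Matrix.diagonal_apply, hne, (hne _ _).symm]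

lemma diagonal_mem_of_isMatrixConvex {T : FreeSet d} (hT : IsMatrixConvex T) {N : ℕ} (hN : 1 ≤ N)
    (x : Fin N → Fin d → ℝ) (hx : ∀ k, scalarTuple (x k) ∈ T 1) :
    (fun j => Matrix.diagonal fun k => (x k j : ℂ)) ∈ T N := by
  have hd : ∀ y : Fin d → ℝ, scalarTuple y = fun j => Matrix.diagonal fun _ => (y j : ℂ) := by
    intro y
    funext j
    rw [scalarTuple, Matrix.smul_one_eq_diagonal]
  induction N, hN using Nat.le_induction with
  | base =>
    have h := hx 0
    rw [hd] at h
    convert h using 4 with j k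
    rw [Subsingleton.elim k 0]
  | succ N hN ih =>
    have h1 := ih (fun k => x (Fin.castAdd 1 k)) fun k => hx _
    have h2 := hx (Fin.last N)
    rw [hd] at h2
    have h3 := hT.directSum_mem _ _ _ h1 _ h2
    convert h3 using 2 with j
    rw [matDirectSum_diagonal]
    congr 1
    funext k
    induction k using Fin.addCases with
    | left k => simp
    | right k => rw [Fin.append_right, Subsingleton.elim k 0]; rfl

/-- Tuples dominated by rank one sums over `L` belong to every matrix convex set containing `L`. -/
lemma mem_of_homog_mem_rankOneSums {T : FreeSet d} (hT : IsMatrixConvex T) (hn : 1 ≤ n)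
    {L : Set (Fin d → ℝ)} (hL : ∀ x ∈ L, scalarTuple x ∈ T 1) {X : Fin d → Matrix (Fin n) (Fin n) ℂ}
    (hX : (fun κ i j => homog X κ i j) ∈ rankOneSums L n) : X ∈ T n := by
  obtain ⟨τ, _, x, ζ, hx, hsum⟩ := hX
  let e := (Fintype.equivFin τ).symm
  have hsum' : ∀ κ i j, homog X κ i j =
      ∑ k, (homog (x (e k)) κ : ℝ) * (star (ζ (e k) i) * ζ (e k) j) := fun κ i j => by
    have h := congrFun (congrFun (congrFun hsum κ) i) j
    rw [h, Finset.sum_apply, Finset.sum_apply, Finset.sum_apply]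
    exact (Equiv.sum_comp e fun k => rankOneTuple (x k) (ζ k) κ i j).symm
  -- An empty sum is impossible, since the unit component is the identity of positive size.
  have hN : 1 ≤ Fintype.card τ := by
    by_contra h0
    have h1 := hsum' none ⟨0, hn⟩ ⟨0, hn⟩
    have h2 : IsEmpty (Fin (Fintype.card τ)) := by
      rw [show Fintype.card τ = 0 by omega]; infer_instance
    simp at h1
  -- The unit component says `W*W = 1`, so compression by `W` is unital; it sends the diagonal tuple
  -- of the points `x k` to `X`.
  set W : Matrix (Fin (Fintype.card τ)) (Fin n) ℂ := Matrix.of fun k i => ζ (e k) i with hW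
  have h1 := hT.ucp_mem _ _ _ (by
    simp only [LinearMap.coe_mk, AddHom.coe_mk, Matrix.mul_one]
    ext i j
    have h2 := hsum' none i j
    simp only [homog_none, Complex.ofReal_one, one_mul] at h2
    rw [h2, Matrix.mul_apply]
    rfl) (isCP_conj W) _ (diagonal_mem_of_isMatrixConvex hT hN (fun k => x (e k))
      fun k => hL _ (hx _))
  convert h1 using 1
  funext j
  ext i i'
  have h2 := hsum' (some j) i i'
  simp only [homog_some] at h2
  rw [h2]
  simp only [LinearMap.coe_mk, AddHom.coe_mk, Matrix.mul_apply (M := _ * _), Matrix.mul_diagonal,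
    Matrix.conjTranspose_apply, hW, Matrix.of_apply]
  exact Finset.sum_congr rfl fun _ _ => by ring

end Separation

/-! ### Diagonal operators on `ℓ²` of a bounded set. -/

section DiagonalTuple

variable {n d : ℕ}

lemma memℓp_two_mul {τ : Type*} {f : τ → ℝ} {M : ℝ} (hf : ∀ k, |f k| ≤ M)
    (ξ : lp (fun _ : τ => ℂ) 2) : Memℓp (fun k => (f k : ℂ) * ξ k) 2 := by
  have h := (lp.memℓp ξ).summable (by norm_num)
  refine memℓp_gen ((h.mul_left (M ^ 2)).of_nonneg_of_le (fun k => by positivity) fun k => ?_)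
  simp only [ENNReal.toReal_ofNat, Real.rpow_ofNat, norm_mul, Complex.norm_real, Real.norm_eq_abs,
    mul_pow]
  gcongr
  exact hf k

/-- Multiplication by a bounded real function on `ℓ²`. -/
def diagonalLinearMap {τ : Type*} {f : τ → ℝ} {M : ℝ} (hf : ∀ k, |f k| ≤ M) :
    lp (fun _ : τ => ℂ) 2 →ₗ[ℂ] lp (fun _ : τ => ℂ) 2 where
  toFun ξ := ⟨fun k => (f k : ℂ) * ξ k, memℓp_two_mul hf ξ⟩
  map_add' ξ η := by
    ext k
    exact mul_add _ _ _
  map_smul' c ξ := by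
    ext k
    simp [mul_left_comm]

lemma diagonalLinearMap_apply {τ : Type*} {f : τ → ℝ} {M : ℝ} (hf : ∀ k, |f k| ≤ M)
    (ξ : lp (fun _ : τ => ℂ) 2) (k : τ) : diagonalLinearMap hf ξ k = (f k : ℂ) * ξ k := rfl

lemma diagonalLinearMap_isSymmetric {τ : Type*} {f : τ → ℝ} {M : ℝ} (hf : ∀ k, |f k| ≤ M) :
    (diagonalLinearMap hf).IsSymmetric := by
  intro ξ η
  rw [lp.inner_eq_tsum, lp.inner_eq_tsum]
  refine tsum_congr fun k => ?_
  simp only [diagonalLinearMap_apply, RCLike.inner_apply, map_mul, Complex.conj_ofReal]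
  ring

/-- A tuple of commuting diagonal operators with joint spectrum the closure of a bounded set. -/
lemma exists_diagonal_tuple {L : Set (Fin d → ℝ)} (hL : Bornology.IsBounded L) :
    ∃ (K : Type*) (_ : NormedAddCommGroup K) (_ : InnerProductSpace ℂ K) (_ : CompleteSpace K)
      (B : Fin d → K →L[ℂ] K), (∀ i, IsSelfAdjoint (B i)) ∧
      (∀ c ∈ scalarCone (homog B), ∀ x ∈ L, 0 ≤ ∑ κ, c κ * homog x κ) ∧
      ∀ (n : ℕ) (C : Option (Fin d) → Matrix (Fin n) (Fin n) ℂ), (∀ κ, (C κ).IsHermitian) →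
        (∀ x ∈ L, ∀ ζ, 0 ≤ (pairing C fun κ => Matrix.of (rankOneTuple x ζ κ)).re) →
        C ∈ pencilCone (homog B) n := by
  classical
  obtain ⟨M, hM⟩ := hL.exists_norm_le
  -- The index set is lifted so that the Hilbert space can live in an arbitrary universe.
  have hf : ∀ (j : Fin d) (k : ULift L), |k.down.1 j| ≤ M := fun j k =>
    (norm_le_pi_norm k.down.1 j).trans (hM _ k.down.2)
  -- Continuity is Hellinger–Toeplitz: a symmetric operator defined everywhere is bounded.
  let B : Fin d → lp (fun _ : ULift L => ℂ) 2 →L[ℂ] lp (fun _ : ULift L => ℂ) 2 := fun j =>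
    ⟨diagonalLinearMap (hf j), (diagonalLinearMap_isSymmetric (hf j)).continuous⟩
  have hB : ∀ j, IsSelfAdjoint (B j) := fun j =>
    ContinuousLinearMap.isSelfAdjoint_iff_isSymmetric.2 (diagonalLinearMap_isSymmetric (hf j))
  have hBκ : ∀ κ (ξ : lp (fun _ : ULift L => ℂ) 2) (k : ULift L),
      homog B κ ξ k = ((homog k.down.1 κ : ℝ) : ℂ) * ξ k := by
    intro κ ξ k
    cases κ with
    | none => simp
    | some j => rfl
  refine ⟨lp (fun _ : ULift L => ℂ) 2, inferInstance, inferInstance, inferInstance, B, hB, ?_, ?_⟩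
  · intro c hc x hx
    -- The basis vector at `x` is a joint eigenvector with eigenvalues `x`.
    have h := hc (lp.single 2 (⟨x, hx⟩ : ULift L) (1 : ℂ))
    convert h using 2 with κ
    congr 1
    rw [lp.inner_single_left]
    simp [hBκ]
  · intro n C hCh hC
    refine ⟨hCh, fun ξ => ?_⟩
    -- The form of the pencil is the sum over the points `k` of its values at `(1, k) ⊗ ζ*ζ`, with
    -- `ζ` the `k`-th coordinates of `ξ`.
    have hs : HasSum (fun k : ULift L => pairing C fun κ =>
        Matrix.of (rankOneTuple k.down.1 (fun i => ξ i k) κ)) (pairing C (opGram (homog B) ξ)) := by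
      refine hasSum_sum fun κ _ => hasSum_sum fun i _ => hasSum_sum fun j _ => ?_
      refine HasSum.mul_left _ ?_
      have := lp.hasSum_inner (𝕜 := ℂ) (ξ i) (homog B κ (ξ j))
      have e : ∀ k : ULift L, Matrix.of (rankOneTuple k.down.1 (fun i => ξ i k) κ) i j =
          ⟪ξ i k, homog B κ (ξ j) k⟫_ℂ := fun k => by
        rw [hBκ]
        simp only [Matrix.of_apply, rankOneTuple, RCLike.inner_apply, RCLike.star_def]
        ring
      simp only [e]
      exact this
    refine hs.nonneg fun k => pairing_nonneg_of_re hCh (fun κ => ?_) (hC _ k.down.2 _)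
    ext i j
    simp [rankOneTuple, mul_comm]

end DiagonalTuple

/-! ### The scale `ρ` and maps into `S_A`. -/

section RangeScale

variable {n d : ℕ}
variable {H : Type*} [NormedAddCommGroup H] [InnerProductSpace ℂ H]

lemma homog_smul_opGram {A : Fin d → H →L[ℂ] H} {v : Fin n → H} (hv : Orthonormal ℂ v) (s : ℂ) :
    homog (fun j => s • opGram A v j) = opGram (homog fun j => s • A j) v := by
  rw [← homog_opGram hv]
  congr 1
  funext j
  ext i i'
  simp

/-- The supremum defining a scale is not known to be attained. An affine function that is
nonnegative at `0` and at points beyond every `s < t` is nonnegative at `t`. -/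
lemma affine_nonneg_of_cofinal {a b t : ℝ} (ht : 0 ≤ t) (ha : 0 ≤ a)
    (h : ∀ s, 0 ≤ s → s < t → ∃ s' > s, 0 ≤ a + s' * b) : 0 ≤ a + t * b := by
  by_contra hneg
  push Not at hneg
  have hb : b < 0 := by
    by_contra hb
    push Not at hb
    nlinarith [mul_nonneg ht hb]
  obtain ⟨s', hs', h1⟩ := h (a / -b) (div_nonneg ha (by linarith)) (by
    rw [div_lt_iff₀ (by linarith)]
    linarith)
  rw [gt_iff_lt, div_lt_iff₀ (by linarith)] at hs'
  linarith

lemma pairing_opGram_homog_smul (C : Option (Fin d) → Matrix (Fin n) (Fin n) ℂ)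
    (A : Fin d → H →L[ℂ] H) (s : ℂ) (ξ : Fin n → H) :
    pairing C (opGram (homog fun j => s • A j) ξ) =
      tensorForm ξ (C none) 1 + s * ∑ j, tensorForm ξ (C (some j)) (A j) := by
  rw [pairing_opGram, Fintype.sum_option, Finset.mul_sum]
  simp

lemma exists_gt_mem_inclusionScaleSet {S : FreeSet d} {t : ℝ≥0}
    (ht : (t : ℝ≥0∞) ≤ inclusionScale S) (hn : 1 ≤ n) {s : ℝ} (hs : 0 ≤ s) (hst : s < t) :
    ∃ s' ∈ inclusionScaleSet S n, s < (s' : ℝ) := by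
  lift s to ℝ≥0 using hs
  have h1 : (s : ℝ≥0∞) < inclusionScaleAt S n :=
    lt_of_lt_of_le (by exact_mod_cast hst) (ht.trans (iInf₂_le n hn))
  rw [inclusionScaleAt, lt_iSup_iff] at h1
  obtain ⟨s', h1⟩ := h1
  rw [lt_iSup_iff] at h1
  obtain ⟨hs', h1⟩ := h1
  exact ⟨s', hs', by exact_mod_cast h1⟩

lemma le_inclusionScale {S : FreeSet d} {t : ℝ≥0}
    (h : ∀ n, 1 ≤ n → t ∈ inclusionScaleSet S n) : (t : ℝ≥0∞) ≤ inclusionScale S :=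
  le_iInf₂ fun n hn => le_iSup₂_of_le t (h n hn) le_rfl

lemma evalPencil_zero (C : Option (Fin d) → Matrix (Fin n) (Fin n) ℂ) :
    evalPencil C 0 = C none := by
  simp [evalPencil]

variable [CompleteSpace H]

lemma exists_scalarTuple_of_mem_matrixRange {A : Fin d → H →L[ℂ] H} (hA : ∀ i, IsSelfAdjoint (A i))
    {X : Fin d → Matrix (Fin 1) (Fin 1) ℂ} (hX : X ∈ matrixRange A 1) :
    ∃ x ∈ levelOne (matrixRange A), X = scalarTuple x := by
  have h := eq_scalarTuple_of_isHermitian ((mem_matrixRange_iff hA).1 hX).1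
  refine ⟨_, ?_, h⟩
  rw [mem_levelOne, ← h]
  exact hX

/-- A pencil positive on `W_1(A)` is positive at `B`, hence at `tA`, hence nonnegative on `tX`.
Compactness of `W_1(A)` then makes `(1, tX)` an exact rank one sum. -/
lemma mem_inclusionScaleSet_matrixRange {A : Fin d → H →L[ℂ] H} (hA : ∀ i, IsSelfAdjoint (A i))
    {t : ℝ≥0} {K : Type*} [NormedAddCommGroup K] [InnerProductSpace ℂ K] [CompleteSpace K]
    {B : Fin d → K →L[ℂ] K}
    (hB : ∀ (n : ℕ) (C : Option (Fin d) → Matrix (Fin n) (Fin n) ℂ), (∀ κ, (C κ).IsHermitian) →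
        (∀ x ∈ levelOne (matrixRange A), ∀ ζ,
          0 ≤ (pairing C fun κ => Matrix.of (rankOneTuple x ζ κ)).re) →
        C ∈ pencilCone (homog B) n)
    (hcp : ∀ n, pencilCone (homog B) n ⊆ pencilCone (homog fun i => ((t : ℝ) : ℂ) • A i) n)
    (hn : 1 ≤ n) : t ∈ inclusionScaleSet (matrixRange A) n := by
  intro T hT hST X hX
  have htA := isSelfAdjoint_real_smul hA (t : ℝ)
  obtain ⟨hXh, hXpos⟩ := (mem_matrixRange_iff hA).1 hX
  have htX : ∀ j, (((t : ℝ) : ℂ) • X j).IsHermitian := fun j => by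
    rw [Matrix.IsHermitian, Matrix.conjTranspose_smul, (hXh j).eq, RCLike.star_def,
      Complex.conj_ofReal]
  refine mem_of_homog_mem_rankOneSums hT hn (L := levelOne (matrixRange A)) (fun x hx => hST hx)
    (homog_mem_rankOneSums_of_isCompact (isCompact_levelOne_matrixRange hA) hn fun C hC => ?_)
  have h1 := hcp n (hB n (hermPart C) (hermPart_isHermitian C) fun x hx ζ => by
    rw [pairing_hermPart]
    · simpa using hC x hx ζ
    · intro κ
      ext i j
      simp [rankOneTuple, mul_comm])
  -- The factor `t` is moved from the operators to the coefficients, so that `X` itself can be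
  -- tested.
  let D : Option (Fin d) → Matrix (Fin n) (Fin n) ℂ := fun κ =>
    κ.elim (hermPart C none) fun j => ((t : ℝ) : ℂ) • hermPart C (some j)
  have hD : D ∈ pencilCone (homog A) n := by
    refine ⟨fun κ => ?_, fun ξ => ?_⟩
    · cases κ with
      | none => exact hermPart_isHermitian C _
      | some j =>
        simp only [D, Option.elim, Matrix.IsHermitian]
        rw [Matrix.conjTranspose_smul, (hermPart_isHermitian C _).eq, RCLike.star_def,
          Complex.conj_ofReal]
    · refine (h1.2 ξ).trans_eq ?_
      rw [pairing_opGram_homog_smul, pairing_opGram, Fintype.sum_option, Finset.mul_sum]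
      simp [D]
  have h2 := hXpos D hD
  have h3 : pairing D (homog X) = pairing (hermPart C) (homog fun j => ((t : ℝ) : ℂ) • X j) := by
    simp only [pairing, Fintype.sum_option, D, Option.elim, homog_none, homog_some,
      Matrix.smul_apply, smul_eq_mul]
    congr 1
    exact Finset.sum_congr rfl fun _ _ => Finset.sum_congr rfl fun _ _ =>
      Finset.sum_congr rfl fun _ _ => by ring
  rw [h3, pairing_hermPart C (isHermitian_homog htX)] at h2
  exact_mod_cast h2

/-- The scale is applied to the dual of the pencils positive at `B`, whose first level contains
`W_1(A)`, and to the compression of `A` to the span of the vectors being tested. -/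
lemma unitalMapIsCP_of_le_inclusionScale {A : Fin d → H →L[ℂ] H} (hA : ∀ i, IsSelfAdjoint (A i))
    (h0 : (0 : Fin d → ℝ) ∈ levelOne (matrixRange A)) {t : ℝ≥0}
    (ht : (t : ℝ≥0∞) ≤ inclusionScale (matrixRange A))
    {K : Type*} [NormedAddCommGroup K] [InnerProductSpace ℂ K] [CompleteSpace K]
    {B : Fin d → K →L[ℂ] K} (hB : ∀ i, IsSelfAdjoint (B i))
    (hBA : scalarCone (homog B) ⊆ scalarCone (homog A)) :
    UnitalMapIsCP B fun i => ((t : ℝ) : ℂ) • A i := by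
  have htA := isSelfAdjoint_real_smul hA (t : ℝ)
  rw [unitalMapIsCP_iff hB htA]
  intro n C hC
  refine ⟨hC.1, fun ξ => ?_⟩
  by_cases hξ : ξ = 0
  · simp [hξ, pairing]
  refine pairing_nonneg_of_re hC.1 (opGram_isHermitian (isSelfAdjoint_homog htA) ξ) ?_
  have hLB : ∀ x ∈ levelOne (matrixRange A), ∀ c ∈ scalarCone (homog B),
      0 ≤ ∑ κ, c κ * homog x κ := fun x hx c hc => (mem_scalarCone_homog_iff hA).1 (hBA hc) x hx
  rw [pairing_opGram_homog_smul, Complex.add_re, Complex.re_ofReal_mul]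
  refine affine_nonneg_of_cofinal t.2 ?_ fun s hs hst => ?_
  -- At scale `0` only the constant term remains; it is positive because `0 ∈ W_1(A)`.
  · have h1 := evalPencil_posSemidef hB (hLB 0 h0) hC
    rw [evalPencil_zero] at h1
    exact (Complex.nonneg_iff.1 (tensorForm_nonneg ξ h1 fun η => by
      rw [one_apply_eq_self, inner_self_eq_ofReal]
      exact_mod_cast sq_nonneg ‖η‖)).1
  set V : Submodule ℂ H := Submodule.span ℂ (Set.range ξ)
  have hfin : FiniteDimensional ℂ V := FiniteDimensional.span_of_finite ℂ (Set.finite_range ξ)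
  let b := stdOrthonormalBasis ℂ V
  set v : Fin (Module.finrank ℂ V) → H := fun p => (b p : H)
  have hv : Orthonormal ℂ v := b.orthonormal.comp_linearIsometry V.subtypeₗᵢ
  set R : Matrix (Fin (Module.finrank ℂ V)) (Fin n) ℂ :=
    Matrix.of fun p i => b.repr ⟨ξ i, Submodule.subset_span ⟨i, rfl⟩⟩ p with hR
  have hRv : (fun i => ∑ p, R p i • v p) = ξ := by
    funext i
    have := congrArg Subtype.val (b.sum_repr ⟨ξ i, Submodule.subset_span ⟨i, rfl⟩⟩)
    simpa [hR, v] using this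
  -- Scales are defined on levels `≥ 1` only, hence the separate case `ξ = 0`.
  have hm : 1 ≤ Module.finrank ℂ V := by
    by_contra h
    have h1 : IsEmpty (Fin (Module.finrank ℂ V)) := by
      rw [show Module.finrank ℂ V = 0 by omega]; infer_instance
    exact hξ (by rw [← hRv]; funext i; simp)
  obtain ⟨s', hs', hlt⟩ := exists_gt_mem_inclusionScaleSet ht hm hs hst
  refine ⟨s', hlt, ?_⟩
  have h1 := hs' (conePolar fun n => pencilCone (homog B) n)
    (isMatrixConvex_conePolar fun k n V C hC => compress_mem_pencilCone hC V) (fun Y hY => by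
      obtain ⟨x, hx, rfl⟩ := exists_scalarTuple_of_mem_matrixRange hA hY
      intro D hD
      have e := eq_scalar_pencil hD.1
      rw [e] at hD
      rw [e, pairing_scalar]
      exact_mod_cast hLB x hx _ ((scalar_pencil_mem_iff (isSelfAdjoint_homog hB)).1 hD))
    _ (compression_mem_matrixRange hA hv) _ (compress_mem_pencilCone hC R.transpose)
  rw [pairing_compress, Matrix.transpose_transpose, homog_smul_opGram hv, compress_opGram, hRv,
    pairing_opGram_homog_smul] at h1
  have h2 := (Complex.nonneg_iff.1 h1).1
  rwa [Complex.add_re, Complex.re_ofReal_mul] at h2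

end RangeScale

/-! ### Absorbing small errors into rank one sums. -/

section Interior

variable {n d : ℕ}

/-- Entries bounded by `η` give a quadratic form bounded by `nη‖v‖²`. -/
lemma posSemidef_smul_one_add {E : Matrix (Fin n) (Fin n) ℂ} (hE : E.IsHermitian) {c η : ℝ}
    (hη : ∀ i j, ‖E i j‖ ≤ η) (hc : n * η ≤ c) :
    ((c : ℂ) • (1 : Matrix (Fin n) (Fin n) ℂ) + E).PosSemidef := by
  have hh : ((c : ℂ) • (1 : Matrix (Fin n) (Fin n) ℂ) + E).IsHermitian := by
    refine Matrix.IsHermitian.add ?_ hE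
    simp [Matrix.IsHermitian, Matrix.conjTranspose_smul]
  refine Matrix.PosSemidef.of_dotProduct_mulVec_nonneg hh fun v => ?_
  have him : (star v ⬝ᵥ ((c : ℂ) • (1 : Matrix (Fin n) (Fin n) ℂ) + E).mulVec v).im = 0 :=
    hh.im_star_dotProduct_mulVec_self v
  refine Complex.nonneg_iff.2 ⟨?_, him.symm⟩
  have h1 : star v ⬝ᵥ ((c : ℂ) • (1 : Matrix (Fin n) (Fin n) ℂ) + E).mulVec v =
      ((c * ∑ i, ‖v i‖ ^ 2 : ℝ) : ℂ) + ∑ i, ∑ j, star (v i) * E i j * v j := by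
    rw [Matrix.add_mulVec, dotProduct_add, Matrix.smul_mulVec, dotProduct_smul, Matrix.one_mulVec]
    congr 1
    · push_cast
      rw [smul_eq_mul, dotProduct]
      congr 1
      exact Finset.sum_congr rfl fun i _ => Complex.conj_mul' _
    · simp only [dotProduct, Matrix.mulVec, Pi.star_apply, Finset.mul_sum, mul_assoc]
  have h2 : ‖∑ i, ∑ j, star (v i) * E i j * v j‖ ≤ c * ∑ i, ‖v i‖ ^ 2 := by
    have h3 : ∀ i j, ‖star (v i) * E i j * v j‖ ≤ η * ((‖v i‖ ^ 2 + ‖v j‖ ^ 2) / 2) := by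
      intro i j
      rw [norm_mul, norm_mul, norm_star]
      have h4 : ‖v i‖ * ‖v j‖ ≤ (‖v i‖ ^ 2 + ‖v j‖ ^ 2) / 2 := by
        nlinarith [sq_nonneg (‖v i‖ - ‖v j‖)]
      have h5 := mul_le_mul (hη i j) h4 (by positivity) ((norm_nonneg _).trans (hη i j))
      linarith
    calc _ ≤ ∑ i, ∑ j, η * ((‖v i‖ ^ 2 + ‖v j‖ ^ 2) / 2) :=
          (norm_sum_le _ _).trans (Finset.sum_le_sum fun i _ =>
            (norm_sum_le _ _).trans (Finset.sum_le_sum fun j _ => h3 i j))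
      _ = n * η * ∑ i, ‖v i‖ ^ 2 := by
          simp only [← Finset.mul_sum, ← Finset.sum_div, Finset.sum_add_distrib, Finset.sum_const,
            Finset.card_univ, Fintype.card_fin, nsmul_eq_mul]
          ring
      _ ≤ _ := mul_le_mul_of_nonneg_right hc (Finset.sum_nonneg fun _ _ => sq_nonneg _)
  rw [h1, Complex.add_re, Complex.ofReal_re]
  linarith [(abs_le.1 ((Complex.abs_re_le_norm _).trans h2)).1]

lemma mem_rankOneSums_of_posSemidef {L : Set (Fin d → ℝ)} {x : Fin d → ℝ} (hx : x ∈ L)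
    {P : Matrix (Fin n) (Fin n) ℂ} (hP : P.PosSemidef) :
    (fun κ i j => ((homog x κ : ℝ) : ℂ) * P i j) ∈ rankOneSums L n := by
  obtain ⟨R, rfl⟩ := hP.exists_conjTranspose_mul_self
  refine ⟨Fin n, inferInstance, fun _ => x, fun r => R r, fun _ => hx, ?_⟩
  funext κ i j
  simp only [Matrix.mul_apply, Matrix.conjTranspose_apply, Finset.sum_apply, rankOneTuple,
    Finset.mul_sum]

/-- Hermitian tuples close to a multiple of `(1, 0)` are rank one sums over any set containing a
cross polytope. -/
lemma mem_rankOneSums_of_near_one {L : Set (Fin d → ℝ)} (hd : 1 ≤ d) {δ : ℝ} (hδ : 0 < δ)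
    (hL : ∀ k, ∀ s : ℝ, |s| = δ → Pi.single k s ∈ L)
    {Y : Option (Fin d) → Matrix (Fin n) (Fin n) ℂ} (hY : ∀ κ, (Y κ).IsHermitian) {γ η : ℝ}
    (hY0 : ∀ i j, ‖(Y none - (γ : ℂ) • 1) i j‖ ≤ η) (hYk : ∀ k i j, ‖Y (some k) i j‖ ≤ η)
    (hηγ : n * (η / (2 * d) + η / (2 * δ)) ≤ γ / (2 * d)) :
    (fun κ i j => Y κ i j) ∈ rankOneSums L n := by
  have hd0 : (0 : ℝ) < d := by exact_mod_cast hd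
  -- The decomposition is `Y = ∑_k ∑_± (1, ±δe_k) ⊗ (Y_0/(2d) ± Y_k/(2δ))`; for `s = ±δ` the
  -- coefficient `s/(2δ²)` is `±1/(2δ)`.
  have hps : ∀ (k : Fin d) (s : ℝ), |s| = δ →
      (((1 / (2 * d) : ℝ) : ℂ) • Y none + ((s / (2 * δ ^ 2) : ℝ) : ℂ) • Y (some k)).PosSemidef := by
    intro k s hs
    have e : ((1 / (2 * d) : ℝ) : ℂ) • Y none + ((s / (2 * δ ^ 2) : ℝ) : ℂ) • Y (some k) =
        ((γ / (2 * d) : ℝ) : ℂ) • 1 + (((1 / (2 * d) : ℝ) : ℂ) • (Y none - (γ : ℂ) • 1) +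
          ((s / (2 * δ ^ 2) : ℝ) : ℂ) • Y (some k)) := by
      rw [smul_sub, smul_smul, ← Complex.ofReal_mul, one_div_mul_eq_div]
      abel
    have hsm : ∀ (r : ℝ) (Z : Matrix (Fin n) (Fin n) ℂ), Z.IsHermitian →
        ((r : ℂ) • Z).IsHermitian := fun r Z hZ => by
      rw [Matrix.IsHermitian, Matrix.conjTranspose_smul, hZ.eq, RCLike.star_def, Complex.conj_ofReal]
    rw [e]
    refine posSemidef_smul_one_add ?_ (fun i j => ?_) hηγ
    · exact (hsm _ _ ((hY _).sub (hsm _ _ Matrix.isHermitian_one))).add (hsm _ _ (hY _))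
    · rw [Matrix.add_apply, Matrix.smul_apply, Matrix.smul_apply]
      refine (norm_add_le _ _).trans (add_le_add ?_ ?_)
      · rw [norm_smul, Complex.norm_real, Real.norm_of_nonneg (by positivity)]
        calc _ ≤ 1 / (2 * (d : ℝ)) * η := mul_le_mul_of_nonneg_left (hY0 i j) (by positivity)
          _ = _ := by ring
      · rw [norm_smul, Complex.norm_real, Real.norm_eq_abs, abs_div, hs,
          abs_of_pos (by positivity : 0 < 2 * δ ^ 2)]
        calc _ ≤ δ / (2 * δ ^ 2) * η := mul_le_mul_of_nonneg_left (hYk k i j) (by positivity)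
          _ = _ := by field_simp
  have h1 := fun k => add_mem_rankOneSums
    (mem_rankOneSums_of_posSemidef (hL k δ (abs_of_pos hδ)) (hps k δ (abs_of_pos hδ)))
    (mem_rankOneSums_of_posSemidef (hL k (-δ) (by rw [abs_neg, abs_of_pos hδ]))
      (hps k (-δ) (by rw [abs_neg, abs_of_pos hδ])))
  have h2 := sum_mem_rankOneSums Finset.univ fun k _ => h1 k
  convert h2 using 1
  have hdc : (d : ℂ) ≠ 0 := by exact_mod_cast hd0.ne'
  have hδc : (δ : ℂ) ≠ 0 := by exact_mod_cast hδ.ne'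
  funext κ i j
  simp only [Finset.sum_apply, Pi.add_apply, Matrix.add_apply, Matrix.smul_apply, smul_eq_mul]
  cases κ with
  | none =>
    simp only [homog_none, Complex.ofReal_one, one_mul]
    have : ∀ k : Fin d, ((1 / (2 * d) : ℝ) : ℂ) * Y none i j + ((δ / (2 * δ ^ 2) : ℝ) : ℂ) *
        Y (some k) i j + (((1 / (2 * d) : ℝ) : ℂ) * Y none i j + ((-δ / (2 * δ ^ 2) : ℝ) : ℂ) *
        Y (some k) i j) = (d : ℂ)⁻¹ * Y none i j := fun k => by
      push_cast
      field_simp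
      ring
    simp only [this, Finset.sum_const, Finset.card_univ, Fintype.card_fin, nsmul_eq_mul]
    rw [mul_inv_cancel_left₀ hdc]
  | some l =>
    rw [Finset.sum_eq_single l]
    · simp only [homog_some, Pi.single_eq_same]
      push_cast
      field_simp
      ring
    · intro k _ hk
      simp [homog_some, Pi.single_eq_of_ne hk.symm]
    · simp

lemma isHermitian_of_mem_rankOneSums {L : Set (Fin d → ℝ)}
    {Y : Option (Fin d) → Fin n → Fin n → ℂ} (hY : Y ∈ rankOneSums L n) (κ : Option (Fin d)) :
    (Matrix.of (Y κ)).IsHermitian := by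
  obtain ⟨τ, _, x, ζ, -, rfl⟩ := hY
  ext i j
  simp [rankOneTuple, Finset.sum_apply, mul_comm]

/-- Limits of rank one sums become rank one sums after shrinking. -/
lemma homog_smul_mem_rankOneSums {L : Set (Fin d → ℝ)} (hd : 1 ≤ d) (hn : 1 ≤ n) {δ : ℝ}
    (hδ : 0 < δ) (hL : ∀ k, ∀ s : ℝ, |s| = δ → Pi.single k s ∈ L)
    {X : Fin d → Matrix (Fin n) (Fin n) ℂ} (hXh : ∀ j, (X j).IsHermitian)
    (hX : (fun κ i j => (((n : ℝ)⁻¹ : ℝ) • homog X) κ i j) ∈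
      closure (convexHull ℝ (rankOneStates L n))) {θ : ℝ} (hθ0 : 0 ≤ θ) (hθ : θ < 1) :
    (fun κ i j => homog (fun j => (θ : ℂ) • X j) κ i j) ∈ rankOneSums L n := by
  have hd0 : (0 : ℝ) < d := by exact_mod_cast hd
  have hn0 : (0 : ℝ) < n := by exact_mod_cast hn
  -- Chosen to give equality in the smallness condition of `mem_rankOneSums_of_near_one` with `γ = 1
  -- - θ`, `η = nε`.
  set ε : ℝ := ((1 - θ) / (2 * d)) / (n * n * (1 / (2 * d) + 1 / (2 * δ))) with hε
  have hεpos : 0 < ε := div_pos (div_pos (by linarith) (by positivity)) (by positivity)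
  obtain ⟨q, hq, hdist⟩ := Metric.mem_closure_iff.1 hX ε hεpos
  have hqK := convexHull_rankOneStates_subset L hq
  have hqh := isHermitian_of_mem_rankOneSums hqK
  -- The remainder after subtracting `θn q` from `(1, θX)`: its unit component is near `1 - θ`, the
  -- others near `0`.
  set Y : Option (Fin d) → Matrix (Fin n) (Fin n) ℂ := fun κ =>
    homog (fun j => (θ : ℂ) • X j) κ - ((θ * n : ℝ) : ℂ) • Matrix.of (q κ) with hY
  have hent : ∀ κ i j, ‖((n : ℝ)⁻¹ : ℂ) * homog X κ i j - q κ i j‖ ≤ ε := by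
    intro κ i j
    have h1 := (dist_pi_lt_iff hεpos).1 hdist κ
    have h2 := (dist_pi_lt_iff hεpos).1 h1 i
    have h3 := (dist_pi_lt_iff hεpos).1 h2 j
    rw [dist_eq_norm] at h3
    simpa using h3.le
  have hsc : ∀ κ i j, ‖((θ * n : ℝ) : ℂ) * (((n : ℝ)⁻¹ : ℂ) * homog X κ i j - q κ i j)‖ ≤
      n * ε := by
    intro κ i j
    rw [norm_mul, Complex.norm_real, Real.norm_of_nonneg (by positivity)]
    have h1 : θ * n ≤ n := by nlinarith
    exact mul_le_mul h1 (hent κ i j) (norm_nonneg _) hn0.le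
  have hnc : (n : ℂ) ≠ 0 := by exact_mod_cast hn0.ne'
  have hYmem : (fun κ i j => Y κ i j) ∈ rankOneSums L n := by
    refine mem_rankOneSums_of_near_one hd hδ hL (γ := 1 - θ) (η := n * ε) (fun κ => ?_)
      (fun i j => ?_) (fun k i j => ?_) ?_
    · have hsm : ∀ (r : ℝ) (Z : Matrix (Fin n) (Fin n) ℂ), Z.IsHermitian →
          ((r : ℂ) • Z).IsHermitian := fun r Z hZ => by
        rw [Matrix.IsHermitian, Matrix.conjTranspose_smul, hZ.eq, RCLike.star_def,
          Complex.conj_ofReal]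
      exact (isHermitian_homog (fun j => hsm θ _ (hXh j)) κ).sub (hsm _ _ (hqh κ))
    · refine le_of_eq_of_le (congrArg _ ?_) (hsc none i j)
      simp only [hY, homog_none, Matrix.sub_apply, Matrix.smul_apply, Matrix.of_apply, smul_eq_mul]
      push_cast
      field_simp
      ring
    · refine le_of_eq_of_le (congrArg _ ?_) (hsc (some k) i j)
      simp only [hY, homog_some, Matrix.sub_apply, Matrix.smul_apply, Matrix.of_apply, smul_eq_mul]
      push_cast
      field_simp
    · have h1 : n * (n * ε / (2 * d) + n * ε / (2 * δ)) =
          ε * (n * n * (1 / (2 * d) + 1 / (2 * δ))) := by ring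
      rw [h1, hε, div_mul_cancel₀ _ (by positivity)]
  have h := add_mem_rankOneSums (smul_mem_rankOneSums hqK (by positivity : 0 ≤ θ * n)) hYmem
  convert h using 1
  funext κ i j
  simp [hY]

end Interior

/-! ### Polar duals of matrix ranges. -/

section Polar

variable {m n d : ℕ}

lemma pairing_comm {ι : Type*} [Fintype ι] (C Y : ι → Matrix (Fin n) (Fin n) ℂ) :
    pairing C Y = pairing Y C := by
  simp only [pairing, mul_comm]

lemma star_dotProduct_kronecker_mulVec (P : Matrix (Fin m) (Fin m) ℂ) (Q : Matrix (Fin n) (Fin n) ℂ)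
    (V : Matrix (Fin n) (Fin m) ℂ) :
    (star fun p : Fin m × Fin n => V p.2 p.1) ⬝ᵥ (P ⊗ₖ Q).mulVec (fun p => V p.2 p.1) =
      ∑ a, ∑ b, (V.conjTranspose * Q * V) a b * P a b := by
  simp only [dotProduct, Matrix.mulVec, Fintype.sum_prod_type, Pi.star_apply, Matrix.kroneckerMap_apply,
    Matrix.mul_apply, Matrix.conjTranspose_apply, Finset.mul_sum, Finset.sum_mul]
  refine Finset.sum_congr rfl fun a _ => ?_
  rw [Finset.sum_comm]
  refine Finset.sum_congr rfl fun b _ => ?_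
  rw [Finset.sum_comm]
  exact Finset.sum_congr rfl fun _ _ => Finset.sum_congr rfl fun _ _ => by ring

/-- The quadratic form of `1 - ∑_j Y_j ⊗ X_j` as a pairing. -/
lemma star_dotProduct_one_sub_kronecker_mulVec (Y : Fin d → Matrix (Fin m) (Fin m) ℂ)
    (X : Fin d → Matrix (Fin n) (Fin n) ℂ) (V : Matrix (Fin n) (Fin m) ℂ) :
    (star fun p : Fin m × Fin n => V p.2 p.1) ⬝ᵥ
      (1 - ∑ j, Y j ⊗ₖ X j).mulVec (fun p => V p.2 p.1) =
      pairing (compress V (homog fun j => -X j)) (homog Y) := by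
  rw [Matrix.sub_mulVec, dotProduct_sub, ← Matrix.one_kronecker_one, Matrix.sum_mulVec,
    dotProduct_sum]
  simp only [star_dotProduct_kronecker_mulVec]
  simp only [pairing, Fintype.sum_option, compress, homog_none, homog_some, Matrix.mul_neg,
    Matrix.neg_mul, Matrix.neg_apply, neg_mul, Finset.sum_neg_distrib]
  rw [sub_eq_add_neg]

lemma pairing_nonneg_of_mem_polarDual {S : FreeSet d} {X : Fin d → Matrix (Fin n) (Fin n) ℂ}
    (hX : X ∈ polarDual S n) {Y : Fin d → Matrix (Fin m) (Fin m) ℂ} (hY : Y ∈ S m)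
    (V : Matrix (Fin n) (Fin m) ℂ) :
    0 ≤ pairing (compress V (homog fun j => -X j)) (homog Y) := by
  rw [← star_dotProduct_one_sub_kronecker_mulVec]
  exact (hX.2 m Y hY).dotProduct_mulVec_nonneg _

lemma pairing_rankOneTuple (C : Option (Fin d) → Matrix (Fin n) (Fin n) ℂ) (x : Fin d → ℝ)
    (ζ : Fin n → ℂ) : (pairing C fun κ => Matrix.of (rankOneTuple x ζ κ)) =
      ∑ κ, ((homog x κ : ℝ) : ℂ) * (star ζ ⬝ᵥ (C κ).mulVec ζ) := by
  simp only [pairing, rankOneTuple, Matrix.of_apply, dotProduct, Matrix.mulVec, Finset.mul_sum,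
    Pi.star_apply]
  exact Finset.sum_congr rfl fun _ _ => Finset.sum_congr rfl fun _ _ =>
    Finset.sum_congr rfl fun _ _ => by ring

/-- A positive semidefinite matrix plus a positive scalar factors through an invertible matrix. -/
lemma Matrix.PosSemidef.exists_add_smul_one_eq {E : Matrix (Fin n) (Fin n) ℂ} (hE : E.PosSemidef)
    {ε : ℝ} (hε : 0 < ε) : ∃ R W : Matrix (Fin n) (Fin n) ℂ,
      R.conjTranspose * R = E + (ε : ℂ) • 1 ∧ W * R = 1 ∧ R * W = 1 := by
  have hpd : (E + (ε : ℂ) • (1 : Matrix (Fin n) (Fin n) ℂ)).PosDef :=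
    Matrix.PosDef.posSemidef_add hE (Matrix.PosDef.one.smul (by exact_mod_cast hε))
  obtain ⟨R, hR⟩ := hpd.posSemidef.exists_conjTranspose_mul_self
  have hu : IsUnit (R.conjTranspose * R).det := by
    rw [← hR]
    exact (Matrix.isUnit_iff_isUnit_det _).1 hpd.isUnit
  rw [Matrix.det_mul] at hu
  have hu' := isUnit_of_mul_isUnit_right hu
  exact ⟨R, R⁻¹, hR.symm, Matrix.nonsing_inv_mul R hu', Matrix.mul_nonsing_inv R hu'⟩

/-- Hermitian matrices as operators on a finite dimensional Hilbert space in any universe. -/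
lemma exists_operators_of_matrices {X : Fin d → Matrix (Fin n) (Fin n) ℂ}
    (hX : ∀ j, (X j).IsHermitian) :
    ∃ (K : Type*) (_ : NormedAddCommGroup K) (_ : InnerProductSpace ℂ K) (_ : CompleteSpace K)
      (B : Fin d → K →L[ℂ] K) (e : Fin n → K), (∀ i, IsSelfAdjoint (B i)) ∧ Orthonormal ℂ e ∧
      opGram B e = X ∧ ∀ ξ : K, ∃ v : Fin n → ℂ, ξ = ∑ i, v i • e i := by
  let σ : Type _ := ULift (Fin n)
  let B : Fin d → EuclideanSpace ℂ σ →L[ℂ] EuclideanSpace ℂ σ := fun j =>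
    Matrix.toEuclideanCLM (n := σ) (𝕜 := ℂ) ((X j).submatrix ULift.down ULift.down)
  let b := (EuclideanSpace.basisFun σ ℂ).reindex Equiv.ulift
  have hb : ∀ i, b i = EuclideanSpace.single (ULift.up i) (1 : ℂ) := fun i => by
    simp only [b, OrthonormalBasis.reindex_apply, EuclideanSpace.basisFun_apply]
    rfl
  refine ⟨EuclideanSpace ℂ σ, inferInstance, inferInstance, inferInstance, B, b, fun j => ?_,
    b.orthonormal, ?_, fun ξ => ⟨fun i => b.repr ξ i, (b.sum_repr ξ).symm⟩⟩
  · have h : star ((X j).submatrix ULift.down ULift.down : Matrix σ σ ℂ) =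
        (X j).submatrix ULift.down ULift.down := by
      rw [Matrix.star_eq_conjTranspose, Matrix.conjTranspose_submatrix, (hX j).eq]
    change star (B j) = B j
    rw [← map_star, h]
  · funext j
    ext i i'
    rw [opGram_apply, hb, hb]
    simp [B, EuclideanSpace.inner_single_left, Matrix.ofLp_toEuclideanCLM]

/-- A bipolar inequality for affine functionals. -/
lemma bipolar_nonneg {L : Set (Fin d → ℝ)} (h0 : 0 ∈ L) {q c : Option (Fin d) → ℝ}
    (hq : ∀ x : Fin d → ℝ, (∀ y ∈ L, ∑ j, x j * y j ≤ 1) → 0 ≤ ∑ κ, homog x κ * q κ)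
    (hc : ∀ y ∈ L, 0 ≤ ∑ κ, c κ * homog y κ) :
    0 ≤ c none * q none - ∑ j, c (some j) * q (some j) := by
  have hc0 : 0 ≤ c none := by simpa [Fintype.sum_option] using hc 0 h0
  refine le_of_forall_pos_le_add fun ε hε => ?_
  have hq0 : 0 ≤ q none := by
    simpa [Fintype.sum_option] using hq 0 (by simp)
  -- Replacing `c_0` by `c_0 + r > 0` allows division, which puts `-c_j / (c_0 + r)` in the polar of
  -- `L`; the error `r q_0` is at most `ε`.
  set r : ℝ := ε / (q none + 1) with hr
  have hrpos : 0 < r := by positivity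
  have h := hq (fun j => -c (some j) / (c none + r)) fun y hy => by
    have h1 := hc y hy
    rw [Fintype.sum_option] at h1
    simp only [homog_none, homog_some, mul_one] at h1
    have h2 : ∑ j, -c (some j) / (c none + r) * y j =
        -(∑ j, c (some j) * y j) / (c none + r) := by
      rw [← Finset.sum_neg_distrib, Finset.sum_div]
      exact Finset.sum_congr rfl fun _ _ => by ring
    rw [h2, div_le_one (by positivity)]
    linarith
  rw [Fintype.sum_option] at h
  simp only [homog_none, homog_some, one_mul] at h
  have h3 : ∑ j, -c (some j) / (c none + r) * q (some j) =
      -(∑ j, c (some j) * q (some j)) / (c none + r) := by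
    rw [← Finset.sum_neg_distrib, Finset.sum_div]
    exact Finset.sum_congr rfl fun _ _ => by ring
  rw [h3] at h
  have h4 : 0 ≤ q none * (c none + r) - ∑ j, c (some j) * q (some j) := by
    have h5 := mul_nonneg h (by positivity : 0 ≤ c none + r)
    have h6 : (q none + -(∑ j, c (some j) * q (some j)) / (c none + r)) * (c none + r) =
        q none * (c none + r) - ∑ j, c (some j) * q (some j) := by
      field_simp
      ring
    linarith
  have h7 : q none * r ≤ ε := by
    rw [hr, mul_div_assoc', div_le_iff₀ (by positivity)]
    nlinarith
  linarith

variable {H : Type*} [NormedAddCommGroup H] [InnerProductSpace ℂ H] [CompleteSpace H]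

lemma mem_polarDual_of_mem_pencilCone {A : Fin d → H →L[ℂ] H} (hA : ∀ i, IsSelfAdjoint (A i))
    {X : Fin d → Matrix (Fin n) (Fin n) ℂ}
    (hX : (homog fun j => -X j) ∈ pencilCone (homog A) n) : X ∈ polarDual (matrixRange A) n := by
  refine ⟨fun j => by simpa using (hX.1 (some j)).neg, fun m Y hY => ?_⟩
  refine Matrix.posSemidef_of_forall_nonneg fun v => ?_
  have h := ((mem_matrixRange_iff hA).1 hY).2 _
    (compress_mem_pencilCone hX (Matrix.of fun i p => v (p, i)))
  rw [← star_dotProduct_one_sub_kronecker_mulVec] at h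
  exact h

lemma homog_neg_scalarTuple (x : Fin d → ℝ) : (homog fun j => -scalarTuple x j) =
    fun κ => Matrix.of fun _ _ => ((homog (fun j => -x j) κ : ℝ) : ℂ) := by
  funext κ
  ext a b
  cases κ with
  | none => simp [Subsingleton.elim a b]
  | some j => simp [scalarTuple_apply]

/-- The higher levels of `W(A)` impose nothing further on scalars: the condition on `W_1(A)` already
says `∑ x_j A_j ≤ 1`, which every level inherits. -/
lemma mem_levelOne_polarDual_iff {A : Fin d → H →L[ℂ] H} (hA : ∀ i, IsSelfAdjoint (A i))
    {x : Fin d → ℝ} : x ∈ levelOne (polarDual (matrixRange A)) ↔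
      ∀ y ∈ levelOne (matrixRange A), ∑ j, x j * y j ≤ 1 := by
  have e : ∀ y : Fin d → ℝ, ∑ κ, homog (fun j => -x j) κ * homog y κ = 1 - ∑ j, x j * y j := by
    intro y
    simp [Fintype.sum_option, sub_eq_add_neg]
  constructor
  · intro hx y hy
    have h := pairing_nonneg_of_mem_polarDual (mem_levelOne.1 hx) (mem_levelOne.1 hy) 1
    have e1 : ∀ C : Option (Fin d) → Matrix (Fin 1) (Fin 1) ℂ, compress 1 C = C := fun C => by
      funext κ
      simp [compress]
    rw [e1, homog_neg_scalarTuple, pairing_scalar] at h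
    rw [e] at h
    have : 0 ≤ 1 - ∑ j, x j * y j := by exact_mod_cast h
    linarith
  · intro h
    refine mem_polarDual_of_mem_pencilCone hA ?_
    change (homog fun j => -scalarTuple x j) ∈ _
    rw [homog_neg_scalarTuple, scalar_pencil_mem_iff (isSelfAdjoint_homog hA),
      mem_scalarCone_homog_iff hA]
    intro y hy
    rw [e]
    linarith [h y hy]

/-- The polar of a set bounded by `M` contains the points `±e_k / M`. This holds even when the polar
is unbounded. -/
lemma exists_cross_subset_levelOne_polarDual {A : Fin d → H →L[ℂ] H}
    (hA : ∀ i, IsSelfAdjoint (A i)) : ∃ δ : ℝ, 0 < δ ∧ ∀ k, ∀ s : ℝ, |s| = δ →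
      Pi.single k s ∈ levelOne (polarDual (matrixRange A)) := by
  obtain ⟨M, hMpos, hM⟩ :=
    (isCompact_levelOne_matrixRange hA).isBounded.exists_pos_norm_le
  refine ⟨M⁻¹, inv_pos.2 hMpos, fun k s hs => (mem_levelOne_polarDual_iff hA).2 fun y hy => ?_⟩
  rw [Finset.sum_eq_single k (fun j _ hj => by simp [Pi.single_eq_of_ne hj]) (by simp)]
  rw [Pi.single_eq_same]
  have h1 : |y k| ≤ M := (norm_le_pi_norm y k).trans (hM y hy)
  calc s * y k ≤ |s * y k| := le_abs_self _
    _ = M⁻¹ * |y k| := by rw [abs_mul, hs]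
    _ ≤ M⁻¹ * M := mul_le_mul_of_nonneg_left h1 (inv_pos.2 hMpos).le
    _ = 1 := inv_mul_cancel₀ hMpos.ne'

end Polar

/-! ### The scale `σ` and maps out of `S_A`. -/

section DualScale

variable {m n d : ℕ}

lemma compress_compress {ι : Type*} {k : ℕ} (W : Matrix (Fin k) (Fin n) ℂ)
    (V : Matrix (Fin n) (Fin m) ℂ) (F : ι → Matrix (Fin k) (Fin k) ℂ) :
    compress V (compress W F) = compress (W * V) F := by
  funext κ
  simp only [compress, Matrix.conjTranspose_mul, Matrix.mul_assoc]

lemma compress_column_apply {ι : Type*} (V : Matrix (Fin n) (Fin 1) ℂ)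
    (F : ι → Matrix (Fin n) (Fin n) ℂ) (κ : ι) :
    compress V F κ 0 0 = (star fun i => V i 0) ⬝ᵥ (F κ).mulVec fun i => V i 0 := by
  simp only [compress, Matrix.mul_assoc]
  simp [Matrix.mul_apply, dotProduct, Matrix.mulVec]

lemma isHermitian_real_smul {X : Matrix (Fin n) (Fin n) ℂ} (hX : X.IsHermitian) (t : ℝ) :
    ((t : ℂ) • X).IsHermitian := by
  rw [Matrix.IsHermitian, Matrix.conjTranspose_smul, hX.eq, RCLike.star_def, Complex.conj_ofReal]

variable {H : Type*} [NormedAddCommGroup H] [InnerProductSpace ℂ H] [CompleteSpace H]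

/-- Pencils positive on the polar of the numerical range of `A` are nonnegative on `t X` for `X` in
the polar dual of the matrix range, when `t` scales positive maps to completely positive ones. -/
lemma pairing_homog_smul_nonneg_of_polarDual {A : Fin d → H →L[ℂ] H}
    (hA : ∀ i, IsSelfAdjoint (A i)) (h0 : (0 : Fin d → ℝ) ∈ levelOne (matrixRange A)) {t : ℝ}
    (ht : ∀ (K : Type*) [NormedAddCommGroup K] [InnerProductSpace ℂ K] [CompleteSpace K]
      (B : Fin d → K →L[ℂ] K), (∀ i, IsSelfAdjoint (B i)) →
        scalarCone (homog A) ⊆ scalarCone (homog B) →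
        ∀ n, pencilCone (homog A) n ⊆ pencilCone (homog fun i => (t : ℂ) • B i) n)
    {X : Fin d → Matrix (Fin n) (Fin n) ℂ} (hX : X ∈ polarDual (matrixRange A) n)
    {C : Option (Fin d) → Matrix (Fin n) (Fin n) ℂ}
    (hC : ∀ x ∈ levelOne (polarDual (matrixRange A)), ∀ ζ,
      0 ≤ (pairing C fun κ => Matrix.of (rankOneTuple x ζ κ)).re) :
    0 ≤ (pairing C (homog fun j => (t : ℂ) • X j)).re := by
  set E := hermPart C with hEdef
  have hEh : ∀ κ, (E κ).IsHermitian := hermPart_isHermitian C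
  set q : (Fin n → ℂ) → Option (Fin d) → ℝ := fun ζ κ => (star ζ ⬝ᵥ (E κ).mulVec ζ).re with hq
  have hqc : ∀ ζ κ, star ζ ⬝ᵥ (E κ).mulVec ζ = (q ζ κ : ℂ) := fun ζ κ =>
    Complex.ext rfl ((hEh κ).im_star_dotProduct_mulVec_self ζ)
  have hqM : ∀ ζ, ∀ x : Fin d → ℝ, (∀ y ∈ levelOne (matrixRange A), ∑ j, x j * y j ≤ 1) →
      0 ≤ ∑ κ, homog x κ * q ζ κ := by
    intro ζ x hx
    have h1 := hC x ((mem_levelOne_polarDual_iff hA).2 hx) ζ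
    have h2 := pairing_hermPart C (Y := fun κ => Matrix.of (rankOneTuple x ζ κ)) (fun κ => by
      ext i j
      simp [rankOneTuple, mul_comm])
    rw [← hEdef, pairing_rankOneTuple] at h2
    simp only [hqc] at h2
    have h3 : ∑ κ, homog x κ * q ζ κ = (pairing C fun κ => Matrix.of (rankOneTuple x ζ κ)).re := by
      exact_mod_cast h2
    rw [h3]
    exact h1
  have hE0 : (E none).PosSemidef := by
    refine Matrix.posSemidef_of_forall_nonneg fun ζ => ?_
    have h1 := hqM ζ 0 (by simp)
    rw [Fintype.sum_option] at h1
    simp only [homog_none, homog_some, Pi.zero_apply, zero_mul, Finset.sum_const_zero, add_zero,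
      one_mul] at h1
    rw [hqc]
    exact_mod_cast h1
  have htX : ∀ j, ((t : ℂ) • X j).IsHermitian := fun j => isHermitian_real_smul (hX.1 j) t
  have key : ∀ ε : ℝ, 0 < ε → 0 ≤ (pairing C (homog fun j => (t : ℂ) • X j)).re + ε * n := by
    intro ε hε
    obtain ⟨R, W, hR, hWR, hRW⟩ := hE0.exists_add_smul_one_eq hε
    -- Adding `ε` makes the constant term `R*R` invertible. Compression by `W = R⁻¹` normalizes it
    -- to `1`, and the negated other coefficients become a tuple `B` of operators.
    set F : Option (Fin d) → Matrix (Fin n) (Fin n) ℂ := fun κ =>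
      κ.elim (E none + (ε : ℂ) • 1) fun k => -E (some k) with hF
    have hFh : ∀ κ, (F κ).IsHermitian := by
      intro κ
      cases κ with
      | none => exact (hEh none).add (isHermitian_real_smul Matrix.isHermitian_one ε)
      | some k => exact (hEh _).neg
    have hstar : R.conjTranspose * W.conjTranspose = 1 := by
      rw [← Matrix.conjTranspose_mul, hWR, Matrix.conjTranspose_one]
    have hstar' : W.conjTranspose * R.conjTranspose = 1 := by
      rw [← Matrix.conjTranspose_mul, hRW, Matrix.conjTranspose_one]
    have hWF : compress W F = homog fun k => compress W F (some k) := by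
      funext κ
      cases κ with
      | none =>
        change W.conjTranspose * (E none + (ε : ℂ) • 1) * W = 1
        rw [← hR, ← Matrix.mul_assoc, hstar', Matrix.one_mul, hRW]
      | some k => rfl
    obtain ⟨K, _, _, _, B, e, hB, he, hBe, hspan⟩ :=
      exists_operators_of_matrices fun k => compress_isHermitian W hFh (some k)
    have hgram : opGram (homog B) e = compress W F := by
      rw [← homog_opGram he, hBe, ← hWF]
    -- Positivity of `A_i ↦ B_i` is the bipolar inequality: the forms of `E` are nonnegative on the
    -- polar of `W_1(A)`, and the shift by `ε` contributes a nonnegative term.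
    have hord : scalarCone (homog A) ⊆ scalarCone (homog B) := by
      intro c hc ξ
      obtain ⟨v, rfl⟩ := hspan ξ
      set V : Matrix (Fin n) (Fin 1) ℂ := Matrix.of fun i _ => v i with hV
      have h1 := compress_opGram V (homog B) e
      rw [hgram, compress_compress] at h1
      set w : Fin n → ℂ := fun i => (W * V) i 0
      have h2 : ∀ κ, ⟪∑ i, v i • e i, homog B κ (∑ i, v i • e i)⟫_ℂ =
          star w ⬝ᵥ (F κ).mulVec w := fun κ => by
        rw [← compress_column_apply, h1]
        rfl
      have hcL := (mem_scalarCone_homog_iff hA).1 hc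
      have h3 := bipolar_nonneg h0 (hqM w) hcL
      have hc0 : 0 ≤ c none := by simpa [Fintype.sum_option] using hcL 0 h0
      have h4 : star w ⬝ᵥ (F none).mulVec w = ((q w none + ε * ∑ i, ‖w i‖ ^ 2 : ℝ) : ℂ) := by
        simp only [hF, Option.elim]
        rw [Matrix.add_mulVec, dotProduct_add, hqc, Matrix.smul_mulVec, dotProduct_smul,
          Matrix.one_mulVec]
        push_cast
        rw [smul_eq_mul, dotProduct]
        congr 2
        exact Finset.sum_congr rfl fun i _ => Complex.conj_mul' _
      have h5 : ∀ k, star w ⬝ᵥ (F (some k)).mulVec w = ((-q w (some k) : ℝ) : ℂ) := fun k => by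
        simp only [hF, Option.elim]
        rw [Matrix.neg_mulVec, dotProduct_neg, hqc]
        push_cast
        rfl
      simp only [h2]
      rw [Fintype.sum_option, h4]
      simp only [h5, Complex.ofReal_re, mul_neg, Finset.sum_neg_distrib]
      have h6 : 0 ≤ c none * (ε * ∑ i, ‖w i‖ ^ 2) :=
        mul_nonneg hc0 (mul_nonneg hε.le (Finset.sum_nonneg fun _ _ => sq_nonneg _))
      linarith
    have hmem : (fun k => (t : ℂ) • compress W F (some k)) ∈ matrixRange A n := by
      refine (mem_matrixRange_iff hA).2
        ⟨fun k => isHermitian_real_smul (compress_isHermitian W hFh _) t, fun D hD => ?_⟩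
      have e2 : (fun k => (t : ℂ) • compress W F (some k)) =
          fun k => (t : ℂ) • opGram B e k := by rw [hBe]
      rw [e2, homog_smul_opGram he]
      exact (ht K B hB hord n hD).2 e
    -- `X` is paired with `tB ∈ W(A)`, and `R` undoes the normalization; the two signs cancel and
    -- leave the pairing of `E` with `tX` plus `εn`.
    have h1 := pairing_nonneg_of_mem_polarDual hX hmem R.transpose
    rw [pairing_compress, Matrix.transpose_transpose] at h1
    have h2 : compress R (homog fun k => (t : ℂ) • compress W F (some k)) =
        fun κ => κ.elim (E none + (ε : ℂ) • 1) fun k => -((t : ℂ) • E (some k)) := by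
      funext κ
      cases κ with
      | none =>
        simp only [compress, homog_none, Matrix.mul_one, hR, Option.elim]
      | some k =>
        simp only [compress, homog_some, Option.elim, hF]
        rw [Matrix.mul_smul, Matrix.smul_mul, ← smul_neg]
        congr 1
        rw [← Matrix.mul_assoc, ← Matrix.mul_assoc, hstar, Matrix.one_mul, Matrix.mul_assoc, hWR,
          Matrix.mul_one]
    have h3 : pairing (homog fun j => -X j)
        (compress R (homog fun k => (t : ℂ) • compress W F (some k))) =
        pairing E (homog fun j => (t : ℂ) • X j) + ((ε * n : ℝ) : ℂ) := by
      rw [h2]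
      simp only [pairing, Fintype.sum_option, homog_none, homog_some, Option.elim,
        Matrix.add_apply, Matrix.smul_apply, Matrix.neg_apply, Matrix.one_apply, smul_eq_mul,
        ite_mul, mul_ite, zero_mul, mul_zero, one_mul, mul_one, neg_mul_neg, Finset.sum_ite_eq,
        Finset.mem_univ, if_true, Finset.sum_add_distrib, Finset.sum_const, Finset.card_univ,
        Fintype.card_fin, nsmul_eq_mul]
      push_cast
      rw [add_right_comm, mul_comm (n : ℂ)]
      congr 2
      exact Finset.sum_congr rfl fun _ _ => Finset.sum_congr rfl fun _ _ =>
        Finset.sum_congr rfl fun _ _ => by ring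
    rw [h3, hEdef, pairing_hermPart C (isHermitian_homog htX)] at h1
    exact_mod_cast h1
  refine le_of_forall_pos_le_add fun ε hε => ?_
  have h1 := key (ε / (n + 1)) (by positivity)
  have h2 : ε / (n + 1) * n ≤ ε := by
    rw [div_mul_eq_mul_div, div_le_iff₀ (by positivity)]
    nlinarith
  linarith

/-- Without compactness of the polar, separation yields only a limit of rank one sums for `tX`;
shrinking by `s/t < 1` makes it an actual sum. -/
lemma mem_inclusionScaleSet_polarDual {A : Fin d → H →L[ℂ] H}
    (hA : ∀ i, IsSelfAdjoint (A i)) (h0 : (0 : Fin d → ℝ) ∈ levelOne (matrixRange A))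
    (hd : 1 ≤ d) (hn : 1 ≤ n) {s t : ℝ≥0} (hst : s < t)
    (ht : ∀ (K : Type*) [NormedAddCommGroup K] [InnerProductSpace ℂ K] [CompleteSpace K]
      (B : Fin d → K →L[ℂ] K), (∀ i, IsSelfAdjoint (B i)) →
        scalarCone (homog A) ⊆ scalarCone (homog B) →
        ∀ n, pencilCone (homog A) n ⊆ pencilCone (homog fun i => ((t : ℝ) : ℂ) • B i) n) :
    s ∈ inclusionScaleSet (polarDual (matrixRange A)) n := by
  intro T hT hST X hX
  have htpos : (0 : ℝ) < t := lt_of_le_of_lt s.2 hst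
  have hnc : (n : ℂ) ≠ 0 := by exact_mod_cast (by omega : n ≠ 0)
  obtain ⟨δ, hδ, hcross⟩ := exists_cross_subset_levelOne_polarDual hA
  have h1 := mem_closure_convexHull_rankOneStates (L := levelOne (polarDual (matrixRange A)))
    (p := ((n : ℝ)⁻¹ : ℝ) • homog fun j => ((t : ℝ) : ℂ) • X j)
    (by simp [Matrix.trace_smul, hnc]) (fun C hC => by
      have : ((n : ℝ)⁻¹ : ℝ) • (homog fun j => ((t : ℝ) : ℂ) • X j) =
          (((n : ℝ)⁻¹ : ℝ) : ℂ) • homog fun j => ((t : ℝ) : ℂ) • X j :=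
        (Complex.coe_smul _ _).symm
      rw [this, pairing_smul_right, Complex.re_ofReal_mul]
      exact mul_nonneg (by positivity) (pairing_homog_smul_nonneg_of_polarDual hA h0 ht hX hC))
  have h2 := homog_smul_mem_rankOneSums hd hn hδ hcross
    (fun j => isHermitian_real_smul (hX.1 j) t) h1 (θ := s / t)
    (div_nonneg s.2 htpos.le) ((div_lt_one htpos).2 hst)
  have h3 : (fun j => ((s / t : ℝ) : ℂ) • ((t : ℝ) : ℂ) • X j) = fun j => ((s : ℝ) : ℂ) • X j := by
    funext j
    rw [smul_smul, ← Complex.ofReal_mul, div_mul_cancel₀ _ htpos.ne']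
  rw [h3] at h2
  exact mem_of_homog_mem_rankOneSums hT hn (fun x hx => hST hx) h2

/-- A pencil positive at `A`, shifted by `ε` and normalized to constant term `1`, is up to sign a
point of the polar dual. The scale is applied to this point and to the matrix convex set of tuples
`Y` with `∑ B_j ⊗ Y_j ≤ I`, encoded by Gram matrices. -/
lemma unitalMapIsCP_of_le_dualInclusionScale {A : Fin d → H →L[ℂ] H}
    (hA : ∀ i, IsSelfAdjoint (A i)) (h0 : (0 : Fin d → ℝ) ∈ levelOne (matrixRange A)) {t : ℝ≥0}
    (ht : (t : ℝ≥0∞) ≤ dualInclusionScale (matrixRange A))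
    {K : Type*} [NormedAddCommGroup K] [InnerProductSpace ℂ K] [CompleteSpace K]
    {B : Fin d → K →L[ℂ] K} (hB : ∀ i, IsSelfAdjoint (B i))
    (hAB : scalarCone (homog A) ⊆ scalarCone (homog B)) :
    UnitalMapIsCP A fun i => ((t : ℝ) : ℂ) • B i := by
  have htB := isSelfAdjoint_real_smul hB (t : ℝ)
  rw [unitalMapIsCP_iff hA htB]
  intro n C hC
  refine ⟨hC.1, fun ξ => ?_⟩
  rcases Nat.eq_zero_or_pos n with rfl | hn
  · simp [pairing]
  refine pairing_nonneg_of_re hC.1 (opGram_isHermitian (isSelfAdjoint_homog htB) ξ) ?_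
  have hC0 : (C none).PosSemidef := by
    have h1 := evalPencil_posSemidef hA (fun c hc => (mem_scalarCone_homog_iff hA).1 hc 0 h0) hC
    rwa [evalPencil_zero] at h1
  rw [pairing_opGram_homog_smul, Complex.add_re, Complex.re_ofReal_mul]
  refine affine_nonneg_of_cofinal t.2 ?_ fun s hs hst => ?_
  · exact (Complex.nonneg_iff.1 (tensorForm_nonneg ξ hC0 fun η => by
      rw [one_apply_eq_self, inner_self_eq_ofReal]
      exact_mod_cast sq_nonneg ‖η‖)).1
  obtain ⟨s', hs', hlt⟩ := exists_gt_mem_inclusionScaleSet ht hn hs hst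
  refine ⟨s', hlt, ?_⟩
  have key : ∀ ε : ℝ, 0 < ε → 0 ≤ (tensorForm ξ (C none) 1).re + ε * ∑ i, ‖ξ i‖ ^ 2 +
      s' * (∑ j, tensorForm ξ (C (some j)) (B j)).re := by
    intro ε hε
    obtain ⟨R, W, hR, hWR, hRW⟩ := hC0.exists_add_smul_one_eq hε
    set F : ℝ → Option (Fin d) → Matrix (Fin n) (Fin n) ℂ := fun r κ =>
      κ.elim (C none + (ε : ℂ) • 1) fun k => (r : ℂ) • C (some k) with hF
    have hstar' : W.conjTranspose * R.conjTranspose = 1 := by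
      rw [← Matrix.conjTranspose_mul, hRW, Matrix.conjTranspose_one]
    have hWF : ∀ r, compress W (F r) = homog fun k => (r : ℂ) • compress W C (some k) := by
      intro r
      funext κ
      cases κ with
      | none =>
        change W.conjTranspose * (C none + (ε : ℂ) • 1) * W = 1
        rw [← hR, ← Matrix.mul_assoc, hstar', Matrix.one_mul, hRW]
      | some k => simp [compress, hF]
    have hF1 : F 1 ∈ pencilCone (homog A) n := by
      refine ⟨fun κ => ?_, fun η => ?_⟩
      · cases κ with
        | none => exact (hC.1 none).add (isHermitian_real_smul Matrix.isHermitian_one ε)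
        | some k => exact isHermitian_real_smul (hC.1 _) 1
      · have h1 := hC.2 η
        have h2 : 0 ≤ tensorForm η (((ε : ℂ) • 1 : Matrix (Fin n) (Fin n) ℂ)) (1 : H →L[ℂ] H) :=
          tensorForm_nonneg η (Matrix.PosSemidef.one.smul (by exact_mod_cast hε.le)) fun ζ => by
            rw [one_apply_eq_self, inner_self_eq_ofReal]
            exact_mod_cast sq_nonneg ‖ζ‖
        refine (add_nonneg h1 h2).trans_eq ?_
        rw [pairing_opGram, pairing_opGram, Fintype.sum_option, Fintype.sum_option]
        simp only [hF, Option.elim, homog_none, homog_some, map_add, LinearMap.add_apply,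
          Complex.ofReal_one, one_smul]
        ring
    set X : Fin d → Matrix (Fin n) (Fin n) ℂ := fun k => -compress W C (some k) with hXdef
    have hX : X ∈ polarDual (matrixRange A) n := by
      refine mem_polarDual_of_mem_pencilCone hA ?_
      have h1 := compress_mem_pencilCone hF1 W
      rw [hWF] at h1
      simpa [hXdef] using h1
    -- The level-one inclusion is positivity of the map: `∑ x_j A_j ≤ 1` implies `∑ x_j B_j ≤ 1`.
    -- The test vectors `R ξ` are chosen so that compression by `W` returns `ξ`.
    have h1 := hs' (conePolar fun n => {D | ∃ η : Fin n → K, D = opGram (homog fun j => -B j) η})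
      (isMatrixConvex_conePolar (by
        rintro k m V _ ⟨η, rfl⟩
        exact ⟨_, compress_opGram V _ η⟩)) (by
      intro Y hY
      have hYs := eq_scalarTuple_of_isHermitian hY.1
      set x : Fin d → ℝ := fun j => (Y j 0 0).re
      have hx : x ∈ levelOne (polarDual (matrixRange A)) := by
        rw [mem_levelOne, ← hYs]
        exact hY
      have hc : (homog fun j => -x j) ∈ scalarCone (homog A) := by
        rw [mem_scalarCone_homog_iff hA]
        intro y hy
        have := (mem_levelOne_polarDual_iff hA).1 hx y hy
        simp only [Fintype.sum_option, homog_none, homog_some, one_mul, neg_mul,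
          Finset.sum_neg_distrib]
        linarith
      rintro _ ⟨η, rfl⟩
      have h2 := ((scalar_pencil_mem_iff (isSelfAdjoint_homog hB)).2 (hAB hc)).2 η
      rw [hYs, pairing_comm]
      convert h2 using 1
      simp only [pairing, Fin.sum_univ_one, homog_scalarTuple_apply, Matrix.of_apply,
        opGram_apply, Fintype.sum_option, homog_none, homog_some]
      simp) X hX _ ⟨fun a => ∑ j, R a j • ξ j, rfl⟩
    set η : Fin n → K := fun a => ∑ j, R a j • ξ j with hη
    have h2 : pairing (opGram (homog fun j => -B j) η) (homog fun j => ((s' : ℝ) : ℂ) • X j) =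
        pairing (homog fun k => ((s' : ℝ) : ℂ) • compress W C (some k)) (opGram (homog B) η) := by
      rw [pairing_comm]
      simp [pairing, Fintype.sum_option, hXdef]
    have h3 : (fun b => ∑ a, W.transpose a b • η a) = ξ := by
      funext b
      simp only [hη, Finset.smul_sum, smul_smul, Matrix.transpose_apply]
      rw [Finset.sum_comm]
      simp only [← Finset.sum_smul, ← Matrix.mul_apply, hWR]
      simp [Matrix.one_apply]
    rw [h2, ← hWF, pairing_compress, compress_opGram, h3, pairing_opGram, Fintype.sum_option] at h1
    simp only [hF, Option.elim, homog_none, homog_some, map_add, map_smul, LinearMap.add_apply,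
      LinearMap.smul_apply, smul_eq_mul, ← Finset.mul_sum] at h1
    have h4 : tensorForm ξ (1 : Matrix (Fin n) (Fin n) ℂ) (1 : K →L[ℂ] K) =
        ((∑ i, ‖ξ i‖ ^ 2 : ℝ) : ℂ) := by
      simp [tensorForm_apply, Matrix.one_apply]
    rw [h4] at h1
    have h5 := (Complex.nonneg_iff.1 h1).1
    simpa only [Complex.add_re, Complex.re_ofReal_mul, Complex.ofReal_re] using h5
  refine le_of_forall_pos_le_add fun ε hε => ?_
  set N : ℝ := ∑ i, ‖ξ i‖ ^ 2 with hN
  have hN0 : 0 ≤ N := Finset.sum_nonneg fun _ _ => sq_nonneg _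
  have h1 := key (ε / (N + 1)) (by positivity)
  have h2 : ε / (N + 1) * N ≤ ε := by
    rw [div_mul_eq_mul_div, div_le_iff₀ (by positivity)]
    nlinarith
  linarith

end DualScale

/-! ### Rank one symmetries from interior points and from tight frames. -/

section RankOneFrames

variable {d : ℕ}

/-- The matrices are `a v vᵀ`, and the identity is their uniform average. -/
lemma isRankOneSymmetric_of_sum_vecMulVec {L : Set (Fin d → ℝ)} {C a : ℝ} (ha : a ≠ 0) {ι : Type*}
    [Fintype ι] [Nonempty ι] {v : ι → Fin d → ℝ} (hv : ∀ i, v i ≠ 0)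
    (hsum : ∑ i, Matrix.vecMulVec (v i) (v i) = (Fintype.card ι / a) • (1 : Matrix (Fin d) (Fin d) ℝ))
    (hL : ∀ i, ∀ x ∈ L, ∃ y ∈ L, (a * (v i ⬝ᵥ x)) • v i = C • y) : IsRankOneSymmetric L C := by
  have hk : (Fintype.card ι : ℝ) ≠ 0 := by exact_mod_cast Fintype.card_ne_zero
  refine ⟨Fintype.card ι, fun m => a • Matrix.vecMulVec (v ((Fintype.equivFin ι).symm m))
    (v ((Fintype.equivFin ι).symm m)), fun m => ?_, ?_, fun m x hx => ?_⟩
  · beta_reduce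
    rw [← Matrix.smul_vecMulVec]
    refine le_antisymm (Matrix.rank_vecMulVec_le _ _) (Nat.one_le_iff_ne_zero.2 fun h => ?_)
    rw [Matrix.rank, Submodule.finrank_eq_zero, LinearMap.range_eq_bot, ← Matrix.toLin'_apply',
      LinearEquiv.map_eq_zero_iff, Matrix.vecMulVec_eq_zero] at h
    rcases h with h | h
    · exact (smul_ne_zero ha (hv _)) h
    · exact hv _ h
  · have h1 : (1 : Matrix (Fin d) (Fin d) ℝ) =
        ∑ i, (Fintype.card ι : ℝ)⁻¹ • a • Matrix.vecMulVec (v i) (v i) := by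
      rw [← Finset.smul_sum, ← Finset.smul_sum, hsum, smul_smul, smul_smul]
      rw [show (Fintype.card ι : ℝ)⁻¹ * a * (Fintype.card ι / a) = 1 by field_simp, one_smul]
    rw [h1]
    refine (convex_convexHull ℝ _).sum_mem (fun _ _ => by positivity) ?_ fun i _ =>
      subset_convexHull ℝ _ ⟨Fintype.equivFin ι i, by simp⟩
    rw [Finset.sum_const, Finset.card_univ, nsmul_eq_mul, mul_inv_cancel₀ hk]
  · obtain ⟨y, hy, h⟩ := hL ((Fintype.equivFin ι).symm m) x hx
    refine ⟨y, hy, ?_⟩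
    rw [← h, Matrix.smul_mulVec, Matrix.vecMulVec_mulVec, mul_smul, op_smul_eq_smul]

/-- The matrices `d E_ii` average to the identity and send `x` to `d x_i e_i`. If `L` is bounded by
`M` and contains the `δ`-ball, then `(δ/2M) x_i e_i` lies in `L`; the factor `2` keeps it in the
open ball. -/
lemma exists_isRankOneSymmetric_of_mem_interior (hd : 1 ≤ d) {L : Set (Fin d → ℝ)}
    (hL : Bornology.IsBounded L) (h0 : 0 ∈ interior L) : ∃ C, 0 < C ∧ IsRankOneSymmetric L C := by
  have : Nonempty (Fin d) := ⟨⟨0, hd⟩⟩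
  have hd0 : (0 : ℝ) < d := by exact_mod_cast hd
  obtain ⟨M, hM0, hM⟩ := hL.exists_pos_norm_le
  obtain ⟨δ, hδ, hball⟩ := Metric.mem_nhds_iff.1 (mem_interior_iff_mem_nhds.1 h0)
  refine ⟨2 * d * M / δ, by positivity, isRankOneSymmetric_of_sum_vecMulVec hd0.ne'
    (v := fun i : Fin d => Pi.single i 1) (fun i h => ?_) ?_ fun i x hx => ?_⟩
  · simpa using congrFun h i
  · ext i j
    rw [Fintype.card_fin, div_self hd0.ne', one_smul, Matrix.sum_apply]
    simp [Matrix.vecMulVec_apply, Pi.single_apply, Matrix.one_apply]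
  · refine ⟨(δ / (2 * M) * x i) • Pi.single i 1, hball ?_, ?_⟩
    · have h1 : |x i| ≤ M := (norm_le_pi_norm x i).trans (hM x hx)
      rw [mem_ball_zero_iff, norm_smul, Pi.norm_single, norm_one, mul_one, Real.norm_eq_abs,
        abs_mul, abs_of_pos (by positivity : 0 < δ / (2 * M))]
      calc δ / (2 * M) * |x i| ≤ δ / (2 * M) * M := by gcongr
        _ = δ / 2 := by field_simp
        _ < δ := half_lt_self hδ
    · rw [smul_smul, single_dotProduct, one_mul]
      congr 1
      field_simp

lemma sum_vecMulVec_of_sum_dotProduct_sq {F : Finset (Fin d → ℝ)} {s : ℝ}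
    (hs : ∀ x : Fin d → ℝ, ∑ v ∈ F, (x ⬝ᵥ v) ^ 2 = s * (x ⬝ᵥ x)) :
    ∑ v ∈ F, Matrix.vecMulVec v v = s • (1 : Matrix (Fin d) (Fin d) ℝ) := by
  have h1 : ∀ i, ∑ v ∈ F, v i ^ 2 = s := fun i => by simpa using hs (Pi.single i 1)
  ext i j
  rw [Matrix.sum_apply]
  simp only [Matrix.vecMulVec_apply, Matrix.smul_apply, Matrix.one_apply, smul_eq_mul, mul_ite,
    mul_one, mul_zero]
  split_ifs with hij
  · subst hij
    rw [← h1 i]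
    exact Finset.sum_congr rfl fun v _ => (sq _).symm
  · have h2 := hs (Pi.single i 1 + Pi.single j 1)
    have h3 : ∑ v ∈ F, (v i + v j) ^ 2 = 2 * s := by
      simpa [add_dotProduct, hij, Ne.symm hij, mul_comm, one_add_one_eq_two] using h2
    simp only [add_sq, Finset.sum_add_distrib, h1, mul_assoc, ← Finset.mul_sum] at h3
    linarith

/-- Polarizing the frame identity gives `∑ v vᵀ = s`, whose trace is `|F| r² = s d`. Hence the
matrices `(d/r²) v vᵀ`, which are `d` times the projections, average to the identity. -/
lemma IsTightFrameInvariant.isRankOneSymmetric (hd : 1 ≤ d) {L : Set (Fin d → ℝ)}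
    (hL : IsTightFrameInvariant L) : IsRankOneSymmetric L d := by
  have hd0 : (0 : ℝ) < d := by exact_mod_cast hd
  obtain ⟨F, ⟨⟨r, hr, hrF⟩, s, hs, hsF⟩, hinv⟩ := hL
  have hsum := sum_vecMulVec_of_sum_dotProduct_sq hsF
  have htr : (F.card : ℝ) * r ^ 2 = s * d := by
    have := congrArg Matrix.trace hsum
    rw [Matrix.trace_sum, Finset.sum_congr rfl fun v hv => (Matrix.trace_vecMulVec v v).trans
      (hrF v hv), Finset.sum_const, nsmul_eq_mul, Matrix.trace_smul, Matrix.trace_one] at this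
    simpa using this
  have hF : F.Nonempty := by
    rw [Finset.nonempty_iff_ne_empty]
    rintro rfl
    have : s * (d : ℝ) = 0 := by simpa using htr.symm
    exact (mul_pos hs hd0).ne' this
  have : Nonempty F := hF.to_subtype
  refine isRankOneSymmetric_of_sum_vecMulVec (a := d / r ^ 2) (by positivity)
    (v := fun v : F => v.1) (fun v h => ?_) ?_ fun v x hx => ⟨_, hinv v.1 v.2 x hx, ?_⟩
  · have := hrF v.1 v.2
    rw [h, dotProduct_zero] at this
    exact (pow_pos hr 2).ne this
  · rw [Finset.univ_eq_attach, Finset.sum_attach F fun v => Matrix.vecMulVec v v, hsum,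
      Fintype.card_coe]
    congr 1
    field_simp
    linarith
  · rw [hrF v.1 v.2, smul_smul, dotProduct_comm]
    congr 1
    ring

end RankOneFrames

/-! ### Lower bounds and finiteness of the scales. -/

section Scales

variable {d : ℕ}

/-- Each level has a single empty tuple, and direct sums carry it from level one to all levels. -/
lemma inclusionScale_eq_top_of_dim_zero {S : FreeSet 0} (hS : (S 1).Nonempty) :
    inclusionScale S = ∞ := by
  refine ENNReal.eq_top_of_forall_nnreal_le fun t => le_inclusionScale fun n hn T hT hST X _ => ?_
  obtain ⟨Y, hY⟩ := hS
  have key : ∀ n, 1 ≤ n → ∀ Z : Fin 0 → Matrix (Fin n) (Fin n) ℂ, Z ∈ T n := by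
    intro n hn
    induction n, hn using Nat.le_induction with
    | base =>
      intro Z
      rw [Subsingleton.elim Z Y]
      exact hST hY
    | succ n hn ih =>
      intro Z
      rw [Subsingleton.elim Z fun j => matDirectSum ((0 : Fin 0 → Matrix (Fin n) (Fin n) ℂ) j) (Y j)]
      exact hT.directSum_mem n 1 0 (ih 0) Y (hST hY)
  exact key n hn _

variable {H : Type*} [NormedAddCommGroup H] [InnerProductSpace ℂ H] [CompleteSpace H]

/-- The pencils `1 + aA_i` with `|a| ‖A_i‖ ≤ 1` are positive. If `1 + t a A_i ≥ 0` for all `t`, then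
`aA_i ≥ 0`; both signs of `a` give `A_i = 0`. -/
lemma eq_zero_of_forall_scalarCone_subset {A : Fin d → H →L[ℂ] H} (hA : ∀ i, IsSelfAdjoint (A i))
    (h : ∀ t : ℝ≥0, scalarCone (homog A) ⊆ scalarCone (homog fun i => ((t : ℝ) : ℂ) • A i)) :
    A = 0 := by
  have sum_single : ∀ (B : Fin d → H →L[ℂ] H) (i : Fin d) (a : ℝ) (ξ : H),
      ∑ κ, homog (Pi.single i a : Fin d → ℝ) κ * (⟪ξ, homog B κ ξ⟫_ℂ).re =
        (⟪ξ, ξ⟫_ℂ).re + a * (⟪ξ, B i ξ⟫_ℂ).re := fun B i a ξ => by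
    simp [Fintype.sum_option, Pi.single_apply]
  have upper : ∀ (i : Fin d) (a : ℝ), |a| * ‖A i‖ ≤ 1 → ∀ (t : ℝ≥0) (ξ : H),
      0 ≤ ‖ξ‖ ^ 2 + t * (a * (⟪ξ, A i ξ⟫_ℂ).re) := by
    intro i a ha t ξ
    have h1 := h t (a := homog (Pi.single i a)) (fun ζ => by
      rw [sum_single, inner_self_eq_ofReal, Complex.ofReal_re]
      have h2 : |a * (⟪ζ, A i ζ⟫_ℂ).re| ≤ |a| * (‖A i‖ * ‖ζ‖ ^ 2) := by
        rw [abs_mul]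
        gcongr
        refine abs_le.2 ⟨neg_norm_mul_le_re_inner _ _, ?_⟩
        have := neg_norm_mul_le_re_inner (-A i) ζ
        simp only [norm_neg, _root_.neg_apply, inner_neg_right, Complex.neg_re] at this
        linarith
      have h3 := (abs_le.1 h2).1
      nlinarith [sq_nonneg ‖ζ‖]) ξ
    rw [sum_single, inner_self_eq_ofReal, Complex.ofReal_re, _root_.smul_apply,
      inner_smul_right, Complex.re_ofReal_mul] at h1
    linarith
  have vanish : ∀ (x y : ℝ), (∀ t : ℝ≥0, 0 ≤ x + t * y) → 0 ≤ y := by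
    intro x y hxy
    by_contra! hy
    have h1 := hxy ((|x| + 1) / -y).toNNReal
    rw [Real.coe_toNNReal _ (div_nonneg (by positivity) (by linarith)), div_mul_eq_mul_div,
      mul_div_assoc, div_neg, div_self hy.ne] at h1
    linarith [le_abs_self x]
  funext i
  have hi : ∀ ξ, ⟪ξ, A i ξ⟫_ℂ = 0 := by
    intro ξ
    have hpos : 0 < (‖A i‖ + 1)⁻¹ := by positivity
    have hle : |(‖A i‖ + 1)⁻¹| * ‖A i‖ ≤ 1 := by
      rw [abs_of_pos hpos, inv_mul_le_iff₀ (by positivity)]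
      linarith
    have h1 := vanish _ _ fun t => upper i _ hle t ξ
    have h2 := vanish _ _ fun t => upper i (-(‖A i‖ + 1)⁻¹) (by rwa [abs_neg]) t ξ
    have h3 := nonneg_of_mul_nonneg_right h1 hpos
    rw [neg_mul, neg_nonneg] at h2
    rw [inner_eq_re_of_isSelfAdjoint (hA i),
      le_antisymm (nonpos_of_mul_nonpos_right h2 hpos) h3, Complex.ofReal_zero]
  have h2 : (A i : H →ₗ[ℂ] H) = 0 := (inner_map_self_eq_zero _).1 fun ξ => by
    rw [← inner_conj_symm]
    exact (congrArg _ (hi ξ)).trans (map_zero _)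
  exact ContinuousLinearMap.coe_injective h2

lemma UnitalMapIsCP.scalarCone_subset {K : Type*} [NormedAddCommGroup K] [InnerProductSpace ℂ K]
    [CompleteSpace K] {A : Fin d → H →L[ℂ] H} {B : Fin d → K →L[ℂ] K}
    (hA : ∀ i, IsSelfAdjoint (A i)) (hB : ∀ i, IsSelfAdjoint (B i)) (h : UnitalMapIsCP A B) :
    scalarCone (homog A) ⊆ scalarCone (homog B) := fun _ hc =>
  (scalar_pencil_mem_iff (isSelfAdjoint_homog hB)).1
    ((unitalMapIsCP_iff hA hB).1 h 1 ((scalar_pencil_mem_iff (isSelfAdjoint_homog hA)).2 hc))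

lemma zero_mem_levelOne_polarDual {A : Fin d → H →L[ℂ] H} (hA : ∀ i, IsSelfAdjoint (A i)) :
    (0 : Fin d → ℝ) ∈ levelOne (polarDual (matrixRange A)) :=
  (mem_levelOne_polarDual_iff hA).2 fun y _ => by simp

/-- It suffices to place every `s < t` in the scale sets. Dimension zero is separate because the
cross polytope argument divides by `d`. -/
lemma le_dualInclusionScale {A : Fin d → H →L[ℂ] H} (hA : ∀ i, IsSelfAdjoint (A i))
    (h0 : (0 : Fin d → ℝ) ∈ levelOne (matrixRange A)) {t : ℝ≥0}
    (ht : ∀ (K : Type*) [NormedAddCommGroup K] [InnerProductSpace ℂ K] [CompleteSpace K]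
      (B : Fin d → K →L[ℂ] K), (∀ i, IsSelfAdjoint (B i)) →
        UnitalMapIsPositive A B → UnitalMapIsCP A (fun i => ((t : ℝ) : ℂ) • B i)) :
    (t : ℝ≥0∞) ≤ dualInclusionScale (matrixRange A) := by
  rcases Nat.eq_zero_or_pos d with rfl | hd
  · rw [dualInclusionScale, inclusionScale_eq_top_of_dim_zero ⟨_, zero_mem_levelOne_polarDual hA⟩]
    exact le_top
  refine ENNReal.le_of_forall_nnreal_lt fun s hs => le_inclusionScale fun n hn =>
    mem_inclusionScaleSet_polarDual hA h0 hd hn (ENNReal.coe_lt_coe.1 hs) fun K _ _ _ B hB hAB => ?_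
  exact (unitalMapIsCP_iff hA (isSelfAdjoint_real_smul hB _)).1
    (ht K B hB ((unitalMapIsPositive_iff hA hB).2 hAB))

/-- A single test tuple suffices: the diagonal operators on `ℓ²(W_1(A))`. -/
lemma le_inclusionScale_of_forall_unitalMapIsCP {A : Fin d → H →L[ℂ] H}
    (hA : ∀ i, IsSelfAdjoint (A i)) {t : ℝ≥0}
    (ht : ∀ (K : Type*) [NormedAddCommGroup K] [InnerProductSpace ℂ K] [CompleteSpace K]
      (B : Fin d → K →L[ℂ] K), (∀ i, IsSelfAdjoint (B i)) →
        UnitalMapIsPositive B A → UnitalMapIsCP B (fun i => ((t : ℝ) : ℂ) • A i)) :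
    (t : ℝ≥0∞) ≤ inclusionScale (matrixRange A) := by
  obtain ⟨K, _, _, _, B, hB, hBL, hBC⟩ :=
    exists_diagonal_tuple (isCompact_levelOne_matrixRange hA).isBounded
  refine le_inclusionScale fun n hn => mem_inclusionScaleSet_matrixRange hA hBC ?_ hn
  exact (unitalMapIsCP_iff hB (isSelfAdjoint_real_smul hA _)).1 (ht K B hB
    ((unitalMapIsPositive_iff hB hA).2 fun c hc => (mem_scalarCone_homog_iff hA).2 (hBL c hc)))

/-- The set `L = W_1(A)` serves both bounds: positivity of `B ↦ A` or of `A ↦ B` places it on the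
required side of `B`, and the two operator tuples exchange roles. -/
lemma le_scales_of_isRankOneSymmetric {A : Fin d → H →L[ℂ] H} (hA : ∀ i, IsSelfAdjoint (A i))
    (h0 : (0 : Fin d → ℝ) ∈ levelOne (matrixRange A)) {C : ℝ} (hC : 0 < C)
    (hsym : IsRankOneSymmetric (levelOne (matrixRange A)) C) :
    ENNReal.ofReal (1 / C) ≤ inclusionScale (matrixRange A) ∧
      ENNReal.ofReal (1 / C) ≤ dualInclusionScale (matrixRange A) := by
  have hL := isCompact_levelOne_matrixRange hA
  have e : ((1 / C).toNNReal : ℝ) = 1 / C := Real.coe_toNNReal _ (by positivity)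
  constructor
  · refine le_inclusionScale_of_forall_unitalMapIsCP.{_, 0} hA fun K _ _ _ B hB hBA => ?_
    rw [e]
    exact unitalMapIsCP_of_isRankOneSymmetric hL ⟨0, h0⟩ hC hsym hA hB
      (fun c => (mem_scalarCone_homog_iff hA).2) fun c hc =>
        (mem_scalarCone_homog_iff hA).1 ((unitalMapIsPositive_iff hB hA).1 hBA hc)
  · refine le_dualInclusionScale.{_, 0} hA h0 fun K _ _ _ B hB hAB => ?_
    rw [e]
    exact unitalMapIsCP_of_isRankOneSymmetric hL ⟨0, h0⟩ hC hsym hB hA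
      (fun c hc => (unitalMapIsPositive_iff hA hB).1 hAB ((mem_scalarCone_homog_iff hA).2 hc))
      fun c hc => (mem_scalarCone_homog_iff hA).1 hc

lemma scales_eq_top_of_dim_zero {A : Fin 0 → H →L[ℂ] H} (hA : ∀ i, IsSelfAdjoint (A i))
    (h0 : (0 : Fin 0 → ℝ) ∈ levelOne (matrixRange A)) :
    inclusionScale (matrixRange A) = ∞ ∧ dualInclusionScale (matrixRange A) = ∞ :=
  ⟨inclusionScale_eq_top_of_dim_zero ⟨_, h0⟩,
    inclusionScale_eq_top_of_dim_zero ⟨_, zero_mem_levelOne_polarDual hA⟩⟩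

end Scales

end

theorem theorem9p4 {d : ℕ} {H : Type*} [NormedAddCommGroup H] [InnerProductSpace ℂ H]
    [CompleteSpace H] (A : Fin d → H →L[ℂ] H) (hA : ∀ i, IsSelfAdjoint (A i))
    (h0 : (0 : Fin d → ℝ) ∈ levelOne (matrixRange A)) :
    -- the constants are finite unless `A = 0`
    (A ≠ 0 → dualInclusionScale (matrixRange A) ≠ ∞ ∧ inclusionScale (matrixRange A) ≠ ∞) ∧
    -- `t = σ_S` is the largest constant that works for all positive maps `A_i ↦ B_i`
    (∀ t : ℝ≥0,
      (∀ (K : Type*) [NormedAddCommGroup K] [InnerProductSpace ℂ K] [CompleteSpace K]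
        (B : Fin d → K →L[ℂ] K), (∀ i, IsSelfAdjoint (B i)) →
          UnitalMapIsPositive A B → UnitalMapIsCP A (fun i => ((t : ℝ) : ℂ) • B i)) ↔
        (t : ℝ≥0∞) ≤ dualInclusionScale (matrixRange A)) ∧
    -- `t = ρ_S` is the largest constant that works for all positive maps `B_i ↦ A_i`
    (∀ t : ℝ≥0,
      (∀ (K : Type*) [NormedAddCommGroup K] [InnerProductSpace ℂ K] [CompleteSpace K]
        (B : Fin d → K →L[ℂ] K), (∀ i, IsSelfAdjoint (B i)) →
          UnitalMapIsPositive B A → UnitalMapIsCP B (fun i => ((t : ℝ) : ℂ) • A i)) ↔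
        (t : ℝ≥0∞) ≤ inclusionScale (matrixRange A)) ∧
    -- positivity of both constants
    (0 ∈ interior (levelOne (matrixRange A)) →
      0 < inclusionScale (matrixRange A) ∧ 0 < dualInclusionScale (matrixRange A)) ∧
    -- lower bounds under symmetry
    (∀ C : ℝ, 0 < C → IsRankOneSymmetric (levelOne (matrixRange A)) C →
      ENNReal.ofReal (1 / C) ≤ inclusionScale (matrixRange A) ∧
      ENNReal.ofReal (1 / C) ≤ dualInclusionScale (matrixRange A)) ∧
    (IsTightFrameInvariant (levelOne (matrixRange A)) →
      1 / (d : ℝ≥0∞) ≤ inclusionScale (matrixRange A) ∧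
      1 / (d : ℝ≥0∞) ≤ dualInclusionScale (matrixRange A)) := by
  refine ⟨fun hne => ⟨fun htop => hne ?_, fun htop => hne ?_⟩, fun t => ⟨le_dualInclusionScale hA h0,
    fun ht K _ _ _ B hB hAB => unitalMapIsCP_of_le_dualInclusionScale hA h0 ht hB
      ((unitalMapIsPositive_iff hA hB).1 hAB)⟩, fun t =>
    ⟨le_inclusionScale_of_forall_unitalMapIsCP hA, fun ht K _ _ _ B hB hBA =>
      unitalMapIsCP_of_le_inclusionScale hA h0 ht hB ((unitalMapIsPositive_iff hB hA).1 hBA)⟩,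
    fun hint => ?_, fun C hC hsym => le_scales_of_isRankOneSymmetric hA h0 hC hsym, fun hfr => ?_⟩
  -- An infinite scale, tested on `B = A`, makes `A ↦ tA` completely positive for every `t`.
  · exact eq_zero_of_forall_scalarCone_subset hA fun t =>
      (unitalMapIsCP_of_le_dualInclusionScale hA h0 (htop ▸ le_top) hA subset_rfl).scalarCone_subset
        hA (isSelfAdjoint_real_smul hA _)
  · exact eq_zero_of_forall_scalarCone_subset hA fun t =>
      (unitalMapIsCP_of_le_inclusionScale hA h0 (htop ▸ le_top) hA subset_rfl).scalarCone_subset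
        hA (isSelfAdjoint_real_smul hA _)
  · rcases Nat.eq_zero_or_pos d with rfl | hd
    · obtain ⟨h1, h2⟩ := scales_eq_top_of_dim_zero hA h0
      rw [h1, h2]
      exact ⟨ENNReal.zero_lt_top, ENNReal.zero_lt_top⟩
    · obtain ⟨C, hC, hsym⟩ := exists_isRankOneSymmetric_of_mem_interior hd
        (isCompact_levelOne_matrixRange hA).isBounded hint
      have hpos : 0 < ENNReal.ofReal (1 / C) := ENNReal.ofReal_pos.2 (by positivity)
      obtain ⟨h1, h2⟩ := le_scales_of_isRankOneSymmetric hA h0 hC hsym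
      exact ⟨hpos.trans_le h1, hpos.trans_le h2⟩
  · rcases Nat.eq_zero_or_pos d with rfl | hd
    · obtain ⟨h1, h2⟩ := scales_eq_top_of_dim_zero hA h0
      rw [h1, h2]
      exact ⟨le_top, le_top⟩
    · have hd0 : (0 : ℝ) < d := by exact_mod_cast hd
      have h1 := le_scales_of_isRankOneSymmetric hA h0 hd0 (hfr.isRankOneSymmetric hd)
      rwa [ENNReal.ofReal_div_of_pos hd0, ENNReal.ofReal_one, ENNReal.ofReal_natCast] at h1
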